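/- For $N\ge 1$ let $M=M(N)\ge 0$ be an integer and $\Box_{N,M}=\{(i,j):1\le i\le N,\ 1\le j\le M\}$. An up-right path from $(1,1)$ to $(N,M)$ is a set $\sigma=\{(i_k,j_k):1\le k\le M+N-1\}$ with $(i_1,j_1)=(1,1)$, $(i_{M+N-1},j_{M+N-1})=(N,M)$ and each difference $(i_{k+1}-i_k,\,j_{k+1}-j_k)$ equal to $(1,0)$ or $(0,1)$. Let $\sigma$ be uniformly distributed on a set $\mathcal P_N$ of up-right paths from $(1,1)$ to $(N,M)$ given by one of the following three schemes, whose parameters do not depend on $N$ (in each of them $\mathcal P_N\neq\emptyset$ for all large $N$): 1. $M=\lfloor\xi N\rfloor$ with $\xi>0$, and $\mathcal P_N$ consists of all such paths; 2. $M=\lfloor\xi N\rfloor$ with $\xi>0$, and $\mathcal P_N$ consists of the paths that pass through each of the points $(\lfloor\zeta_iN\rfloor,\lfloor\xi_iN\rfloor)$, $1\le i\le n$, where $0<\xi_1<\dots<\xi_n<\xi$ and $0<\zeta_1<\dots<\zeta_n<1$; 3. $M=N$, and $\mathcal P_N$ consists of the paths that contain no point of the closed axis-parallel square with centre $\left(\frac{N+1}{2},\frac{N+1}{2}\right)$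 and side $\lfloor\beta N\rfloor$, where $\beta\in(0,1)$. For each $N$ let $w^{(N)}=(w^{(N)}_{i,j})_{(i,j)\in\Box_{N,M}}$ be independent real random variables with mean $0$, variance $1$ and $\mathbb E|w^{(N)}_{i,j}|^p\le K$, where $p$ and $K<\infty$ do not depend on $N,i,j$. The arrays for all $N$ are defined on one probability space $(\Omega,\mathbb P_w)$, and nothing is assumed about the joint law of arrays with different $N$ (in particular, they may be restrictions of a single infinite array). The path $\sigma$ is chosen independently of the weights. Let $\mu_N$ be the quenched law of the normalized path sum, that is, the random probability measure (defined for all large $N$) $$\mu_N=\frac1{|\mathcal P_N|}\sum_{\sigma\in\mathcal P_N}\delta_{S_N(\sigma)},\qquad S_N(\sigma)=\frac1{\sqrt{M+N-1}}\sum_{(i,j)\in\sigma}w^{(N)}_{i,j}.$$ **Theorem 1.2.** (a) If $p>8$, then $\mu_N$ converges to $\mathcal N(0,1)$ weakly in probability as $N\to\infty$: for every bounded continuous $f:\mathbb R\to\mathbb R$ and every $\varepsilon>0$, $$\mathbb P_w\left[\left|\int f\,d\mu_N-\int f\,d\mathcal N(0,1)\right|>\varepsilon\right]\to0.$$ (b)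 If $p>12$, then, for $\mathbb P_w$-almost every realization of the weights, $\mu_N$ converges in distribution to $\mathcal N(0,1)$ as $N\to\infty$. -/

import Mathlib

open MeasureTheory ProbabilityTheory Filter Topology
open scoped NNReal ENNReal BoundedContinuousFunction

/-- The grid of points `(i, j)` with `1 ≤ i ≤ N` and `1 ≤ j ≤ M`. -/
def gridBox (N M : ℕ) : Finset (ℕ × ℕ) :=
  Finset.Icc 1 N ×ˢ Finset.Icc 1 M

/-- `σ` is the set of points of an up-right path `γ 1, …, γ (N + M - 1)` from `(1, 1)` to
`(N, M)`, each step of which is `(1, 0)` or `(0, 1)`. -/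
def IsUpRightPath (N M : ℕ) (σ : Finset (ℕ × ℕ)) : Prop :=
  ∃ γ : ℕ → ℕ × ℕ, γ 1 = (1, 1) ∧ γ (N + M - 1) = (N, M) ∧
    (∀ k, 1 ≤ k → k < N + M - 1 → γ (k + 1) = γ k + (1, 0) ∨ γ (k + 1) = γ k + (0, 1)) ∧
    σ = (Finset.Icc 1 (N + M - 1)).image γ

/-- The three ways of choosing the path in the corner growth setting, with their parameters. -/
inductive PathScheme : Type
  /-- All up-right paths from `(1, 1)` to `(N, ⌊ξ N⌋)`. -/
  | unrestricted (ξ : ℝ) (hξ : 0 < ξ) : PathScheme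
  /-- The up-right paths from `(1, 1)` to `(N, ⌊ξ N⌋)` that pass through each of the points
  `(⌊y i * N⌋, ⌊x i * N⌋)`, where `0 < x 0 < x 1 < ⋯ < ξ` and `0 < y 0 < y 1 < ⋯ < 1`. -/
  | throughPoints (ξ : ℝ) (hξ : 0 < ξ) (n : ℕ) (x y : Fin n → ℝ)
      (hx : StrictMono x) (hy : StrictMono y)
      (hx_mem : ∀ i, 0 < x i ∧ x i < ξ) (hy_mem : ∀ i, 0 < y i ∧ y i < 1) : PathScheme
  /-- The up-right paths from `(1, 1)` to `(N, N)` that avoid the square of side `⌊β N⌋` centred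
  at the centre of the grid. -/
  | avoidSquare (β : ℝ) (hβ : 0 < β ∧ β < 1) : PathScheme

/-- The second side length `M = M(N)` of the grid. -/
noncomputable def PathScheme.height : PathScheme → ℕ → ℕ
  | .unrestricted ξ _, N => ⌊ξ * N⌋₊
  | .throughPoints ξ _ _ _ _ _ _ _ _, N => ⌊ξ * N⌋₊
  | .avoidSquare _ _, N => N

/-- The lattice points of the closed square with side `s` whose centre is
`((N + 1) / 2, (N + 1) / 2)`, the centre of the `N × N` grid. -/
def InCentralSquare (N s : ℕ) (a : ℕ × ℕ) : Prop :=
  |(a.1 : ℝ) - ((N : ℝ) + 1) / 2| ≤ (s : ℝ) / 2 ∧ |(a.2 : ℝ) - ((N : ℝ) + 1) / 2| ≤ (s : ℝ) / 2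

/-- The additional restriction which the scheme puts on the path, for a given `N`. -/
def PathScheme.Restriction : PathScheme → ℕ → Finset (ℕ × ℕ) → Prop
  | .unrestricted _ _, _, _ => True
  | .throughPoints _ _ _ x y _ _ _ _, N, σ => ∀ i, (⌊y i * N⌋₊, ⌊x i * N⌋₊) ∈ σ
  | .avoidSquare β _, N, σ => ∀ a ∈ σ, ¬ InCentralSquare N ⌊β * N⌋₊ a

/-- The grid that carries the weights. -/
noncomputable def PathScheme.box (S : PathScheme) (N : ℕ) : Finset (ℕ × ℕ) :=
  gridBox N (S.height N)

open Classical in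
/-- The finite set of paths from which `σ` is chosen uniformly. -/
noncomputable def PathScheme.paths (S : PathScheme) (N : ℕ) : Finset (Finset (ℕ × ℕ)) :=
  (S.box N).powerset.filter fun σ => IsUpRightPath N (S.height N) σ ∧ S.Restriction N σ

/-- The normalized path sum `(M + N - 1)^(-1/2) ∑_{a ∈ σ} v a` for fixed weights `v`. -/
noncomputable def PathScheme.pathSum (S : PathScheme) (N : ℕ) (v : ℕ × ℕ → ℝ)
    (σ : Finset (ℕ × ℕ)) : ℝ :=
  1 / √((S.height N : ℝ) + (N : ℝ) - 1) * ∑ a ∈ σ, v a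

/-- The law of the normalized path sum for fixed weights `v`, when `σ` is uniformly distributed on
`S.paths N`. It is a probability measure as soon as there is a path; for the finitely many `N`
without any path it is the zero measure. -/
noncomputable def PathScheme.quenchedMeasure (S : PathScheme) (N : ℕ) (v : ℕ × ℕ → ℝ) :
    Measure ℝ :=
  ((S.paths N).card : ℝ≥0∞)⁻¹ • ∑ σ ∈ S.paths N, Measure.dirac (S.pathSum N v σ)

theorem PathScheme.isProbabilityMeasure_quenchedMeasure (S : PathScheme) (N : ℕ)
    (v : ℕ × ℕ → ℝ) (h : (S.paths N).Nonempty) :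
    IsProbabilityMeasure (S.quenchedMeasure N v) := by
  constructor
  have h0 : ((S.paths N).card : ℝ≥0∞) ≠ 0 := by
    simpa using h.ne_empty
  simp [PathScheme.quenchedMeasure, Measure.finsetSum_apply,
    ENNReal.inv_mul_cancel h0 (ENNReal.natCast_ne_top _)]

instance PathScheme.isFiniteMeasure_quenchedMeasure (S : PathScheme) (N : ℕ)
    (v : ℕ × ℕ → ℝ) : IsFiniteMeasure (S.quenchedMeasure N v) := by
  rcases (S.paths N).eq_empty_or_nonempty with h | h
  · have h0 : S.quenchedMeasure N v = 0 := by simp [PathScheme.quenchedMeasure, h]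
    rw [h0]
    infer_instance
  · have := S.isProbabilityMeasure_quenchedMeasure N v h
    infer_instance

/-- The quenched law of the normalized path sum as a point of the space of finite measures, which
carries the topology of weak convergence. -/
noncomputable def PathScheme.quenchedLaw (S : PathScheme) (N : ℕ) (v : ℕ × ℕ → ℝ) :
    FiniteMeasure ℝ :=
  ⟨S.quenchedMeasure N v, S.isFiniteMeasure_quenchedMeasure N v⟩

/-- The standard normal distribution. -/
noncomputable def stdNormal : FiniteMeasure ℝ :=
  ⟨gaussianReal 0 1, inferInstance⟩

/-- Weak convergence in probability of random measures `μ N` to `ν`, with the bounded continuous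
functions as test functions. -/
def ConvergesWeaklyInProbability {Ω : Type*} [MeasurableSpace Ω] (P : Measure Ω)
    (μ : ℕ → Ω → FiniteMeasure ℝ) (ν : FiniteMeasure ℝ) : Prop :=
  ∀ f : ℝ →ᵇ ℝ, ∀ ε : ℝ, 0 < ε →
    Tendsto (fun N : ℕ =>
        P {ω | ε < |(∫ t, f t ∂(μ N ω : Measure ℝ)) - ∫ t, f t ∂(ν : Measure ℝ)|})
      atTop (𝓝 0)

/-! For a bounded Lipschitz test function `f`, the quenched average of `f` is a function of the
independent weights. With L = M + N - 1, changing the weight at `a` by h changes this average by at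
most a constant times P(a ∈ σ)|h|/√L. The sum of the squares of these Lipschitz constants is
therefore of the order of 1/L times ∑ₐ P(a ∈ σ)², which is the expected number of common points of
two independent paths.

This expected overlap is O(√N) (`PathScheme.exists_hasSmallOverlap`). Fix the steps outside a block
of times [u, v) and the number of right steps inside it. If the family of paths allows it, the right
steps inside the block then form a uniform subset of fixed size, and the position at time k is
hypergeometric. Its atoms are of order (1/(k-u+1) + 1/(v-k+1))^(1/2) as long as the block has a
positive density of both kinds of steps (`choose_mul_choose_le`), and the sum over k is of order
√(v-u). For prescribed points the blocks are the stretches between them. For the forbidden square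
they are the two halves of the path, and there the density is controlled only on average.

A sixth moment inequality for coordinatewise Lipschitz functions (`integral_pi_sub_integral_pow_le`)
then gives a centred sixth moment O(N^(-3/2)) for the quenched average. This is summable, so the
quenched average minus its mean tends to 0 almost surely, whatever the joint law for different N.
The mean is an average over paths of expectations along a fixed path. Every path has L points, so
the central limit theorem, with an explicit error for characteristic functions, is uniform over the
paths.

Taking cosines and sines for `f` gives almost sure convergence of the characteristic functions at
all rational points. Truncated absolute values for `f` give the equicontinuity that extends this to
all real points. Six moments are enough for this argument, and convergence in probability follows
from almost sure convergence. -/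

/-! ### Sixth moments of Lipschitz functions of independent variables -/

/-- The term linear in `d` is kept exact, because it integrates to 0 when `d` is centred. The other
odd powers of `d` are absorbed into their even neighbours by 2xd ≤ x² + d². -/
theorem add_pow_four_le (x d : ℝ) :
    (x + d) ^ 4 ≤ x ^ 4 + 4 * x ^ 3 * d + 8 * x ^ 2 * d ^ 2 + 3 * d ^ 4 := by
  nlinarith [sq_nonneg (d * (x - d))]

theorem add_pow_six_le (x d : ℝ) :
    (x + d) ^ 6 ≤ x ^ 6 + 6 * x ^ 5 * d + 25 * x ^ 4 * d ^ 2 + 28 * x ^ 2 * d ^ 4 + 4 * d ^ 6 := by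
  nlinarith [sq_nonneg (x * d * (x - d)), sq_nonneg (d ^ 2 * (x - d))]

theorem integrable_of_measurable_of_abs_le {α : Type*} [MeasurableSpace α] {μ : Measure α}
    [IsFiniteMeasure μ] {f : α → ℝ} (hf : Measurable f) {B : ℝ} (hB : ∀ x, |f x| ≤ B) :
    Integrable f μ :=
  Integrable.of_bound hf.aestronglyMeasurable B (Eventually.of_forall hB)

theorem integral_add_mul_add_mul_add_const {α : Type*} [MeasurableSpace α] {μ : Measure α}
    [IsProbabilityMeasure μ] {f g h : α → ℝ} (hf : Integrable f μ) (hg : Integrable g μ)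
    (hh : Integrable h μ) (a b e : ℝ) :
    ∫ x, (f x + a * g x + b * h x + e) ∂μ
      = ∫ x, f x ∂μ + a * ∫ x, g x ∂μ + b * ∫ x, h x ∂μ + e := by
  have i1 := hf.add (hg.const_mul a)
  have i2 := i1.add (hh.const_mul b)
  have e3 := integral_add i2 (integrable_const e)
  have e2 := integral_add i1 (hh.const_mul b)
  have e1 := integral_add hf (hg.const_mul a)
  simp only [Pi.add_apply] at e1 e2 e3
  rw [e3, e2, e1, integral_const_mul, integral_const_mul]
  simp

/-- A constant that bounds the centred moments of order at most six of a random variable with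
sixth absolute moment at most `K`. -/
noncomputable def centredMomentBound (K : ℝ) : ℝ := 1 + 32 * (K + (1 + K) ^ 6)

/-- Averaging the Lipschitz bound over an independent copy gives |h(x) - ∫ h| ≤ c(|x| + ∫ |y|).
Boundedness of `h` serves integrability only, and `B` does not enter the estimate. -/
theorem integral_sub_integral_pow_le {μ : Measure ℝ} [IsProbabilityMeasure μ] {K : ℝ}
    (hi : Integrable (fun x : ℝ => x ^ 6) μ) (hK : ∫ x, x ^ 6 ∂μ ≤ K)
    {h : ℝ → ℝ} (hm : Measurable h) {B : ℝ} (hB : ∀ x, |h x| ≤ B) {c : ℝ} (hc : 0 ≤ c)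
    (hL : ∀ x y, |h x - h y| ≤ c * |x - y|) {j : ℕ} (hj : Even j) (hj6 : j ≤ 6) :
    ∫ x, (h x - ∫ y, h y ∂μ) ^ j ∂μ ≤ centredMomentBound K * c ^ j := by
  have habs : ∀ x : ℝ, |x| ≤ 1 + x ^ 6 := fun x => by
    rw [← Even.pow_abs (by decide : Even 6) x]
    rcases le_total |x| 1 with h1 | h1
    · have := pow_nonneg (abs_nonneg x) 6; linarith
    · have := le_self_pow₀ h1 (by norm_num : 6 ≠ 0); linarith
  have hi1 : Integrable (fun x : ℝ => |x|) μ := by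
    refine Integrable.mono' ((integrable_const 1).add hi) (by fun_prop) (.of_forall fun x => ?_)
    simpa using habs x
  set m := ∫ x, |x| ∂μ with hmdef
  have hm0 : 0 ≤ m := integral_nonneg fun x => abs_nonneg x
  have hm1 : m ≤ 1 + K := by
    calc m ≤ ∫ x, (1 + x ^ 6) ∂μ := integral_mono hi1 ((integrable_const 1).add hi) habs
      _ = 1 + ∫ x, x ^ 6 ∂μ := by rw [integral_add (integrable_const 1) hi]; simp
      _ ≤ _ := by linarith
  have hint : Integrable h μ := integrable_of_measurable_of_abs_le hm hB
  have hD : ∀ x, |h x - ∫ y, h y ∂μ| ≤ c * (|x| + m) := fun x => by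
    have e : h x - ∫ y, h y ∂μ = ∫ y, (h x - h y) ∂μ := by
      rw [integral_sub (integrable_const _) hint]; simp
    rw [e]
    calc |∫ y, (h x - h y) ∂μ| ≤ ∫ y, |h x - h y| ∂μ := abs_integral_le_integral_abs
      _ ≤ ∫ y, c * (|x| + |y|) ∂μ := by
          refine integral_mono ((integrable_const _).sub hint).abs
            (((integrable_const _).add hi1).const_mul c) fun y => (hL x y).trans ?_
          exact mul_le_mul_of_nonneg_left (abs_sub _ _) hc
      _ = _ := by
          rw [integral_const_mul, integral_add (integrable_const _) hi1]; simp [hmdef]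
  have hpt : ∀ x, (h x - ∫ y, h y ∂μ) ^ j ≤ c ^ j * (1 + 32 * (x ^ 6 + m ^ 6)) := fun x => by
    rw [← Even.pow_abs hj]
    refine (pow_le_pow_left₀ (abs_nonneg _) (hD x) j).trans ?_
    rw [mul_pow]
    refine mul_le_mul_of_nonneg_left ?_ (pow_nonneg hc j)
    have h0 : 0 ≤ |x| + m := by positivity
    have h1 : (|x| + m) ^ j ≤ 1 + (|x| + m) ^ 6 := by
      rcases le_total (|x| + m) 1 with h1 | h1
      · have := pow_le_one₀ h0 h1 (n := j)
        have := pow_nonneg h0 6; linarith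
      · have := pow_le_pow_right₀ h1 hj6; linarith
    have h2 := add_pow_le (abs_nonneg x) hm0 6
    rw [Even.pow_abs (by decide : Even 6)] at h2
    norm_num at h2
    linarith
  have hle : ∫ x, (h x - ∫ y, h y ∂μ) ^ j ∂μ ≤ ∫ x, c ^ j * (1 + 32 * (x ^ 6 + m ^ 6)) ∂μ := by
    refine integral_mono_of_nonneg (.of_forall fun x => hj.pow_nonneg _) ?_ (.of_forall hpt)
    fun_prop
  refine hle.trans ?_
  rw [integral_const_mul, mul_comm]
  refine mul_le_mul_of_nonneg_right ?_ (pow_nonneg hc j)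
  rw [integral_add (integrable_const _) (by fun_prop), integral_const_mul,
    integral_add hi (integrable_const _)]
  have := pow_le_pow_left₀ hm0 hm1 6
  simp only [integral_const, probReal_univ, smul_eq_mul, one_mul, centredMomentBound]
  linarith

/-- One step of the moment recursion: `X` is the part of the deviation already fixed by the other
coordinates, and `D` is the centred contribution of a new one. -/
theorem integral_add_pow_le {μ : Measure ℝ} [IsProbabilityMeasure μ] {A : ℝ}
    {D : ℝ → ℝ} (hm : Measurable D) {B : ℝ} (hB : ∀ x, |D x| ≤ B) {c : ℝ}
    (h0 : ∫ x, D x ∂μ = 0)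
    (h2 : ∫ x, D x ^ 2 ∂μ ≤ A * c ^ 2) (h4 : ∫ x, D x ^ 4 ∂μ ≤ A * c ^ 4)
    (h6 : ∫ x, D x ^ 6 ∂μ ≤ A * c ^ 6) (X : ℝ) :
    ∫ x, (X + D x) ^ 2 ∂μ ≤ X ^ 2 + A * c ^ 2 ∧
    ∫ x, (X + D x) ^ 4 ∂μ ≤ X ^ 4 + 8 * A * c ^ 2 * X ^ 2 + 3 * A * c ^ 4 ∧
    ∫ x, (X + D x) ^ 6 ∂μ ≤ X ^ 6 + 25 * A * c ^ 2 * X ^ 4 + 28 * A * c ^ 4 * X ^ 2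
      + 4 * A * c ^ 6 := by
  have hi : ∀ j : ℕ, Integrable (fun x => D x ^ j) μ := fun j =>
    integrable_of_measurable_of_abs_le (hm.pow_const j) (B := B ^ j) fun x => by
      rw [abs_pow]; exact pow_le_pow_left₀ (abs_nonneg _) (hB x) j
  have hi1 : Integrable D μ := by simpa using hi 1
  have hiX : ∀ j : ℕ, Integrable (fun x => (X + D x) ^ j) μ := fun j =>
    integrable_of_measurable_of_abs_le ((hm.const_add X).pow_const j) (B := (|X| + B) ^ j)
      fun x => by
        rw [abs_pow]
        exact pow_le_pow_left₀ (abs_nonneg _) ((abs_add_le _ _).trans (by linarith [hB x])) j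
  have key : ∀ a b e g k : ℝ,
      Integrable (fun x => a + b * D x + e * D x ^ 2 + g * D x ^ 4 + k * D x ^ 6) μ ∧
      ∫ x, (a + b * D x + e * D x ^ 2 + g * D x ^ 4 + k * D x ^ 6) ∂μ =
        a + e * ∫ x, D x ^ 2 ∂μ + g * ∫ x, D x ^ 4 ∂μ + k * ∫ x, D x ^ 6 ∂μ := by
    intro a b e g k
    have i0 : Integrable (fun _ : ℝ => a) μ := integrable_const _
    have i1 := i0.add (hi1.const_mul b)
    have i2 := i1.add ((hi 2).const_mul e)
    have i3 := i2.add ((hi 4).const_mul g)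
    have i4 := i3.add ((hi 6).const_mul k)
    refine ⟨i4, ?_⟩
    have e4 := integral_add i3 ((hi 6).const_mul k)
    have e3 := integral_add i2 ((hi 4).const_mul g)
    have e2 := integral_add i1 ((hi 2).const_mul e)
    have e1 := integral_add i0 (hi1.const_mul b)
    simp only [Pi.add_apply] at e1 e2 e3 e4
    rw [e4, e3, e2, e1]
    simp only [integral_const_mul, h0]
    simp
  refine ⟨?_, ?_, ?_⟩
  · obtain ⟨_, k2⟩ := key (X ^ 2) (2 * X) 1 0 0
    calc ∫ x, (X + D x) ^ 2 ∂μ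
        = ∫ x, (X ^ 2 + 2 * X * D x + 1 * D x ^ 2 + 0 * D x ^ 4 + 0 * D x ^ 6) ∂μ :=
          integral_congr_ae (.of_forall fun x => by ring)
      _ ≤ _ := by rw [k2]; linarith
  · obtain ⟨k1, k2⟩ := key (X ^ 4) (4 * X ^ 3) (8 * X ^ 2) 3 0
    calc ∫ x, (X + D x) ^ 4 ∂μ
        ≤ ∫ x, (X ^ 4 + 4 * X ^ 3 * D x + 8 * X ^ 2 * D x ^ 2 + 3 * D x ^ 4 + 0 * D x ^ 6) ∂μ :=
          integral_mono (hiX 4) k1 fun x => by have := add_pow_four_le X (D x); simp only; linarith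
      _ ≤ _ := by
          rw [k2]
          have := mul_le_mul_of_nonneg_left h2 (by positivity : 0 ≤ 8 * X ^ 2)
          linarith
  · obtain ⟨k1, k2⟩ := key (X ^ 6) (6 * X ^ 5) (25 * X ^ 4) (28 * X ^ 2) 4
    calc ∫ x, (X + D x) ^ 6 ∂μ
        ≤ ∫ x, (X ^ 6 + 6 * X ^ 5 * D x + 25 * X ^ 4 * D x ^ 2 + 28 * X ^ 2 * D x ^ 4
            + 4 * D x ^ 6) ∂μ :=
          integral_mono (hiX 6) k1 fun x => by have := add_pow_six_le X (D x); simp only; linarith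
      _ ≤ _ := by
          rw [k2]
          have := mul_le_mul_of_nonneg_left h2 (by positivity : 0 ≤ 25 * X ^ 4)
          have := mul_le_mul_of_nonneg_left h4 (by positivity : 0 ≤ 28 * X ^ 2)
          linarith

theorem Fin.integral_pi_succ {n : ℕ} (μ : Fin (n + 1) → Measure ℝ)
    [∀ i, IsProbabilityMeasure (μ i)] {F : (Fin (n + 1) → ℝ) → ℝ} (hF : Measurable F) {B : ℝ}
    (hB : ∀ x, |F x| ≤ B) :
    ∫ x, F x ∂Measure.pi μ =
      ∫ y, ∫ x, F (Fin.cons x y) ∂μ 0 ∂Measure.pi fun i => μ (Fin.succ i) := by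
  have hmp := (measurePreserving_piFinSuccAbove μ 0).symm
  rw [← hmp.integral_comp (MeasurableEquiv.measurableEmbedding _), integral_prod_symm]
  · simp only [MeasurableEquiv.piFinSuccAbove, MeasurableEquiv.symm_mk, MeasurableEquiv.coe_mk,
      Fin.insertNthEquiv, Equiv.symm_symm, Equiv.coe_fn_mk,
      Fin.insertNth_zero', Fin.zero_succAbove]
  · refine integrable_of_measurable_of_abs_le (hF.comp (MeasurableEquiv.measurable _)) (B := B) ?_
    exact fun x => hB _

/-- Integrate out the first coordinate to get `G`, which has the same Lipschitz constants in the
remaining ones. Given these, F - G is centred with moments controlled by `c 0`, and G - m is handled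
by induction. The three exponents go together because the bound for each power uses those for the
lower even powers. -/
theorem integral_pi_sub_integral_pow_le {K : ℝ} (hK0 : 0 ≤ K) {n : ℕ} (μ : Fin n → Measure ℝ)
    [∀ i, IsProbabilityMeasure (μ i)] (hi : ∀ i, Integrable (fun x : ℝ => x ^ 6) (μ i))
    (hK : ∀ i, ∫ x, x ^ 6 ∂(μ i) ≤ K) {F : (Fin n → ℝ) → ℝ} (hF : Measurable F) {B : ℝ}
    (hB : ∀ x, |F x| ≤ B) {c : Fin n → ℝ} (hc : ∀ i, 0 ≤ c i)
    (hL : ∀ i x y, |F (Function.update x i y) - F x| ≤ c i * |y - x i|) :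
    ∫ x, (F x - ∫ y, F y ∂Measure.pi μ) ^ 2 ∂Measure.pi μ
      ≤ centredMomentBound K * ∑ i, c i ^ 2 ∧
    ∫ x, (F x - ∫ y, F y ∂Measure.pi μ) ^ 4 ∂Measure.pi μ
      ≤ 4 * centredMomentBound K ^ 2 * (∑ i, c i ^ 2) ^ 2 ∧
    ∫ x, (F x - ∫ y, F y ∂Measure.pi μ) ^ 6 ∂Measure.pi μ
      ≤ 34 * centredMomentBound K ^ 3 * (∑ i, c i ^ 2) ^ 3 := by
  set A := centredMomentBound K with hA
  have hA1 : 1 ≤ A := by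
    have : 0 ≤ 32 * (K + (1 + K) ^ 6) := by positivity
    rw [hA, centredMomentBound]; linarith
  induction n with
  | zero =>
    have : ∀ x, F x - ∫ y, F y ∂Measure.pi μ = 0 := fun x => by
      have e : ∀ y, F y = F x := fun y => by rw [Subsingleton.elim y x]
      simp [e]
    simp [this]
  | succ n ih =>
    set ν := Measure.pi fun i : Fin n => μ i.succ with hν
    set G : (Fin n → ℝ) → ℝ := fun y => ∫ x, F (Fin.cons x y) ∂μ 0 with hG
    have hcons : Measurable fun q : ℝ × (Fin n → ℝ) => (Fin.cons q.1 q.2 : Fin (n + 1) → ℝ) := by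
      refine measurable_pi_iff.2 fun i => ?_
      refine Fin.cases ?_ (fun i => ?_) i
      · simpa using measurable_fst
      · simp only [Fin.cons_succ]; fun_prop
    have hFc : ∀ y, Measurable fun x => F (Fin.cons x y) := fun y =>
      hF.comp (hcons.comp (measurable_id.prodMk measurable_const))
    have hGm : Measurable G := by
      have : StronglyMeasurable fun q : ℝ × (Fin n → ℝ) => F (Fin.cons q.1 q.2) :=
        (hF.comp hcons).stronglyMeasurable
      exact (this.integral_prod_left' (μ := μ 0)).measurable
    have hint : ∀ y, Integrable (fun x => F (Fin.cons x y)) (μ 0) := fun y =>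
      integrable_of_measurable_of_abs_le (hFc y) fun x => hB _
    have hGB : ∀ y, |G y| ≤ B := fun y => by
      refine abs_integral_le_integral_abs.trans ?_
      refine (integral_mono (hint y).abs (integrable_const B) fun x => hB _).trans ?_
      simp
    have hGL : ∀ i y z, |G (Function.update y i z) - G y| ≤ c i.succ * |z - y i| := by
      intro i y z
      simp only [hG]
      rw [← integral_sub (hint _) (hint _)]
      refine abs_integral_le_integral_abs.trans ?_
      refine (integral_mono ((hint _).sub (hint _)).abs (integrable_const (c i.succ * |z - y i|))
        fun x => ?_).trans ?_
      · have := hL i.succ (Fin.cons x y) z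
        simp only [Fin.cons_succ] at this
        simpa only [Pi.sub_apply, Fin.cons_update] using this
      · simp
    obtain ⟨g2, g4, g6⟩ := ih (fun i => μ i.succ) (fun i => hi _) (fun i => hK _) hGm hGB
      (fun i => hc i.succ) hGL
    have hmean : ∫ y, F y ∂Measure.pi μ = ∫ y, G y ∂ν := Fin.integral_pi_succ μ hF hB
    rw [hmean]
    set m := ∫ y, G y ∂ν with hm
    have hB0 : 0 ≤ B := (abs_nonneg _).trans (hB 0)
    have hmB : |m| ≤ B := by
      refine abs_integral_le_integral_abs.trans ?_
      have hGi : Integrable G ν := integrable_of_measurable_of_abs_le hGm hGB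
      refine (integral_mono hGi.abs (integrable_const B) fun x => hGB _).trans ?_
      simp
    have hstep : ∀ y, _ := fun y => by
      have hL0 : ∀ x z, |F (Fin.cons x y) - F (Fin.cons z y)| ≤ c 0 * |x - z| := fun x z => by
        have := hL 0 (Fin.cons z y) x
        rwa [Fin.update_cons_zero, Fin.cons_zero] at this
      have hj := fun j (hj : Even j) (hj6 : j ≤ 6) =>
        integral_sub_integral_pow_le (hi 0) (hK 0) (hFc y) (fun x => hB _) (hc 0) hL0 hj hj6
      refine integral_add_pow_le (μ := μ 0) (A := A) (c := c 0)
        (D := fun x => F (Fin.cons x y) - G y) ((hFc y).sub_const _) (B := B + B) (fun x => ?_) ?_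
        (hj 2 (by decide) (by norm_num)) (hj 4 (by decide) (by norm_num))
        (hj 6 (by decide) (by norm_num)) (G y - m)
      · exact (abs_sub _ _).trans (add_le_add (hB _) (hGB _))
      · rw [integral_sub (hint y) (integrable_const _)]; simp [hG]
    simp only [show ∀ x y, G y - m + (F (Fin.cons x y) - G y) = F (Fin.cons x y) - m from
      fun x y => by ring] at hstep
    have hpow : ∀ j : ℕ, ∫ x, (F x - m) ^ j ∂Measure.pi μ
        = ∫ y, ∫ x, (F (Fin.cons x y) - m) ^ j ∂μ 0 ∂ν := fun j =>
      Fin.integral_pi_succ μ (F := fun x => (F x - m) ^ j) ((hF.sub_const m).pow_const j)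
        (B := (B + B) ^ j) fun x => by
          rw [abs_pow]
          exact pow_le_pow_left₀ (abs_nonneg _) ((abs_sub _ _).trans (add_le_add (hB _) hmB)) j
    have hGi : ∀ j : ℕ, Integrable (fun y => (G y - m) ^ j) ν := fun j =>
      integrable_of_measurable_of_abs_le ((hGm.sub_const m).pow_const j) (B := (B + B) ^ j)
        fun y => by
          rw [abs_pow]
          exact pow_le_pow_left₀ (abs_nonneg _) ((abs_sub _ _).trans (add_le_add (hGB _) hmB)) j
    set V := ∑ i : Fin n, c i.succ ^ 2 with hV
    have hV0 : 0 ≤ V := Finset.sum_nonneg fun i _ => sq_nonneg _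
    rw [hpow, hpow, hpow, Fin.sum_univ_succ, ← hV]
    have hev : ∀ j, Even j → ∀ᵐ y ∂ν, 0 ≤ ∫ x, (F (Fin.cons x y) - m) ^ j ∂μ 0 := fun j hj =>
      .of_forall fun y => integral_nonneg fun x => hj.pow_nonneg _
    set d := c 0 ^ 2 with hd
    have hd0 : 0 ≤ d := sq_nonneg _
    have hd4 : c 0 ^ 4 = d ^ 2 := by rw [hd]; ring
    have hd6 : c 0 ^ 6 = d ^ 3 := by rw [hd]; ring
    simp only [hd4, hd6] at hstep
    refine ⟨?_, ?_, ?_⟩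
    · calc ∫ y, ∫ x, (F (Fin.cons x y) - m) ^ 2 ∂μ 0 ∂ν
          ≤ ∫ y, ((G y - m) ^ 2 + A * d) ∂ν :=
            integral_mono_of_nonneg (hev 2 (by decide)) ((hGi 2).add (integrable_const _))
              (.of_forall fun y => (hstep y).1)
        _ = ∫ y, (G y - m) ^ 2 ∂ν + A * d := by
            rw [integral_add (hGi 2) (integrable_const _)]; simp
        _ ≤ _ := by linarith
    · calc ∫ y, ∫ x, (F (Fin.cons x y) - m) ^ 4 ∂μ 0 ∂ν
          ≤ ∫ y, ((G y - m) ^ 4 + 8 * A * d * (G y - m) ^ 2 + 3 * A * d ^ 2) ∂ν :=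
            integral_mono_of_nonneg (hev 4 (by decide))
              (((hGi 4).add ((hGi 2).const_mul _)).add (integrable_const _))
              (.of_forall fun y => (hstep y).2.1)
        _ = ∫ y, (G y - m) ^ 4 ∂ν + 8 * A * d * ∫ y, (G y - m) ^ 2 ∂ν + 3 * A * d ^ 2 := by
            simpa using integral_add_mul_add_mul_add_const (hGi 4) (hGi 2) (hGi 2)
              (8 * A * d) 0 (3 * A * d ^ 2)
        -- The constant 4 makes the mixed term 8A²Vd exactly that of 4A²(V + d)².
        _ ≤ 4 * A ^ 2 * V ^ 2 + 8 * A * d * (A * V) + 3 * A * d ^ 2 := by gcongr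
        _ ≤ _ := by
            have : A ≤ A ^ 2 := by nlinarith
            have := mul_le_mul_of_nonneg_right this (sq_nonneg d)
            have : 0 ≤ A ^ 2 * d ^ 2 := by positivity
            nlinarith
    · calc ∫ y, ∫ x, (F (Fin.cons x y) - m) ^ 6 ∂μ 0 ∂ν
          ≤ ∫ y, ((G y - m) ^ 6 + 25 * A * d * (G y - m) ^ 4 + 28 * A * d ^ 2 * (G y - m) ^ 2
              + 4 * A * d ^ 3) ∂ν :=
            integral_mono_of_nonneg (hev 6 (by decide))
              ((((hGi 6).add ((hGi 4).const_mul _)).add ((hGi 2).const_mul _)).add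
                (integrable_const _)) (.of_forall fun y => (hstep y).2.2)
        _ = ∫ y, (G y - m) ^ 6 ∂ν + 25 * A * d * ∫ y, (G y - m) ^ 4 ∂ν
              + 28 * A * d ^ 2 * ∫ y, (G y - m) ^ 2 ∂ν + 4 * A * d ^ 3 := by
            exact integral_add_mul_add_mul_add_const (hGi 6) (hGi 4) (hGi 2) _ _ _
        -- The term in dV² has coefficient 25 · 4 = 100, and 34 is the least integer whose triple
        -- reaches it.
        _ ≤ 34 * A ^ 3 * V ^ 3 + 25 * A * d * (4 * A ^ 2 * V ^ 2) + 28 * A * d ^ 2 * (A * V)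
              + 4 * A * d ^ 3 := by gcongr
        _ ≤ _ := by
            have h1 : A ≤ A ^ 3 := le_self_pow₀ hA1 (by norm_num)
            have h2 : A ^ 2 ≤ A ^ 3 := pow_le_pow_right₀ hA1 (by norm_num)
            have e1 := mul_le_mul_of_nonneg_right h1 (pow_nonneg hd0 3)
            have e2 := mul_le_mul_of_nonneg_right h2 (by positivity : 0 ≤ d ^ 2 * V)
            have e3 : 0 ≤ A ^ 3 * d ^ 3 := by positivity
            have e4 : 0 ≤ A ^ 3 * (d ^ 2 * V) := by positivity
            have e5 : 0 ≤ A ^ 3 * (d * V ^ 2) := by positivity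
            nlinarith

/-- A sixth moment bound for functions of independent random variables that are Lipschitz in each
coordinate. -/
theorem integral_comp_sub_integral_pow_six_le {Ω ι : Type*} [MeasurableSpace Ω] [Fintype ι]
    [DecidableEq ι] {P : Measure Ω} [IsProbabilityMeasure P] {K : ℝ} (hK0 : 0 ≤ K)
    {X : ι → Ω → ℝ} (hX : ∀ i, Measurable (X i)) (hind : iIndepFun X P)
    (hi : ∀ i, Integrable (fun ω => X i ω ^ 6) P) (hK : ∀ i, ∫ ω, X i ω ^ 6 ∂P ≤ K)
    {F : (ι → ℝ) → ℝ} (hF : Measurable F) {B : ℝ} (hB : ∀ x, |F x| ≤ B)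
    {c : ι → ℝ} (hc : ∀ i, 0 ≤ c i)
    (hL : ∀ i x y, |F (Function.update x i y) - F x| ≤ c i * |y - x i|) :
    ∫ ω, (F (fun i => X i ω) - ∫ ω', F (fun i => X i ω') ∂P) ^ 6 ∂P
      ≤ 34 * centredMomentBound K ^ 3 * (∑ i, c i ^ 2) ^ 3 := by
  set e := (Fintype.equivFin ι).symm with he
  set Y : Fin (Fintype.card ι) → Ω → ℝ := fun i => X (e i) with hY
  have hYm : ∀ i, Measurable (Y i) := fun i => hX _
  have hYind : iIndepFun Y P := hind.precomp e.injective
  set μ : Fin (Fintype.card ι) → Measure ℝ := fun i => P.map (Y i) with hμ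
  have hprob : ∀ i, IsProbabilityMeasure (μ i) := fun i =>
    Measure.isProbabilityMeasure_map (hYm i).aemeasurable
  have hlaw : P.map (fun ω i => Y i ω) = Measure.pi μ :=
    (iIndepFun_iff_map_fun_eq_pi_map fun i => (hYm i).aemeasurable).1 hYind
  have hvec : Measurable fun ω i => Y i ω := measurable_pi_iff.2 hYm
  set F' : (Fin (Fintype.card ι) → ℝ) → ℝ := fun x => F fun i => x (e.symm i) with hF'
  have hF'm : Measurable F' := hF.comp (measurable_pi_iff.2 fun i => measurable_pi_apply _)
  have hcomp : ∀ ω, F' (fun i => Y i ω) = F fun i => X i ω := fun ω => by simp [hF', hY]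
  have h6 := (integral_pi_sub_integral_pow_le hK0 μ
    (fun i => by
      rw [hμ, integrable_map_measure (by fun_prop) (hYm i).aemeasurable]; exact hi _)
    (fun i => by
      rw [hμ, integral_map (hYm i).aemeasurable (by fun_prop)]; exact hK _)
    hF'm (fun x => hB _) (c := fun i => c (e i)) (fun i => hc _) (fun i x y => by
      have := hL (e i) (fun j => x (e.symm j)) y
      simp only [Equiv.symm_apply_apply] at this
      convert! this using 4
      ext j
      simp only [Function.update_apply, Equiv.symm_apply_eq])).2.2
  rw [← hlaw, integral_map hvec.aemeasurable (by fun_prop),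
    integral_map hvec.aemeasurable (by fun_prop)] at h6
  simp only [hcomp] at h6
  rwa [e.sum_comp fun i => c i ^ 2] at h6

/-! ### A bound for hypergeometric weights -/

theorem sum_range_choose_mul_choose (a b m : ℕ) :
    ∑ r ∈ Finset.range (m + 1), (a.choose r : ℝ) * (b.choose (m - r) : ℝ)
      = ((a + b).choose m : ℝ) := by
  rw [Nat.add_choose_eq,
    Finset.Nat.sum_antidiagonal_eq_sum_range_succ fun i j => a.choose i * b.choose j]
  push_cast
  rfl

/-- The largest hypergeometric weight. -/
theorem choose_mul_choose_le (a b m r : ℕ) (hr : r ≤ m) :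
    (a.choose r : ℝ) * (b.choose (m - r) : ℝ) ≤
      √(1 / ((a : ℝ) + 1) + 1 / ((b : ℝ) + 1)) * ((a + b + 2).choose (m + 1) : ℝ) := by
  -- A discrete Stein argument: the increments of `H` are `G` times the linear function `l`, where
  -- `G` is a hypergeometric weight for the enlarged parameters and `l` is centred for it. The
  -- second moment of `l` then bounds the total variation of `H`, hence its maximum. The cutoff
  -- matters: at r = m + 1 the truncated difference m - r would make the second binomial coefficient
  -- 1 instead of 0.
  set H : ℕ → ℝ := fun r => if r ≤ m then (a.choose r : ℝ) * (b.choose (m - r) : ℝ) else 0 with hH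
  set G : ℕ → ℝ := fun r => ((a + 1).choose (r + 1) : ℝ) * ((b + 1).choose (m - r) : ℝ) with hG
  set A : ℝ := (a : ℝ) + 1 with hA
  set B : ℝ := (b : ℝ) + 1 with hB
  have hA0 : 0 < A := by positivity
  have hB0 : 0 < B := by positivity
  set l : ℕ → ℝ := fun r => A * ((m : ℝ) + 1) - (A + B) * r with hl
  have hG0 : ∀ r, 0 ≤ G r := fun r => by positivity
  have hH0 : ∀ r, 0 ≤ H r := fun r => by simp only [hH]; split_ifs <;> positivity
  have hdiff : ∀ r ∈ Finset.range (m + 1), A * B * (H (r + 1) - H r) = G r * l (r + 1) := by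
    intro r hr
    obtain ⟨t, rfl⟩ := Nat.exists_eq_add_of_le (Nat.lt_succ_iff.1 (Finset.mem_range.1 hr))
    have e1 : A * (a.choose r : ℝ) = ((a + 1).choose (r + 1) : ℝ) * ((r : ℝ) + 1) := by
      rw [hA]; exact_mod_cast Nat.add_one_mul_choose_eq a r
    have e2 : A * (a.choose (r + 1) : ℝ) = ((a + 1).choose (r + 1) : ℝ) * ((a : ℝ) - r) := by
      have : ((a + 1).choose (r + 1) : ℝ) = a.choose r + a.choose (r + 1) := by
        exact_mod_cast Nat.choose_succ_succ a r
      rw [this] at e1 ⊢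
      linear_combination -e1 + (a.choose r + a.choose (r + 1) : ℝ) * hA
    simp only [hH, hG, hl, add_tsub_cancel_left, Nat.le_add_right, if_true]
    cases t with
    | zero =>
      simp only [add_zero, Nat.not_succ_le_self, if_false, Nat.choose_zero_right, Nat.cast_one]
      push_cast
      linear_combination (-B) * e1
    | succ t =>
      have f1 : B * (b.choose t : ℝ) = ((b + 1).choose (t + 1) : ℝ) * ((t : ℝ) + 1) := by
        rw [hB]; exact_mod_cast Nat.add_one_mul_choose_eq b t
      have f2 : B * (b.choose (t + 1) : ℝ) = ((b + 1).choose (t + 1) : ℝ) * ((b : ℝ) - t) := by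
        have : ((b + 1).choose (t + 1) : ℝ) = b.choose t + b.choose (t + 1) := by
          exact_mod_cast Nat.choose_succ_succ b t
        rw [this] at f1 ⊢
        linear_combination -f1 + (b.choose t + b.choose (t + 1) : ℝ) * hB
      rw [if_pos (by omega), show r + (t + 1) - (r + 1) = t by omega]
      push_cast
      have h1 : A * B * ((a.choose (r + 1) : ℝ) * b.choose t) =
        (((a + 1).choose (r + 1) : ℝ) * ((a : ℝ) - r)) *
          (((b + 1).choose (t + 1) : ℝ) * ((t : ℝ) + 1)) := by rw [← e2, ← f1]; ring
      have h2 : A * B * ((a.choose r : ℝ) * b.choose (t + 1)) =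
        (((a + 1).choose (r + 1) : ℝ) * ((r : ℝ) + 1)) *
          (((b + 1).choose (t + 1) : ℝ) * ((b : ℝ) - t)) := by rw [← e1, ← f2]; ring
      rw [mul_sub, h1, h2, hA, hB]
      ring
  have hHm : H (m + 1) = 0 := by simp [hH]
  have hsumH : ∑ r ∈ Finset.range (m + 1), H r = ((a + b).choose m : ℝ) := by
    rw [← sum_range_choose_mul_choose]
    refine Finset.sum_congr rfl fun r hr => ?_
    simp only [hH]
    rw [if_pos (Nat.lt_succ_iff.1 (Finset.mem_range.1 hr))]
  have hsumG : ∑ r ∈ Finset.range (m + 1), G r ≤ ((a + b + 2).choose (m + 1) : ℝ) := by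
    rw [show a + b + 2 = (a + 1) + (b + 1) by ring, ← sum_range_choose_mul_choose,
      Finset.sum_range_succ' _ (m + 1)]
    simp only [hG, Nat.add_sub_add_right]
    exact le_add_of_nonneg_right (by positivity)
  -- Summation by parts: replace one factor `G * l` by the increment of `H`. Since `l` has constant
  -- slope -(A + B), what remains is (A + B) times the sum of `H` and a boundary term of favourable
  -- sign.
  have hsq : ∑ r ∈ Finset.range (m + 1), G r * l (r + 1) ^ 2
      ≤ A * B * ((A + B) * ((a + b + 2).choose (m + 1) : ℝ)) := by
    have h1 : ∑ r ∈ Finset.range (m + 1), G r * l (r + 1) ^ 2 = A * B *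
        (∑ r ∈ Finset.range (m + 1), (H (r + 1) * l (r + 1) - H r * l r)
          + (A + B) * ∑ r ∈ Finset.range (m + 1), H r) := by
      rw [Finset.mul_sum, ← Finset.sum_add_distrib, Finset.mul_sum]
      refine Finset.sum_congr rfl fun r hr => ?_
      rw [sq, ← mul_assoc, ← hdiff r hr]
      simp only [hl]
      push_cast
      ring
    rw [h1, Finset.sum_range_sub (fun r => H r * l r), hHm, hsumH]
    have hl0 : 0 ≤ H 0 * l 0 := mul_nonneg (hH0 0) (by simp only [hl]; push_cast; nlinarith)
    have hle : ((a + b).choose m : ℝ) ≤ ((a + b + 2).choose (m + 1) : ℝ) := by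
      have h2 : (a + b).choose m ≤ (a + b + 1).choose (m + 1) := by
        rw [Nat.choose_succ_succ]; omega
      have h3 : (a + b + 1).choose (m + 1) ≤ (a + b + 2).choose (m + 1) :=
        Nat.choose_le_succ _ _
      exact_mod_cast h2.trans h3
    refine mul_le_mul_of_nonneg_left ?_ (by positivity)
    have := mul_le_mul_of_nonneg_left hle (by positivity : 0 ≤ A + B)
    linarith
  set T : ℝ := ((a + b + 2).choose (m + 1) : ℝ) with hT
  have hT0 : 0 ≤ T := by positivity
  have hcs : (∑ r ∈ Finset.range (m + 1), G r * |l (r + 1)|) ^ 2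
      ≤ T * (A * B * ((A + B) * T)) := by
    have := Finset.sum_sq_le_sum_mul_sum_of_sq_le_mul (Finset.range (m + 1))
      (r := fun r => G r * |l (r + 1)|) (f := G) (g := fun r => G r * l (r + 1) ^ 2)
      (fun r _ => hG0 r) (fun r _ => mul_nonneg (hG0 r) (sq_nonneg _))
      (fun r _ => by rw [mul_pow, sq_abs]; exact (by ring : _ = _).le)
    exact this.trans (mul_le_mul hsumG hsq
      (Finset.sum_nonneg fun r _ => mul_nonneg (hG0 r) (sq_nonneg _)) hT0)
  -- `H` vanishes at m + 1, so its value at r is minus the sum of the increments from r on.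
  have htv : A * B * H r ≤ ∑ r ∈ Finset.range (m + 1), G r * |l (r + 1)| := by
    have h1 : ∑ k ∈ Finset.Ico r (m + 1), (H (k + 1) - H k) = H (m + 1) - H r :=
      Finset.sum_Ico_sub _ (by omega)
    calc A * B * H r = ∑ k ∈ Finset.Ico r (m + 1), -(A * B * (H (k + 1) - H k)) := by
          rw [Finset.sum_neg_distrib, ← Finset.mul_sum, h1, hHm]; ring
      _ ≤ ∑ k ∈ Finset.Ico r (m + 1), G k * |l (k + 1)| := by
          refine Finset.sum_le_sum fun k hk => ?_
          rw [hdiff k (Finset.mem_range.2 (Finset.mem_Ico.1 hk).2), ← mul_neg]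
          exact mul_le_mul_of_nonneg_left (neg_le_abs _) (hG0 k)
      _ ≤ _ := Finset.sum_le_sum_of_subset_of_nonneg
          (fun k hk => Finset.mem_range.2 (Finset.mem_Ico.1 hk).2)
          fun k _ _ => mul_nonneg (hG0 k) (abs_nonneg _)
  have hfin : H r ^ 2 ≤ (1 / A + 1 / B) * T ^ 2 := by
    have h1 : (A * B * H r) ^ 2 ≤ T * (A * B * ((A + B) * T)) :=
      (pow_le_pow_left₀ (mul_nonneg (by positivity) (hH0 r)) htv 2).trans hcs
    have h2 : (1 / A + 1 / B) * T ^ 2 = T * (A * B * ((A + B) * T)) / (A * B) ^ 2 := by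
      field_simp
      ring
    rw [h2, le_div_iff₀ (by positivity)]
    linarith
  have hHr : (a.choose r : ℝ) * (b.choose (m - r) : ℝ) = H r := by
    simp only [hH]; rw [if_pos hr]
  rw [hHr]
  calc H r = √(H r ^ 2) := (Real.sqrt_sq (hH0 r)).symm
    _ ≤ √((1 / A + 1 / B) * T ^ 2) := Real.sqrt_le_sqrt hfin
    _ = _ := by rw [Real.sqrt_mul (by positivity), Real.sqrt_sq hT0]

/-- Absorption, used twice. It shows that the loss in `choose_mul_choose_le` relative to `n.choose
m` is (n+2)(n+1)/((m+1)(n-m+1)), bounded when m/n stays away from 0 and 1. -/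
theorem choose_add_two_mul (n m : ℕ) (hm : m ≤ n) :
    ((n + 2).choose (m + 1) : ℝ) * (((m : ℝ) + 1) * ((n : ℝ) - m + 1))
      = (n.choose m : ℝ) * (((n : ℝ) + 2) * ((n : ℝ) + 1)) := by
  have e1 : ((n : ℝ) + 2) * ((n + 1).choose m : ℝ) = ((n + 2).choose (m + 1) : ℝ) * ((m : ℝ) + 1) := by
    have := Nat.add_one_mul_choose_eq (n + 1) m
    have h2 : ((n + 1 + 1 : ℕ) : ℝ) * ((n + 1).choose m : ℝ)
      = ((n + 1 + 1).choose (m + 1) : ℝ) * ((m + 1 : ℕ) : ℝ) := by exact_mod_cast this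
    push_cast at h2
    linarith
  have e2 : (n.choose m : ℝ) * ((n : ℝ) + 1) = ((n + 1).choose m : ℝ) * ((n : ℝ) - m + 1) := by
    have := Nat.choose_mul_succ_eq n m
    have h2 : (n.choose m : ℝ) * ((n + 1 : ℕ) : ℝ) = ((n + 1).choose m : ℝ) * ((n + 1 - m : ℕ) : ℝ) := by
      exact_mod_cast this
    rw [Nat.cast_sub (by omega)] at h2
    push_cast at h2
    linarith
  rw [← mul_assoc, ← e1]
  linear_combination (-((n : ℝ) + 2)) * e2

theorem sum_range_one_div_sqrt_le (n : ℕ) :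
    ∑ k ∈ Finset.range n, 1 / √((k : ℝ) + 1) ≤ 2 * √(n : ℝ) := by
  induction n with
  | zero => simp
  | succ n ih =>
    rw [Finset.sum_range_succ]
    push_cast
    set u := √(n : ℝ)
    set v := √((n : ℝ) + 1) with hv
    have hu0 : 0 ≤ u := Real.sqrt_nonneg _
    have hu : u ^ 2 = n := Real.sq_sqrt (by positivity)
    have hv2 : v ^ 2 = n + 1 := Real.sq_sqrt (by positivity)
    have hv0 : 0 < v := Real.sqrt_pos.2 (by positivity)
    have huv : u ≤ v := Real.sqrt_le_sqrt (by linarith)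
    -- From (v - u)(v + u) = 1 and v + u ≤ 2v.
    have : 1 / v ≤ 2 * (v - u) := by
      rw [div_le_iff₀ hv0]
      nlinarith
    linarith

/-- Subadditivity of the square root splits each summand, and k ↦ n - k turns the second sum into
the first. -/
theorem sum_range_sqrt_one_div_add_le (n : ℕ) :
    ∑ k ∈ Finset.range (n + 1), √(1 / ((k : ℝ) + 1) + 1 / (((n - k : ℕ) : ℝ) + 1))
      ≤ 4 * √((n : ℝ) + 1) := by
  have h : ∀ k : ℕ, √(1 / ((k : ℝ) + 1) + 1 / (((n - k : ℕ) : ℝ) + 1))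
      ≤ 1 / √((k : ℝ) + 1) + 1 / √(((n - k : ℕ) : ℝ) + 1) := fun k => by
    simp only [one_div, ← Real.sqrt_inv]
    refine Real.sqrt_le_iff.2 ⟨by positivity, ?_⟩
    have h1 := Real.sq_sqrt (by positivity : 0 ≤ ((k : ℝ) + 1)⁻¹)
    have h2 := Real.sq_sqrt (by positivity : 0 ≤ (((n - k : ℕ) : ℝ) + 1)⁻¹)
    have h3 : 0 ≤ √(((k : ℝ) + 1)⁻¹) * √((((n - k : ℕ) : ℝ) + 1)⁻¹) := by positivity
    nlinarith
  refine (Finset.sum_le_sum fun k _ => h k).trans ?_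
  rw [Finset.sum_add_distrib]
  have hr := Finset.sum_range_reflect (fun k => 1 / √((k : ℝ) + 1)) (n + 1)
  simp only [Nat.add_sub_cancel] at hr
  rw [hr]
  have := sum_range_one_div_sqrt_le (n + 1)
  push_cast at this
  linarith

/-! ### Paths encoded by their sets of right steps -/

/-- The number of elements of `E` below `k`: if `E` is the set of times at which a path steps to
the right, then this is the number of right steps among the first `k` steps. -/
def rightSteps (E : Finset ℕ) (k : ℕ) : ℕ := (E ∩ Finset.range k).card

theorem rightSteps_le (E : Finset ℕ) (k : ℕ) : rightSteps E k ≤ k :=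
  (Finset.card_le_card Finset.inter_subset_right).trans (Finset.card_range k).le

@[simp] theorem rightSteps_zero (E : Finset ℕ) : rightSteps E 0 = 0 := by simp [rightSteps]

theorem rightSteps_succ (E : Finset ℕ) (k : ℕ) :
    rightSteps E (k + 1) = rightSteps E k + if k ∈ E then 1 else 0 := by
  unfold rightSteps
  rw [Finset.range_add_one]
  split_ifs with h
  · rw [Finset.inter_insert_of_mem h, Finset.card_insert_of_notMem (by simp)]
  · rw [Finset.inter_insert_of_notMem h, add_zero]

theorem rightSteps_add_card_Ico (E : Finset ℕ) {j k : ℕ} (h : j ≤ k) :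
    rightSteps E k = rightSteps E j + (E ∩ Finset.Ico j k).card := by
  unfold rightSteps
  rw [← Finset.card_union_of_disjoint]
  · rw [← Finset.inter_union_distrib_left]
    congr 2
    ext i
    simp only [Finset.mem_range, Finset.mem_union, Finset.mem_Ico]
    omega
  · refine Finset.disjoint_left.2 fun i hi hi' => ?_
    simp only [Finset.mem_inter, Finset.mem_range, Finset.mem_Ico] at hi hi'
    omega

theorem rightSteps_mono (E : Finset ℕ) {j k : ℕ} (h : j ≤ k) :
    rightSteps E j ≤ rightSteps E k := by
  rw [rightSteps_add_card_Ico E h]; omega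

theorem rightSteps_sub_le (E : Finset ℕ) {j k : ℕ} (h : j ≤ k) :
    rightSteps E k ≤ rightSteps E j + (k - j) := by
  rw [rightSteps_add_card_Ico E h]
  have := Finset.card_le_card (Finset.inter_subset_right : E ∩ Finset.Ico j k ⊆ Finset.Ico j k)
  rw [Nat.card_Ico] at this
  omega

theorem rightSteps_congr {E E' : Finset ℕ} {k : ℕ} (h : ∀ i < k, (i ∈ E ↔ i ∈ E')) :
    rightSteps E k = rightSteps E' k := by
  unfold rightSteps
  congr 1
  ext i
  simp only [Finset.mem_inter, Finset.mem_range]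
  exact ⟨fun hi => ⟨(h i hi.2).1 hi.1, hi.2⟩, fun hi => ⟨(h i hi.2).2 hi.1, hi.2⟩⟩

theorem rightSteps_eq_card {E : Finset ℕ} {s : ℕ} (h : E ⊆ Finset.range s) :
    rightSteps E s = E.card := by
  rw [rightSteps, Finset.inter_eq_left.2 h]

/-- The point of the path with right steps `E` after `k` steps from `(1, 1)`. -/
def pathPoint (E : Finset ℕ) (k : ℕ) : ℕ × ℕ := (1 + rightSteps E k, 1 + (k - rightSteps E k))

theorem pathPoint_fst_add_snd (E : Finset ℕ) (k : ℕ) :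
    (pathPoint E k).1 + (pathPoint E k).2 = k + 2 := by
  have := rightSteps_le E k
  simp only [pathPoint]
  omega

theorem pathPoint_injective (E : Finset ℕ) : Function.Injective (pathPoint E) := fun j k h => by
  have h1 := pathPoint_fst_add_snd E j
  rw [h, pathPoint_fst_add_snd] at h1
  omega

/-- The set of points of the path of `s` steps with right steps `E`. -/
def pathOf (s : ℕ) (E : Finset ℕ) : Finset (ℕ × ℕ) :=
  (Finset.range (s + 1)).image (pathPoint E)

theorem card_pathOf (s : ℕ) (E : Finset ℕ) : (pathOf s E).card = s + 1 := by
  rw [pathOf, Finset.card_image_of_injective _ (pathPoint_injective E), Finset.card_range]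

theorem mem_pathOf {s : ℕ} {E : Finset ℕ} {a : ℕ × ℕ} :
    a ∈ pathOf s E ↔ 1 ≤ a.1 ∧ 1 ≤ a.2 ∧ a.1 + a.2 ≤ s + 2 ∧
      rightSteps E (a.1 + a.2 - 2) = a.1 - 1 := by
  simp only [pathOf, Finset.mem_image, Finset.mem_range]
  constructor
  · rintro ⟨k, hk, rfl⟩
    have := rightSteps_le E k
    rw [pathPoint_fst_add_snd]
    simp only [pathPoint, Nat.add_sub_cancel]
    omega
  · rintro ⟨h1, h2, h3, h4⟩
    refine ⟨a.1 + a.2 - 2, by omega, ?_⟩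
    ext
    · simp only [pathPoint, h4]; omega
    · simp only [pathPoint, h4]; omega

theorem pathPoint_mem_pathOf {s k : ℕ} (hk : k ≤ s) (E : Finset ℕ) : pathPoint E k ∈ pathOf s E :=
  Finset.mem_image_of_mem _ (Finset.mem_range.2 (Nat.lt_succ_of_le hk))

/-- The point after k steps is the only point of the path with coordinate sum k + 2, so the point
set determines all values of `rightSteps` up to time s, and their increments determine `E`. -/
theorem pathOf_injOn (s : ℕ) :
    Set.InjOn (pathOf s) {E : Finset ℕ | E ⊆ Finset.range s} := by
  intro E hE E' hE' h
  have key : ∀ k ≤ s, rightSteps E k = rightSteps E' k := fun k hk => by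
    have h1 := pathPoint_mem_pathOf hk E
    rw [h, mem_pathOf, pathPoint_fst_add_snd] at h1
    have := h1.2.2.2
    simp only [pathPoint, Nat.add_sub_cancel] at this
    omega
  ext i
  by_cases hi : i < s
  · have h1 := key (i + 1) hi
    rw [rightSteps_succ, rightSteps_succ, key i hi.le] at h1
    by_cases h2 : i ∈ E <;> by_cases h3 : i ∈ E' <;> simp [h2, h3] at h1 ⊢
  · exact ⟨fun h => absurd (Finset.mem_range.1 (hE h)) hi,
      fun h => absurd (Finset.mem_range.1 (hE' h)) hi⟩

theorem isUpRightPath_iff {N M : ℕ} (hN : 1 ≤ N) (hM : 1 ≤ M) (σ : Finset (ℕ × ℕ)) :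
    IsUpRightPath N M σ ↔ ∃ E ⊆ Finset.range (N + M - 2),
      rightSteps E (N + M - 2) = N - 1 ∧ pathOf (N + M - 2) E = σ := by
  obtain ⟨s, hs⟩ : ∃ s, N + M - 2 = s := ⟨_, rfl⟩
  have hs1 : N + M - 1 = s + 1 := by omega
  rw [IsUpRightPath, hs, hs1]
  have himage : ∀ γ : ℕ → ℕ × ℕ, (Finset.Icc 1 (s + 1)).image γ
      = (Finset.range (s + 1)).image fun k => γ (k + 1) := fun γ => by
    ext a
    simp only [Finset.mem_image, Finset.mem_Icc, Finset.mem_range]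
    constructor
    · rintro ⟨k, hk, rfl⟩
      exact ⟨k - 1, by omega, by rw [Nat.sub_add_cancel hk.1]⟩
    · rintro ⟨k, hk, rfl⟩
      exact ⟨k + 1, by omega, rfl⟩
  constructor
  · rintro ⟨γ, h1, h2, h3, rfl⟩
    -- `γ` is indexed from 1 and `pathPoint` from 0, so step k leads from γ (k + 1) to γ (k + 2).
    set E := (Finset.range s).filter fun k => γ (k + 2) = γ (k + 1) + (1, 0) with hE
    have key : ∀ k ≤ s, γ (k + 1) = pathPoint E k := by
      intro k
      induction k with
      | zero => intro _; rw [h1]; simp [pathPoint]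
      | succ k ih =>
        intro hk
        have hstep := h3 (k + 1) (by omega) (by omega)
        have hk' := ih (by omega)
        have hle := rightSteps_le E k
        by_cases hkE : k ∈ E
        · have : γ (k + 2) = γ (k + 1) + (1, 0) := (Finset.mem_filter.1 hkE).2
          rw [this, hk']
          simp only [pathPoint, rightSteps_succ, hkE, if_true, Prod.mk_add_mk, Prod.mk.injEq]
          omega
        · have hne : ¬ γ (k + 2) = γ (k + 1) + (1, 0) := fun h =>
            hkE (Finset.mem_filter.2 ⟨Finset.mem_range.2 (by omega), h⟩)
          have : γ (k + 2) = γ (k + 1) + (0, 1) := hstep.resolve_left hne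
          rw [this, hk']
          simp only [pathPoint, rightSteps_succ, hkE, if_false, Prod.mk_add_mk, Prod.mk.injEq]
          omega
    refine ⟨E, Finset.filter_subset _ _, ?_, ?_⟩
    · have := key s le_rfl
      rw [h2] at this
      have := congrArg Prod.fst this
      simp only [pathPoint] at this
      omega
    · rw [himage, pathOf]
      refine Finset.image_congr fun k hk => ?_
      exact (key k (Nat.lt_succ_iff.1 (Finset.mem_range.1 hk))).symm
  · rintro ⟨E, hE, hN', rfl⟩
    refine ⟨fun k => pathPoint E (k - 1), by simp [pathPoint], ?_, fun k hk1 hk2 => ?_, ?_⟩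
    · simp only [Nat.add_sub_cancel, pathPoint, hN', Prod.mk.injEq]
      omega
    · obtain ⟨k, rfl⟩ := Nat.exists_eq_add_of_le' hk1
      have hle := rightSteps_le E k
      simp only [Nat.add_sub_cancel, pathPoint, rightSteps_succ, Prod.mk_add_mk, Prod.mk.injEq]
      split_ifs <;> omega
    · rw [himage, pathOf]
      simp

theorem pathOf_subset_gridBox {N M : ℕ} (hN : 1 ≤ N) (hM : 1 ≤ M) {E : Finset ℕ}
    (hE : rightSteps E (N + M - 2) = N - 1) : pathOf (N + M - 2) E ⊆ gridBox N M := by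
  intro a ha
  obtain ⟨h1, h2, h3, h4⟩ := mem_pathOf.1 ha
  have h5 := rightSteps_mono E (by omega : a.1 + a.2 - 2 ≤ N + M - 2)
  have h6 := rightSteps_sub_le E (by omega : a.1 + a.2 - 2 ≤ N + M - 2)
  rw [hE, h4] at h5 h6
  simp only [gridBox, Finset.mem_product, Finset.mem_Icc]
  omega

open Classical in
/-- The sets of right steps of the paths of a scheme. -/
noncomputable def PathScheme.stepSets (S : PathScheme) (N : ℕ) : Finset (Finset ℕ) :=
  (Finset.range (N + S.height N - 2)).powerset.filter fun E =>
    rightSteps E (N + S.height N - 2) = N - 1 ∧ S.Restriction N (pathOf (N + S.height N - 2) E)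

theorem PathScheme.mem_stepSets {S : PathScheme} {N : ℕ} {E : Finset ℕ} :
    E ∈ S.stepSets N ↔ E ⊆ Finset.range (N + S.height N - 2) ∧
      rightSteps E (N + S.height N - 2) = N - 1 ∧
      S.Restriction N (pathOf (N + S.height N - 2) E) := by
  simp [PathScheme.stepSets]

theorem PathScheme.mem_paths {S : PathScheme} {N : ℕ} {σ : Finset (ℕ × ℕ)} :
    σ ∈ S.paths N ↔ σ ⊆ S.box N ∧ IsUpRightPath N (S.height N) σ ∧ S.Restriction N σ := by
  simp [PathScheme.paths]

theorem PathScheme.paths_eq_image (S : PathScheme) {N : ℕ} (hN : 1 ≤ N) (hM : 1 ≤ S.height N) :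
    S.paths N = (S.stepSets N).image (pathOf (N + S.height N - 2)) := by
  ext σ
  simp only [PathScheme.mem_paths, Finset.mem_image, PathScheme.mem_stepSets, isUpRightPath_iff hN hM]
  constructor
  · rintro ⟨-, ⟨E, hE, hE', rfl⟩, hR⟩
    exact ⟨E, ⟨hE, hE', hR⟩, rfl⟩
  · rintro ⟨E, ⟨hE, hE', hR⟩, rfl⟩
    exact ⟨pathOf_subset_gridBox hN hM hE', ⟨E, hE, hE', rfl⟩, hR⟩

theorem PathScheme.pathOf_injOn_stepSets (S : PathScheme) (N : ℕ) :
    Set.InjOn (pathOf (N + S.height N - 2)) (S.stepSets N) :=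
  (pathOf_injOn _).mono fun _ hE => (PathScheme.mem_stepSets.1 hE).1

theorem PathScheme.card_paths (S : PathScheme) {N : ℕ} (hN : 1 ≤ N) (hM : 1 ≤ S.height N) :
    (S.paths N).card = (S.stepSets N).card := by
  rw [S.paths_eq_image hN hM, Finset.card_image_of_injOn (S.pathOf_injOn_stepSets N)]

theorem PathScheme.card_paths_filter_mem (S : PathScheme) {N : ℕ} (hN : 1 ≤ N)
    (hM : 1 ≤ S.height N) (a : ℕ × ℕ) :
    ((S.paths N).filter (a ∈ ·)).card
      = ((S.stepSets N).filter (a ∈ pathOf (N + S.height N - 2) ·)).card := by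
  rw [S.paths_eq_image hN hM, Finset.filter_image, Finset.card_image_of_injOn]
  exact (S.pathOf_injOn_stepSets N).mono fun E hE => (Finset.mem_filter.1 hE).1

theorem PathScheme.card_of_mem_paths {S : PathScheme} {N : ℕ} (hN : 1 ≤ N)
    (hM : 1 ≤ S.height N) {σ : Finset (ℕ × ℕ)} (hσ : σ ∈ S.paths N) :
    σ.card = N + S.height N - 1 := by
  rw [S.paths_eq_image hN hM] at hσ
  obtain ⟨E, -, rfl⟩ := Finset.mem_image.1 hσ
  rw [card_pathOf]
  omega

theorem PathScheme.subset_box_of_mem_paths {S : PathScheme} {N : ℕ} {σ : Finset (ℕ × ℕ)}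
    (hσ : σ ∈ S.paths N) : σ ⊆ S.box N :=
  (PathScheme.mem_paths.1 hσ).1

/-! ### Resampling inside a block and the overlap of two paths -/

theorem card_filter_powersetCard_Ico {u k v : ℕ} (huk : u ≤ k) (hkv : k ≤ v) {m t : ℕ}
    (ht : t ≤ m) :
    ((Finset.powersetCard m (Finset.Ico u v)).filter
        fun G => (G ∩ Finset.Ico u k).card = t).card
      = (k - u).choose t * (v - k).choose (m - t) := by
  rw [← Nat.card_Ico u k, ← Nat.card_Ico k v, ← Finset.card_powersetCard,
    ← Finset.card_powersetCard, ← Finset.card_product]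
  have hsplit : ∀ G ⊆ Finset.Ico u v,
      G ∩ Finset.Ico u k ∪ G ∩ Finset.Ico k v = G := fun G hG => by
    rw [← Finset.inter_union_distrib_left, Finset.Ico_union_Ico_eq_Ico huk hkv,
      Finset.inter_eq_left.2 hG]
  have hdisj : Disjoint (Finset.Ico u k) (Finset.Ico k v) := Finset.Ico_disjoint_Ico_consecutive _ _ _
  refine Finset.card_nbij' (fun G => (G ∩ Finset.Ico u k, G ∩ Finset.Ico k v))
    (fun p => p.1 ∪ p.2) ?_ ?_ ?_ ?_
  · intro G hG
    simp only [Finset.coe_filter, Finset.mem_powersetCard, Set.mem_ofPred_eq] at hG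
    simp only [Finset.coe_product, Set.mem_prod, Finset.mem_coe, Finset.mem_powersetCard]
    refine ⟨⟨Finset.inter_subset_right, hG.2⟩, Finset.inter_subset_right, ?_⟩
    have h1 := Finset.card_union_of_disjoint
      (hdisj.mono (Finset.inter_subset_right : G ∩ _ ⊆ _) (Finset.inter_subset_right : G ∩ _ ⊆ _))
    rw [hsplit G hG.1.1, hG.1.2, hG.2] at h1
    omega
  · rintro ⟨G, H⟩ hp
    simp only [Finset.coe_product, Set.mem_prod, Finset.mem_coe, Finset.mem_powersetCard] at hp
    obtain ⟨⟨hG, hGc⟩, hH, hHc⟩ := hp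
    simp only [Finset.coe_filter, Finset.mem_powersetCard, Set.mem_ofPred_eq]
    refine ⟨⟨?_, ?_⟩, ?_⟩
    · rw [← Finset.Ico_union_Ico_eq_Ico huk hkv]
      exact Finset.union_subset_union hG hH
    · rw [Finset.card_union_of_disjoint (hdisj.mono hG hH), hGc, hHc]; omega
    · rw [Finset.union_inter_distrib_right, Finset.inter_eq_left.2 hG,
        (Finset.disjoint_iff_inter_eq_empty.1 (hdisj.symm.mono_left hH)), Finset.union_empty, hGc]
  · intro G hG
    simp only [Finset.coe_filter, Finset.mem_powersetCard, Set.mem_ofPred_eq] at hG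
    exact hsplit G hG.1.1
  · rintro ⟨G, H⟩ hp
    simp only [Finset.coe_product, Set.mem_prod, Finset.mem_coe, Finset.mem_powersetCard] at hp
    obtain ⟨⟨hG, -⟩, hH, -⟩ := hp
    simp only [Finset.union_inter_distrib_right, Finset.inter_eq_left.2 hG,
      Finset.inter_eq_left.2 hH, Finset.disjoint_iff_inter_eq_empty.1 (hdisj.symm.mono_left hH),
      Finset.disjoint_iff_inter_eq_empty.1 (hdisj.mono_left hG), Finset.union_empty,
      Finset.empty_union]

/-- The ratio of `(l + 2).choose (m + 1)` and `l.choose m`. -/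
noncomputable def chooseRatio (l m : ℕ) : ℝ := ((l + 2).choose (m + 1) : ℝ) / (l.choose m : ℝ)

theorem chooseRatio_nonneg (l m : ℕ) : 0 ≤ chooseRatio l m := by
  unfold chooseRatio; positivity

/-- The family `𝓔` is closed under replacing the part of a member inside `[u, v)` by another
subset of `[u, v)` of the same size. -/
def ClosedUnderResampling (𝓔 : Finset (Finset ℕ)) (u v : ℕ) : Prop :=
  ∀ E ∈ 𝓔, ∀ G ⊆ Finset.Ico u v, G.card = (E ∩ Finset.Ico u v).card →
    E \ Finset.Ico u v ∪ G ∈ 𝓔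

/-- Split the family according to the part outside the block and the number c of right steps inside.
On each fibre the inside part ranges over all subsets of size c, so the number of right steps before
k is a shifted hypergeometric variable and `choose_mul_choose_le` applies. The ratios `chooseRatio`
are summed over the family and not bounded one by one, since in some schemes only their average is
bounded. -/
theorem ClosedUnderResampling.card_filter_rightSteps_le {𝓔 : Finset (Finset ℕ)} {u k v : ℕ}
    (h𝓔 : ClosedUnderResampling 𝓔 u v) (huk : u ≤ k) (hkv : k ≤ v) (i : ℕ) :
    ((𝓔.filter fun E => rightSteps E k = i).card : ℝ) ≤
      √(1 / (((k - u : ℕ) : ℝ) + 1) + 1 / (((v - k : ℕ) : ℝ) + 1)) *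
        ∑ E ∈ 𝓔, chooseRatio (v - u) (E ∩ Finset.Ico u v).card := by
  set I := Finset.Ico u v with hI
  set f : Finset ℕ → Finset ℕ × ℕ := fun E => (E \ I, (E ∩ I).card) with hf
  have hmaps : ∀ E ∈ 𝓔, f E ∈ 𝓔.image f := fun E hE => Finset.mem_image_of_mem f hE
  rw [Finset.card_eq_sum_card_fiberwise (f := f) (t := 𝓔.image f)
      (fun E hE => hmaps E (Finset.mem_filter.1 hE).1),
    ← Finset.sum_fiberwise_of_maps_to hmaps, Finset.mul_sum]
  push_cast
  refine Finset.sum_le_sum fun p hp => ?_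
  obtain ⟨E₀, hE₀, rfl⟩ := Finset.mem_image.1 hp
  set D := E₀ \ I with hD
  set c := (E₀ ∩ I).card with hc
  have hDI : Disjoint D I := Finset.sdiff_disjoint
  have hIcard : I.card = v - u := Nat.card_Ico u v
  have hcl : c ≤ v - u := hIcard ▸ Finset.card_le_card Finset.inter_subset_right
  have hchoose : 0 < ((v - u).choose c : ℝ) := by exact_mod_cast Nat.choose_pos hcl
  have hfp : f E₀ = (D, c) := rfl
  rw [hfp]
  have hsum : ∑ E ∈ 𝓔 with f E = (D, c), chooseRatio (v - u) (E ∩ I).card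
      = ((𝓔.filter fun E => f E = (D, c)).card : ℝ) * chooseRatio (v - u) c := by
    rw [← nsmul_eq_mul, ← Finset.sum_const]
    refine Finset.sum_congr rfl fun E hE => ?_
    rw [(Prod.mk.inj (Finset.mem_filter.1 hE).2).2]
  -- This is where closure under resampling enters: every subset of the block of size c extends `D`
  -- to a member of the family.
  have hfib : ((v - u).choose c : ℝ) ≤ ((𝓔.filter fun E => f E = (D, c)).card : ℝ) := by
    rw [← hIcard, ← Finset.card_powersetCard, Nat.cast_le]
    refine Finset.card_le_card_of_injOn (fun G => D ∪ G) ?_ ?_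
    · intro G hG
      obtain ⟨hG, hGc⟩ := Finset.mem_powersetCard.1 hG
      refine Finset.mem_coe.2 (Finset.mem_filter.2 ⟨h𝓔 E₀ hE₀ G hG hGc, ?_⟩)
      simp only [hf, Prod.mk.injEq]
      rw [Finset.union_sdiff_distrib, Finset.sdiff_eq_empty_iff_subset.2 hG, Finset.union_empty,
        Finset.sdiff_eq_self_of_disjoint hDI, Finset.union_inter_distrib_right,
        Finset.disjoint_iff_inter_eq_empty.1 hDI, Finset.empty_union, Finset.inter_eq_left.2 hG]
      exact ⟨rfl, hGc⟩
    · intro G hG G' hG' h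
      have hG := (Finset.mem_powersetCard.1 hG).1
      have hG' := (Finset.mem_powersetCard.1 hG').1
      have h2 := congrArg (· ∩ I) h
      simpa only [Finset.union_inter_distrib_right, Finset.disjoint_iff_inter_eq_empty.1 hDI,
        Finset.empty_union, Finset.inter_eq_left.2 hG, Finset.inter_eq_left.2 hG'] using h2
  rw [hsum, Finset.filter_filter]
  set W := 𝓔.filter fun E => rightSteps E k = i ∧ f E = (D, c) with hW
  set q := √(1 / (((k - u : ℕ) : ℝ) + 1) + 1 / (((v - k : ℕ) : ℝ) + 1)) with hq
  have hrhs : q * ((v - u + 2).choose (c + 1) : ℝ)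
      ≤ q * (((𝓔.filter fun E => f E = (D, c)).card : ℝ) * chooseRatio (v - u) c) := by
    refine mul_le_mul_of_nonneg_left ?_ (Real.sqrt_nonneg _)
    calc ((v - u + 2).choose (c + 1) : ℝ) = ((v - u).choose c : ℝ) * chooseRatio (v - u) c := by
          rw [chooseRatio, mul_div_cancel₀ _ hchoose.ne']
      _ ≤ _ := mul_le_mul_of_nonneg_right hfib (chooseRatio_nonneg _ _)
  refine le_trans ?_ hrhs
  -- A member of `W` is needed to know that t, the number of right steps required in [u, k), is at
  -- most c.
  rcases W.eq_empty_or_nonempty with hW0 | ⟨E₁, hE₁⟩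
  · rw [hW0]; simp only [Finset.card_empty, Nat.cast_zero]; positivity
  have hsteps : ∀ E ∈ W, i = rightSteps D u + ((E ∩ I) ∩ Finset.Ico u k).card ∧
      (E ∩ I).card = c ∧ E = D ∪ (E ∩ I) := fun E hE => by
    obtain ⟨-, hi, hfE⟩ := Finset.mem_filter.1 hE
    obtain ⟨h1, h2⟩ := Prod.mk.inj hfE
    refine ⟨?_, h2, ?_⟩
    · rw [← hi, rightSteps_add_card_Ico E huk, ← h1]
      congr 1
      · refine rightSteps_congr fun j hj => ?_
        have hjI : j ∉ I := fun h => by have := (Finset.mem_Ico.1 h).1; omega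
        simp [hjI]
      · rw [Finset.inter_assoc, Finset.inter_eq_right.2
          (Finset.Ico_subset_Ico_right hkv : Finset.Ico u k ⊆ I)]
    · rw [← h1, Finset.sdiff_union_inter]
  set t := i - rightSteps D u with ht
  have htc : t ≤ c := by
    obtain ⟨h1, h2, -⟩ := hsteps E₁ hE₁
    have := Finset.card_le_card (Finset.inter_subset_left : (E₁ ∩ I) ∩ Finset.Ico u k ⊆ _)
    omega
  have hWcard : W.card ≤ (k - u).choose t * (v - k).choose (c - t) := by
    rw [← card_filter_powersetCard_Ico huk hkv htc]
    refine Finset.card_le_card_of_injOn (fun E => E ∩ I) ?_ ?_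
    · intro E hE
      obtain ⟨h1, h2, -⟩ := hsteps E hE
      refine Finset.mem_coe.2 (Finset.mem_filter.2 ⟨Finset.mem_powersetCard.2
        ⟨Finset.inter_subset_right, h2⟩, ?_⟩)
      simp only
      omega
    · intro E hE E' hE' h
      rw [(hsteps E hE).2.2, (hsteps E' hE').2.2]
      exact congrArg (D ∪ ·) h
  have hmain := choose_mul_choose_le (k - u) (v - k) c t htc
  rw [show k - u + (v - k) + 2 = v - u + 2 by omega] at hmain
  refine le_trans ?_ hmain
  exact_mod_cast hWcard

theorem sum_Icc_sqrt_one_div_add_le {u v : ℕ} (huv : u ≤ v) :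
    ∑ k ∈ Finset.Icc u v,
        √(1 / (((k - u : ℕ) : ℝ) + 1) + 1 / (((v - k : ℕ) : ℝ) + 1))
      ≤ 4 * √(((v - u : ℕ) : ℝ) + 1) := by
  refine le_trans (Finset.sum_nbij' (fun k => k - u) (fun k => k + u) ?_ ?_ ?_ ?_ ?_).le
    (sum_range_sqrt_one_div_add_le (v - u))
  · intro k hk; simp only [Finset.mem_Icc, Finset.mem_range] at hk ⊢; omega
  · intro k hk; simp only [Finset.mem_Icc, Finset.mem_range] at hk ⊢; omega
  · intro k hk; simp only [Finset.mem_Icc] at hk; omega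
  · intro k hk; omega
  · intro k hk
    simp only [Finset.mem_Icc] at hk
    rw [show v - u - (k - u) = v - k by omega]

theorem exists_mem_Icc_consecutive {τ : ℕ → ℕ} {r : ℕ} (h0 : τ 0 = 0) {k : ℕ} (hk : k ≤ τ r)
    (hr : 0 < r) : ∃ j < r, τ j ≤ k ∧ k ≤ τ (j + 1) := by
  have hex : ∃ j, k ≤ τ (j + 1) := ⟨r - 1, by rwa [Nat.sub_add_cancel hr]⟩
  classical
  refine ⟨Nat.find hex, ?_, ?_, Nat.find_spec hex⟩
  · have : Nat.find hex ≤ r - 1 := Nat.find_min' hex (by rwa [Nat.sub_add_cancel hr])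
    omega
  · rcases Nat.eq_zero_or_pos (Nat.find hex) with h | h
    · rw [h, h0]; exact Nat.zero_le _
    · have := Nat.find_min hex (Nat.sub_lt h one_pos)
      rw [Nat.sub_add_cancel (show 1 ≤ Nat.find hex from h)] at this
      omega

/-- The expected overlap of two independent paths is of the order of the square root of their
length. -/
theorem sum_card_filter_mem_pathOf_sq_le {s r : ℕ} {τ : ℕ → ℕ} (hτ0 : τ 0 = 0) (hτr : τ r = s)
    (hr : 0 < r) (hτ : ∀ j < r, τ j ≤ τ (j + 1)) (hτs : ∀ j ≤ r, τ j ≤ s)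
    {𝓔 : Finset (Finset ℕ)}
    (h𝓔 : ∀ j < r, ClosedUnderResampling 𝓔 (τ j) (τ (j + 1))) {R : ℝ} (hR0 : 0 ≤ R)
    (hR : ∀ j < r, ∑ E ∈ 𝓔, chooseRatio (τ (j + 1) - τ j)
      (E ∩ Finset.Ico (τ j) (τ (j + 1))).card ≤ R * 𝓔.card) (T : Finset (ℕ × ℕ)) :
    ∑ a ∈ T, ((𝓔.filter (a ∈ pathOf s ·)).card : ℝ) ^ 2
      ≤ 4 * r * R * √((s : ℝ) + 1) * (𝓔.card : ℝ) ^ 2 := by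
  set n : ℕ × ℕ → ℝ := fun a => ((𝓔.filter (a ∈ pathOf s ·)).card : ℝ) with hn
  have hn0 : ∀ a, 0 ≤ n a := fun a => Nat.cast_nonneg _
  -- Adding up over all blocks, with 0 off the block, avoids choosing the block of k. A common
  -- endpoint is counted twice, which is harmless in an upper bound.
  set g : ℕ → ℕ → ℝ := fun j k => if τ j ≤ k ∧ k ≤ τ (j + 1) then
    √(1 / (((k - τ j : ℕ) : ℝ) + 1) + 1 / (((τ (j + 1) - k : ℕ) : ℝ) + 1)) else 0 with hg
  have hg0 : ∀ j k, 0 ≤ g j k := fun j k => by simp only [hg]; split_ifs <;> positivity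
  have hpoint : ∀ E, ∀ k ∈ Finset.range (s + 1),
      n (pathPoint E k) ≤ ∑ j ∈ Finset.range r, g j k * (R * 𝓔.card) := by
    intro E k hk
    have hks : k ≤ s := Nat.lt_succ_iff.1 (Finset.mem_range.1 hk)
    obtain ⟨j, hj, h1, h2⟩ := exists_mem_Icc_consecutive hτ0 (hks.trans_eq hτr.symm) hr
    -- A path through this point reaches it at time k, the time being fixed by the coordinate sum.
    have h3 : n (pathPoint E k) ≤ ((𝓔.filter fun E' => rightSteps E' k = rightSteps E k).card : ℝ) := by
      refine Nat.cast_le.2 (Finset.card_le_card fun E' hE' => ?_)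
      obtain ⟨hm, hE'⟩ := Finset.mem_filter.1 hE'
      have := (mem_pathOf.1 hE').2.2.2
      rw [pathPoint_fst_add_snd, Nat.add_sub_cancel] at this
      refine Finset.mem_filter.2 ⟨hm, ?_⟩
      rw [this, pathPoint]
      exact Nat.add_sub_cancel_left 1 _
    calc n (pathPoint E k) ≤ _ := h3
      _ ≤ _ := (h𝓔 j hj).card_filter_rightSteps_le h1 h2 _
      _ ≤ g j k * (R * 𝓔.card) := by
          simp only [hg]
          rw [if_pos ⟨h1, h2⟩]
          exact mul_le_mul_of_nonneg_left (hR j hj) (Real.sqrt_nonneg _)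
      _ ≤ _ := Finset.single_le_sum (f := fun j => g j k * (R * 𝓔.card))
          (fun j _ => mul_nonneg (hg0 j k) (by positivity)) (Finset.mem_range.2 hj)
  have hgsum : ∀ j ∈ Finset.range r, ∑ k ∈ Finset.range (s + 1), g j k ≤ 4 * √((s : ℝ) + 1) := by
    intro j hj
    have hj := Finset.mem_range.1 hj
    simp only [hg]
    rw [← Finset.sum_filter]
    have : (Finset.range (s + 1)).filter (fun k => τ j ≤ k ∧ k ≤ τ (j + 1))
        = Finset.Icc (τ j) (τ (j + 1)) := by
      ext k
      have := hτs (j + 1) hj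
      simp only [Finset.mem_filter, Finset.mem_range, Finset.mem_Icc]
      omega
    rw [this]
    refine (sum_Icc_sqrt_one_div_add_le (hτ j hj)).trans ?_
    have h1 : τ (j + 1) - τ j ≤ s := (Nat.sub_le _ _).trans (hτs (j + 1) hj)
    have h2 : ((τ (j + 1) - τ j : ℕ) : ℝ) ≤ s := by exact_mod_cast h1
    gcongr
  have hE : ∀ E ∈ 𝓔, ∑ a ∈ pathOf s E, n a ≤ 4 * r * R * √((s : ℝ) + 1) * 𝓔.card := by
    intro E _
    rw [pathOf, Finset.sum_image fun _ _ _ _ h => pathPoint_injective E h]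
    refine (Finset.sum_le_sum (hpoint E)).trans ?_
    rw [Finset.sum_comm]
    simp only [← Finset.sum_mul]
    refine (mul_le_mul_of_nonneg_right (Finset.sum_le_sum hgsum) (by positivity)).trans_eq ?_
    rw [Finset.sum_const, Finset.card_range, nsmul_eq_mul]
    ring
  -- Double counting: one factor `n a` becomes a sum over the paths through `a`, leaving for each
  -- path the sum of `n` along it.
  calc ∑ a ∈ T, n a ^ 2 = ∑ a ∈ T, ∑ E ∈ 𝓔, if a ∈ pathOf s E then n a else 0 := by
        refine Finset.sum_congr rfl fun a _ => ?_
        rw [← Finset.sum_filter, Finset.sum_const, nsmul_eq_mul, sq]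
    _ = ∑ E ∈ 𝓔, ∑ a ∈ T with a ∈ pathOf s E, n a := by
        rw [Finset.sum_comm]
        exact Finset.sum_congr rfl fun E _ => (Finset.sum_filter _ _).symm
    _ ≤ ∑ E ∈ 𝓔, 4 * r * R * √((s : ℝ) + 1) * 𝓔.card := by
        refine Finset.sum_le_sum fun E hEm => le_trans ?_ (hE E hEm)
        exact Finset.sum_le_sum_of_subset_of_nonneg
          (fun a ha => (Finset.mem_filter.1 ha).2) fun a _ _ => hn0 a
    _ = _ := by rw [Finset.sum_const, nsmul_eq_mul]; ring

/-! ### Small overlap for paths through prescribed points -/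

theorem chooseRatio_le {l m : ℕ} (hm : m ≤ l) {d L : ℝ} (hd : 0 < d) (h1 : d ≤ (m : ℝ) + 1)
    (h2 : d ≤ ((l - m : ℕ) : ℝ) + 1) (hL : (l : ℝ) + 2 ≤ L) : chooseRatio l m ≤ (L / d) ^ 2 := by
  have hc : 0 < (l.choose m : ℝ) := by exact_mod_cast Nat.choose_pos hm
  have key := choose_add_two_mul l m hm
  rw [Nat.cast_sub hm] at h2
  have hl : (0 : ℝ) ≤ l := Nat.cast_nonneg l
  have hprod : d ^ 2 ≤ ((m : ℝ) + 1) * ((l : ℝ) - m + 1) := by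
    rw [sq]; exact mul_le_mul h1 h2 hd.le (by positivity)
  have hprod2 : ((l : ℝ) + 2) * ((l : ℝ) + 1) ≤ L ^ 2 := by
    rw [sq]; exact mul_le_mul hL (by linarith) (by positivity) (by linarith)
  rw [chooseRatio, div_pow, div_le_div_iff₀ hc (by positivity)]
  calc ((l + 2).choose (m + 1) : ℝ) * d ^ 2
      ≤ ((l + 2).choose (m + 1) : ℝ) * (((m : ℝ) + 1) * ((l : ℝ) - m + 1)) :=
        mul_le_mul_of_nonneg_left hprod (by positivity)
    _ = (l.choose m : ℝ) * (((l : ℝ) + 2) * ((l : ℝ) + 1)) := key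
    _ ≤ (l.choose m : ℝ) * L ^ 2 := mul_le_mul_of_nonneg_left hprod2 hc.le
    _ = _ := mul_comm _ _

/-- Only times strictly inside the block notice the exchange, since the number of right steps in the
block is unchanged. Hence constraints imposed at block endpoints survive resampling. -/
theorem rightSteps_resample {E G : Finset ℕ} {u v t : ℕ} (hG : G ⊆ Finset.Ico u v)
    (hcard : G.card = (E ∩ Finset.Ico u v).card) (ht : t ≤ u ∨ v ≤ t) :
    rightSteps (E \ Finset.Ico u v ∪ G) t = rightSteps E t := by
  rcases ht with ht | ht
  · refine rightSteps_congr fun i hi => ?_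
    have h1 : i ∉ Finset.Ico u v := fun h => by have := (Finset.mem_Ico.1 h).1; omega
    have h2 : i ∉ G := fun h => h1 (hG h)
    simp [h1, h2]
  · have hsub : Finset.Ico u v ⊆ Finset.range t := fun i hi =>
      Finset.mem_range.2 ((Finset.mem_Ico.1 hi).2.trans_le ht)
    have h1 : (E \ Finset.Ico u v ∪ G) ∩ Finset.range t
        = (E ∩ Finset.range t) \ Finset.Ico u v ∪ G := by
      rw [Finset.union_inter_distrib_right, Finset.inter_eq_left.2 (hG.trans hsub)]
      congr 1
      ext i
      simp only [Finset.mem_inter, Finset.mem_sdiff]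
      tauto
    have h2 : (E ∩ Finset.range t) ∩ Finset.Ico u v = E ∩ Finset.Ico u v := by
      rw [Finset.inter_assoc, Finset.inter_eq_right.2 hsub]
    rw [rightSteps, h1, Finset.card_union_of_disjoint (Finset.sdiff_disjoint.mono_right hG), hcard,
      ← h2, Finset.card_sdiff_add_card_inter, rightSteps]

theorem card_inter_Ico_eq_sub (E : Finset ℕ) {u v : ℕ} (h : u ≤ v) :
    (E ∩ Finset.Ico u v).card = rightSteps E v - rightSteps E u := by
  rw [rightSteps_add_card_Ico E h, Nat.add_sub_cancel_left]

/-- Between consecutive corners, take all right steps first and then all up steps. This shows that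
the family of paths is nonempty. -/
theorem exists_rightSteps_eq {p q : ℕ → ℕ} (hp0 : p 0 = 0) (hq0 : q 0 = 0) (r : ℕ)
    (hp : ∀ i j, i ≤ j → j ≤ r → p i ≤ p j) (hq : ∀ i j, i ≤ j → j ≤ r → q i ≤ q j) :
    ∃ E ⊆ Finset.range (p r + q r), ∀ j ≤ r, rightSteps E (p j + q j) = p j := by
  induction r with
  | zero => exact ⟨∅, by simp, fun j hj => by simp [Nat.le_zero.1 hj, hp0, hq0]⟩
  | succ r ih =>
    obtain ⟨E, hE, h⟩ := ih (fun i j hij hj => hp i j hij (by omega))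
      (fun i j hij hj => hq i j hij (by omega))
    have hp1 := hp r (r + 1) (by omega) le_rfl
    have hq1 := hq r (r + 1) (by omega) le_rfl
    set J := Finset.Ico (p r + q r) (p (r + 1) + q r) with hJ
    have hold : ∀ j ≤ r, rightSteps (E ∪ J) (p j + q j) = p j := fun j hj => by
      refine (rightSteps_congr fun i hi => ?_).trans (h j hj)
      have h1 := hp j r hj (by omega)
      have h2 := hq j r hj (by omega)
      have h3 : i ∉ J := fun hi' => by have := (Finset.mem_Ico.1 hi').1; omega
      simp [h3]
    refine ⟨E ∪ J, Finset.union_subset (hE.trans ?_) fun i hi => ?_, fun j hj => ?_⟩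
    · exact Finset.range_subset_range.2 (by omega)
    · have := (Finset.mem_Ico.1 hi).2
      exact Finset.mem_range.2 (by omega)
    · rcases Nat.lt_or_ge r j with hj' | hj'
      · obtain rfl : j = r + 1 := by omega
        rw [rightSteps_add_card_Ico _ (by omega : p r + q r ≤ p (r + 1) + q (r + 1)),
          hold r le_rfl, Finset.union_inter_distrib_right]
        have h1 : E ∩ Finset.Ico (p r + q r) (p (r + 1) + q (r + 1)) = ∅ := by
          rw [← Finset.disjoint_iff_inter_eq_empty, Finset.disjoint_left]
          intro i hi hi'
          have := Finset.mem_range.1 (hE hi)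
          have := (Finset.mem_Ico.1 hi').1
          omega
        have h2 : J ⊆ Finset.Ico (p r + q r) (p (r + 1) + q (r + 1)) :=
          Finset.Ico_subset_Ico_right (by omega)
        rw [h1, Finset.empty_union, Finset.inter_eq_left.2 h2, hJ, Nat.card_Ico]
        omega
      · exact hold j hj'

/-- The overlap bound for a scheme: the sum over the grid of the squared numbers of paths through
the points is at most of the order of `√N` times the squared number of all paths. -/
def PathScheme.HasSmallOverlap (S : PathScheme) (C : ℝ) (N : ℕ) : Prop :=
  1 ≤ N ∧ 1 ≤ S.height N ∧ (S.paths N).Nonempty ∧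
    ∑ a ∈ S.box N, (((S.paths N).filter (a ∈ ·)).card : ℝ) ^ 2
      ≤ C * √(N : ℝ) * ((S.paths N).card : ℝ) ^ 2

/-- The criterion that each scheme has to meet: nonemptiness, closure under resampling in each of r
blocks, and a bound `R` for the average of `chooseRatio` in each block. The factor √H converts the
square root of the path length into √N. -/
theorem PathScheme.hasSmallOverlap_of_stepSets {S : PathScheme} {N : ℕ} (hN : 1 ≤ N)
    (hM : 1 ≤ S.height N) (hne : (S.stepSets N).Nonempty) {r : ℕ} {τ : ℕ → ℕ} (hτ0 : τ 0 = 0)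
    (hτr : τ r = N + S.height N - 2) (hr : 0 < r)
    (hτ : ∀ i j, i ≤ j → j ≤ r → τ i ≤ τ j)
    (hcl : ∀ j < r, ClosedUnderResampling (S.stepSets N) (τ j) (τ (j + 1))) {R : ℝ}
    (hR0 : 0 ≤ R)
    (hR : ∀ j < r, ∑ E ∈ S.stepSets N, chooseRatio (τ (j + 1) - τ j)
      (E ∩ Finset.Ico (τ j) (τ (j + 1))).card ≤ R * (S.stepSets N).card) {H : ℝ}
    (hH : (N : ℝ) + S.height N ≤ H * N) :
    S.HasSmallOverlap (4 * r * R * √H) N := by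
  refine ⟨hN, hM, ?_, ?_⟩
  · rw [← Finset.card_pos, S.card_paths hN hM]
    exact Finset.card_pos.2 hne
  · simp only [S.card_paths hN hM, S.card_paths_filter_mem hN hM]
    have hmain := sum_card_filter_mem_pathOf_sq_le hτ0 hτr hr
      (fun j hj => hτ j (j + 1) (by omega) hj) (fun j hj => (hτ j r hj le_rfl).trans_eq hτr)
      hcl hR0 hR (S.box N)
    refine hmain.trans ?_
    have hs : (((N + S.height N - 2 : ℕ) : ℝ)) + 1 ≤ H * N := by
      rw [Nat.cast_sub (by omega)]
      push_cast
      linarith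
    have h1 : √((((N + S.height N - 2 : ℕ) : ℝ)) + 1) ≤ √H * √(N : ℝ) := by
      rw [← Real.sqrt_mul' H (Nat.cast_nonneg N)]
      exact Real.sqrt_le_sqrt hs
    have h2 : 0 ≤ 4 * (r : ℝ) * R := by positivity
    calc _ ≤ 4 * r * R * (√H * √(N : ℝ)) * ((S.stepSets N).card : ℝ) ^ 2 := by gcongr
      _ = _ := by ring

/-- The sequence `0, y 0, …, y (n - 1), c`. -/
def withEndpoints {n : ℕ} (y : Fin n → ℝ) (c : ℝ) : ℕ → ℝ
  | 0 => 0
  | j + 1 => if h : j < n then y ⟨j, h⟩ else c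

theorem withEndpoints_last {n : ℕ} (y : Fin n → ℝ) (c : ℝ) : withEndpoints y c (n + 1) = c := by
  simp [withEndpoints]

theorem withEndpoints_succ {n : ℕ} (y : Fin n → ℝ) (c : ℝ) (i : Fin n) :
    withEndpoints y c (i + 1) = y i := by
  simp [withEndpoints]

theorem withEndpoints_lt {n : ℕ} {y : Fin n → ℝ} {c : ℝ} (hc : 0 < c) (hy : StrictMono y)
    (hy_mem : ∀ i, 0 < y i ∧ y i < c) {i j : ℕ} (hij : i < j) (hj : j ≤ n + 1) :
    withEndpoints y c i < withEndpoints y c j := by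
  obtain ⟨j, rfl⟩ := Nat.exists_eq_succ_of_ne_zero (by omega : j ≠ 0)
  cases i with
  | zero =>
    simp only [withEndpoints]
    split_ifs with h
    · exact (hy_mem _).1
    · exact hc
  | succ i =>
    simp only [withEndpoints]
    rw [dif_pos (by omega : i < n)]
    split_ifs with h
    · exact hy (by simp only [Fin.mk_lt_mk]; omega)
    · exact (hy_mem _).2

theorem exists_pos_le_withEndpoints_sub {n : ℕ} {y : Fin n → ℝ} {c : ℝ} (hc : 0 < c)
    (hy : StrictMono y) (hy_mem : ∀ i, 0 < y i ∧ y i < c) :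
    ∃ δ > 0, ∀ j < n + 1, δ ≤ withEndpoints y c (j + 1) - withEndpoints y c j := by
  obtain ⟨j₀, hj₀, hmin⟩ := Finset.exists_min_image (Finset.range (n + 1))
    (fun j => withEndpoints y c (j + 1) - withEndpoints y c j) ⟨0, by simp⟩
  have hj₀ := Finset.mem_range.1 hj₀
  refine ⟨_, sub_pos.2 (withEndpoints_lt hc hy hy_mem (Nat.lt_succ_self j₀) (by omega)),
    fun j hj => hmin j (Finset.mem_range.2 hj)⟩

theorem le_floor_mul_sub_floor_mul {a b δ : ℝ} (ha : 0 ≤ a) {N : ℕ} (hab : δ ≤ b - a) :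
    δ * N - 1 ≤ ((⌊b * N⌋₊ - 1 - (⌊a * N⌋₊ - 1) : ℕ) : ℝ) + 1 := by
  have h1 := Nat.lt_floor_add_one (b * N)
  have h2 := Nat.floor_le (mul_nonneg ha (Nat.cast_nonneg N))
  have h3 : (⌊b * N⌋₊ : ℝ) ≤ ((⌊b * N⌋₊ - 1 - (⌊a * N⌋₊ - 1) : ℕ) : ℝ) + ⌊a * N⌋₊ + 1 := by
    exact_mod_cast (by omega : ⌊b * (N : ℝ)⌋₊ ≤ (⌊b * (N : ℝ)⌋₊ - 1 - (⌊a * (N : ℝ)⌋₊ - 1))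
      + ⌊a * (N : ℝ)⌋₊ + 1)
  have h4 := mul_le_mul_of_nonneg_right hab (Nat.cast_nonneg N : (0 : ℝ) ≤ N)
  have h5 : b * N < (⌊b * N⌋₊ : ℝ) + 1 := h1
  linarith

theorem PathScheme.throughPoints_hasSmallOverlap (ξ : ℝ) (hξ : 0 < ξ) (n : ℕ) (x y : Fin n → ℝ)
    (hx : StrictMono x) (hy : StrictMono y) (hx_mem : ∀ i, 0 < x i ∧ x i < ξ)
    (hy_mem : ∀ i, 0 < y i ∧ y i < 1) :
    ∃ C, ∀ᶠ N in atTop,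
      (PathScheme.throughPoints ξ hξ n x y hx hy hx_mem hy_mem).HasSmallOverlap C N := by
  set S := PathScheme.throughPoints ξ hξ n x y hx hy hx_mem hy_mem with hS
  obtain ⟨δ₁, hδ₁, hY⟩ := exists_pos_le_withEndpoints_sub one_pos hy hy_mem
  obtain ⟨δ₂, hδ₂, hX⟩ := exists_pos_le_withEndpoints_sub hξ hx hx_mem
  set Y := withEndpoints y 1 with hYdef
  set X := withEndpoints x ξ with hXdef
  set δ := min δ₁ δ₂ with hδdef
  have hδ : 0 < δ := lt_min hδ₁ hδ₂
  have hYlt : ∀ {i j : ℕ}, i < j → j ≤ n + 1 → Y i < Y j := withEndpoints_lt one_pos hy hy_mem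
  have hXlt : ∀ {i j : ℕ}, i < j → j ≤ n + 1 → X i < X j := withEndpoints_lt hξ hx hx_mem
  have hY0 : ∀ j ≤ n + 1, 0 ≤ Y j := fun j hj => by
    rcases Nat.eq_zero_or_pos j with rfl | h
    · exact le_rfl
    · exact (hYlt h hj).le
  have hX0 : ∀ j ≤ n + 1, 0 ≤ X j := fun j hj => by
    rcases Nat.eq_zero_or_pos j with rfl | h
    · exact le_rfl
    · exact (hXlt h hj).le
  -- There are n + 1 blocks of length at most (1 + ξ)N, each with at least about δN steps of either
  -- kind. Halving δ absorbs the rounding for large N.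
  refine ⟨4 * (n + 1 : ℕ) * ((1 + ξ) / (δ / 2)) ^ 2 * √(1 + ξ), ?_⟩
  have hfl : ∀ a : ℝ, 0 < a → ∀ᶠ N : ℕ in atTop, 1 ≤ ⌊a * N⌋₊ := fun a ha =>
    (tendsto_nat_floor_atTop.comp
      (tendsto_natCast_atTop_atTop.const_mul_atTop ha)).eventually_ge_atTop 1
  have hflY : ∀ᶠ N : ℕ in atTop, ∀ j ∈ Finset.Icc 1 (n + 1), 1 ≤ ⌊Y j * N⌋₊ :=
    (Finset.eventually_all _).2 fun j hj => hfl _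
      (hYlt (Finset.mem_Icc.1 hj).1 (Finset.mem_Icc.1 hj).2)
  have hflX : ∀ᶠ N : ℕ in atTop, ∀ j ∈ Finset.Icc 1 (n + 1), 1 ≤ ⌊X j * N⌋₊ :=
    (Finset.eventually_all _).2 fun j hj => hfl _
      (hXlt (Finset.mem_Icc.1 hj).1 (Finset.mem_Icc.1 hj).2)
  have hδN : ∀ᶠ N : ℕ in atTop, 1 ≤ δ / 2 * (N : ℝ) :=
    (tendsto_natCast_atTop_atTop.const_mul_atTop (half_pos hδ)).eventually_ge_atTop 1
  filter_upwards [hflY, hflX, hδN, eventually_ge_atTop 1] with N hflY hflX hδN hN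
  have hN0 : (0 : ℝ) < N := by exact_mod_cast hN
  -- `p j` and `q j` are the numbers of right and up steps from (1, 1) to the j-th corner. For j = 0
  -- the truncated subtraction gives 0, as it should at the starting point.
  set p : ℕ → ℕ := fun j => ⌊Y j * N⌋₊ - 1 with hp
  set q : ℕ → ℕ := fun j => ⌊X j * N⌋₊ - 1 with hq
  have hYlast : ⌊Y (n + 1) * (N : ℝ)⌋₊ = N := by rw [hYdef, withEndpoints_last, one_mul, Nat.floor_natCast]
  have hXlast : ⌊X (n + 1) * (N : ℝ)⌋₊ = S.height N := by rw [hXdef, withEndpoints_last]; rfl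
  have hM : 1 ≤ S.height N := hXlast ▸ hflX (n + 1) (by simp)
  have hMle : (S.height N : ℝ) ≤ ξ * N := Nat.floor_le (by positivity)
  have hpr : p (n + 1) = N - 1 := by simp only [hp, hYlast]
  have hqr : q (n + 1) = S.height N - 1 := by simp only [hq, hXlast]
  have hp0 : p 0 = 0 := by simp [hp, hYdef, withEndpoints]
  have hq0 : q 0 = 0 := by simp [hq, hXdef, withEndpoints]
  have hs : p (n + 1) + q (n + 1) = N + S.height N - 2 := by rw [hpr, hqr]; omega
  have hpm : ∀ i j, i ≤ j → j ≤ n + 1 → p i ≤ p j := fun i j hij hj => by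
    rcases hij.eq_or_lt with rfl | h
    · exact le_rfl
    · exact Nat.sub_le_sub_right (Nat.floor_le_floor
        (mul_le_mul_of_nonneg_right (hYlt h hj).le hN0.le)) 1
  have hqm : ∀ i j, i ≤ j → j ≤ n + 1 → q i ≤ q j := fun i j hij hj => by
    rcases hij.eq_or_lt with rfl | h
    · exact le_rfl
    · exact Nat.sub_le_sub_right (Nat.floor_le_floor
        (mul_le_mul_of_nonneg_right (hXlt h hj).le hN0.le)) 1
  have hτm : ∀ i j, i ≤ j → j ≤ n + 1 → p i + q i ≤ p j + q j := fun i j hij hj =>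
    add_le_add (hpm i j hij hj) (hqm i j hij hj)
  have hmem : ∀ E, E ∈ S.stepSets N ↔ E ⊆ Finset.range (N + S.height N - 2) ∧
      ∀ j ≤ n + 1, rightSteps E (p j + q j) = p j := by
    intro E
    rw [PathScheme.mem_stepSets]
    have hpt : ∀ i : Fin n, (⌊y i * N⌋₊, ⌊x i * N⌋₊) ∈ pathOf (N + S.height N - 2) E ↔
        rightSteps E (p (i + 1) + q (i + 1)) = p (i + 1) := fun i => by
      have hi := i.isLt
      have h1 := hflY (i + 1) (by simp only [Finset.mem_Icc]; omega)
      have h2 := hflX (i + 1) (by simp only [Finset.mem_Icc]; omega)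
      have h3 := hτm (i + 1) (n + 1) (by omega) le_rfl
      have hyi : Y (i + 1) = y i := withEndpoints_succ y 1 i
      have hxi : X (i + 1) = x i := withEndpoints_succ x ξ i
      rw [hs] at h3
      simp only [hp, hq, hyi, hxi] at h1 h2 h3 ⊢
      rw [mem_pathOf]
      simp only
      rw [show ⌊y i * (N : ℝ)⌋₊ - 1 + (⌊x i * (N : ℝ)⌋₊ - 1)
        = ⌊y i * (N : ℝ)⌋₊ + ⌊x i * (N : ℝ)⌋₊ - 2 by omega]
      refine ⟨fun h => h.2.2.2, fun h => ⟨h1, h2, by omega, h⟩⟩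
    refine and_congr_right fun _ => ⟨fun h j hj => ?_, fun h => ⟨?_, fun i => ?_⟩⟩
    · rcases Nat.eq_zero_or_pos j with rfl | hj0
      · simp [hp0, hq0]
      · rcases hj.eq_or_lt with rfl | hj'
        · rw [hs, hpr]; exact h.1
        · have := (hpt ⟨j - 1, by omega⟩).1 (h.2 _)
          simpa only [Nat.sub_add_cancel hj0] using this
    · rw [← hs, h (n + 1) le_rfl, hpr]
    · exact (hpt i).2 (h (i + 1) (by have := i.isLt; omega))
  -- All constraints concern the times p k + q k, none of which lies strictly inside a block.
  have hcl : ∀ j < n + 1, ClosedUnderResampling (S.stepSets N) (p j + q j)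
      (p (j + 1) + q (j + 1)) := by
    intro j hj E hE G hG hGc
    rw [hmem] at hE ⊢
    refine ⟨Finset.union_subset (Finset.sdiff_subset.trans hE.1) fun i hi => ?_, fun k hk => ?_⟩
    · have h1 := (Finset.mem_Ico.1 (hG hi)).2
      have h2 := hτm (j + 1) (n + 1) (by omega) le_rfl
      exact Finset.mem_range.2 (by omega)
    · rw [rightSteps_resample hG hGc, hE.2 k hk]
      rcases Nat.lt_or_ge j k with h | h
      · exact Or.inr (hτm _ _ h hk)
      · exact Or.inl (hτm _ _ h (by omega))
  obtain ⟨E₀, hE₀, hE₀'⟩ := exists_rightSteps_eq hp0 hq0 (n + 1) hpm hqm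
  refine PathScheme.hasSmallOverlap_of_stepSets hN hM ⟨E₀, (hmem E₀).2 ⟨hs ▸ hE₀, hE₀'⟩⟩
    (τ := fun j => p j + q j) (by simp [hp0, hq0]) hs (Nat.succ_pos n) hτm hcl (by positivity)
    (fun j hj => ?_) (by linarith)
  rw [mul_comm, ← nsmul_eq_mul, ← Finset.sum_const]
  refine Finset.sum_le_sum fun E hE => ?_
  rw [hmem] at hE
  have h1 := hpm j (j + 1) (by omega) hj
  have h2 := hqm j (j + 1) (by omega) hj
  have h3 := hτm (j + 1) (n + 1) (by omega) le_rfl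
  rw [card_inter_Ico_eq_sub E (hτm j (j + 1) (by omega) hj), hE.2 j (by omega), hE.2 (j + 1) hj]
  have hdiv : (1 + ξ) / (δ / 2) = ((1 + ξ) * N) / (δ / 2 * N) := by field_simp
  rw [hdiv]
  refine chooseRatio_le (by omega) (by positivity) ?_ ?_ ?_
  · have := le_floor_mul_sub_floor_mul (N := N) (hY0 j (by omega))
      ((min_le_left δ₁ δ₂).trans (hY j hj))
    refine le_trans ?_ this
    linarith
  · have := le_floor_mul_sub_floor_mul (N := N) (hX0 j (by omega))
      ((min_le_right δ₁ δ₂).trans (hX j hj))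
    rw [show p (j + 1) + q (j + 1) - (p j + q j) - (p (j + 1) - p j) = q (j + 1) - q j by omega]
    refine le_trans ?_ this
    linarith
  · have h4 : p (j + 1) + q (j + 1) - (p j + q j) + 2 ≤ N + S.height N := by omega
    have h5 : ((p (j + 1) + q (j + 1) - (p j + q j) : ℕ) : ℝ) + 2 ≤ N + S.height N := by
      exact_mod_cast h4
    linarith

/-- The case of no prescribed points, hence of a single block. -/
theorem PathScheme.unrestricted_hasSmallOverlap (ξ : ℝ) (hξ : 0 < ξ) :
    ∃ C, ∀ᶠ N in atTop, (PathScheme.unrestricted ξ hξ).HasSmallOverlap C N := by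
  obtain ⟨C, hC⟩ := PathScheme.throughPoints_hasSmallOverlap ξ hξ 0 Fin.elim0 Fin.elim0
    (fun i => i.elim0) (fun i => i.elim0) (fun i => i.elim0) (fun i => i.elim0)
  refine ⟨C, hC.mono fun N h => ?_⟩
  have hpaths : (PathScheme.unrestricted ξ hξ).paths N = (PathScheme.throughPoints ξ hξ 0 Fin.elim0
      Fin.elim0 (fun i => i.elim0) (fun i => i.elim0) (fun i => i.elim0)
      (fun i => i.elim0)).paths N := by
    ext σ
    rw [PathScheme.mem_paths, PathScheme.mem_paths]
    simp only [PathScheme.box, PathScheme.height, PathScheme.Restriction, IsEmpty.forall_iff]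
  unfold PathScheme.HasSmallOverlap at h ⊢
  rw [hpaths]
  exact h

/-! ### Small overlap for paths avoiding the square -/

theorem chooseRatio_symm {l m : ℕ} (hm : m ≤ l) : chooseRatio l (l - m) = chooseRatio l m := by
  rw [chooseRatio, chooseRatio, Nat.choose_symm hm,
    ← Nat.choose_symm (by omega : m + 1 ≤ l + 2), show l + 2 - (m + 1) = l - m + 1 by omega]

/-- Doubling clears the half-integral centre and leaves integer inequalities. -/
theorem inCentralSquare_iff {N b : ℕ} {a : ℕ × ℕ} :
    InCentralSquare N b a ↔
      |2 * (a.1 : ℤ) - (N + 1)| ≤ b ∧ |2 * (a.2 : ℤ) - (N + 1)| ≤ b := by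
  have key : ∀ c : ℕ, |(c : ℝ) - ((N : ℝ) + 1) / 2| ≤ (b : ℝ) / 2 ↔ |2 * (c : ℤ) - (N + 1)| ≤ b :=
    fun c => by
      have h1 : (c : ℝ) - ((N : ℝ) + 1) / 2 = ((2 * (c : ℤ) - (N + 1) : ℤ) : ℝ) / 2 := by
        push_cast; ring
      rw [h1, abs_div, abs_two, div_le_div_iff_of_pos_right two_pos, ← Int.cast_abs]
      exact_mod_cast Iff.rfl
  rw [InCentralSquare, key, key]

/-- A path of `2 n` steps from `(1, 1)` to `(n + 1, n + 1)` avoids the central square if and only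
if it does so on the antidiagonal. -/
theorem pathOf_avoids_centralSquare_iff {n b : ℕ} {E : Finset ℕ}
    (hE : rightSteps E (2 * n) = n) :
    (∀ a ∈ pathOf (2 * n) E, ¬ InCentralSquare (n + 1) b a) ↔
      (b : ℤ) < |2 * (rightSteps E n : ℤ) - n| := by
  have hn := rightSteps_le E n
  constructor
  · intro h
    have h1 := h _ (pathPoint_mem_pathOf (by omega : n ≤ 2 * n) E)
    rw [inCentralSquare_iff] at h1
    simp only [pathPoint] at h1
    push_cast [Nat.cast_sub hn] at h1
    by_contra h2
    rw [not_lt, abs_le] at h2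
    refine h1 ⟨abs_le.2 (by omega), abs_le.2 (by omega)⟩
  · rintro h a ha ha'
    obtain ⟨k, hk, rfl⟩ := Finset.mem_image.1 ha
    have hk := Finset.mem_range.1 hk
    rw [inCentralSquare_iff, abs_le, abs_le] at ha'
    have hkk := rightSteps_le E k
    simp only [pathPoint] at ha'
    push_cast [Nat.cast_sub hkk] at ha'
    rw [lt_abs] at h
    -- On the antidiagonal the point lies beyond the square in both coordinates, on opposite sides.
    -- Monotonicity keeps the coordinate that is too small on its side at earlier times, and the one
    -- that is too large at later times.
    rcases le_total k n with h1 | h1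
    · have h2 := rightSteps_mono E h1
      have h3 := rightSteps_sub_le E h1
      omega
    · have h2 := rightSteps_mono E h1
      have h3 := rightSteps_sub_le E h1
      omega

/-- Sums of products of neighbouring binomial coefficients over a set that contains the successor
of each of its small elements. -/
theorem sum_choose_mul_choose_succ_le {n : ℕ} {A : Finset ℕ} {κ : ℝ} (hκ : 0 ≤ κ)
    (hA : ∀ x ∈ A, x + 1 ∈ A ∨ (n : ℝ) ≤ κ * (x + 1)) :
    ∑ x ∈ A, (n.choose x : ℝ) * (n.choose (x + 1) : ℝ)
      ≤ (κ + 1) * ∑ x ∈ A, (n.choose x : ℝ) ^ 2 := by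
  set c : ℕ → ℝ := fun x => (n.choose x : ℝ) with hc
  have hc0 : ∀ x, 0 ≤ c x := fun x => Nat.cast_nonneg _
  -- If x + 1 is in `A`, the product is at most half the sum of the two squares. Otherwise c (x + 1)
  -- ≤ κ c x, as the ratio of these neighbours is at most n/(x + 1).
  have hpt : ∀ x ∈ A, c x * c (x + 1)
      ≤ (κ + 1 / 2) * c x ^ 2 + 1 / 2 * if x + 1 ∈ A then c (x + 1) ^ 2 else 0 := by
    intro x hx
    by_cases hxA : x + 1 ∈ A
    · rw [if_pos hxA]
      have := mul_nonneg hκ (sq_nonneg (c x))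
      nlinarith [sq_nonneg (c x - c (x + 1))]
    · rw [if_neg hxA]
      have h1 := (hA x hx).resolve_left hxA
      have h2 : c (x + 1) * ((x : ℝ) + 1) ≤ c x * n := by
        have h3 := Nat.choose_succ_right_eq n x
        have h4 : n.choose (x + 1) * (x + 1) ≤ n.choose x * n := by
          rw [h3]; exact Nat.mul_le_mul_left _ (Nat.sub_le _ _)
        simp only [hc]
        exact_mod_cast h4
      have h5 : c (x + 1) ≤ κ * c x := by
        have hx1 : (0 : ℝ) < x + 1 := by positivity
        refine le_of_mul_le_mul_right (h2.trans ?_) hx1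
        calc c x * n ≤ c x * (κ * (x + 1)) := mul_le_mul_of_nonneg_left h1 (hc0 x)
          _ = _ := by ring
      have := mul_le_mul_of_nonneg_left h5 (hc0 x)
      nlinarith [sq_nonneg (c x)]
  have hshift : ∑ x ∈ A, (if x + 1 ∈ A then c (x + 1) ^ 2 else 0) ≤ ∑ x ∈ A, c x ^ 2 := by
    rw [← Finset.sum_filter]
    have : ∑ x ∈ A with x + 1 ∈ A, c (x + 1) ^ 2
        = ∑ z ∈ (A.filter fun x => x + 1 ∈ A).image (· + 1), c z ^ 2 :=
      (Finset.sum_image (g := fun x => x + 1) (f := fun z => c z ^ 2)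
        fun _ _ _ _ h => Nat.add_right_cancel h).symm
    rw [this]
    refine Finset.sum_le_sum_of_subset_of_nonneg (fun z hz => ?_) fun _ _ _ => sq_nonneg _
    obtain ⟨x, hx, rfl⟩ := Finset.mem_image.1 hz
    exact (Finset.mem_filter.1 hx).2
  refine (Finset.sum_le_sum hpt).trans ?_
  rw [Finset.sum_add_distrib, ← Finset.mul_sum, ← Finset.mul_sum]
  linarith

/-- `chooseRatio n x` is of order n at x = 0 and x = n, so only its average with the weights
(n.choose x)² is bounded. Pascal's rule, used twice, leaves products of neighbouring binomial
coefficients, and the symmetry of `A` carries left neighbours to right neighbours. -/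
theorem sum_choose_mul_choose_add_two_le {n : ℕ} {A : Finset ℕ} {κ : ℝ} (hκ : 0 ≤ κ)
    (hA : ∀ x ∈ A, x + 1 ∈ A ∨ (n : ℝ) ≤ κ * (x + 1)) (hAn : ∀ x ∈ A, x ≤ n)
    (hsymm : ∀ x ∈ A, n - x ∈ A) :
    ∑ x ∈ A, (n.choose x : ℝ) * ((n + 2).choose (x + 1) : ℝ)
      ≤ (2 * κ + 4) * ∑ x ∈ A, (n.choose x : ℝ) ^ 2 := by
  have h1 := sum_choose_mul_choose_succ_le hκ hA
  -- The left neighbour is written as n.choose (n - x + 1), which correctly vanishes at x = 0.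
  have hpascal : ∀ x ∈ A, ((n + 2).choose (x + 1) : ℝ)
      = 2 * (n.choose x : ℝ) + (n.choose (x + 1) : ℝ) + (n.choose (n - x + 1) : ℝ) := by
    intro x hx
    have hxn := hAn x hx
    cases x with
    | zero =>
      rw [Nat.choose_eq_zero_of_lt (by omega : n < n - 0 + 1)]
      simp
      ring
    | succ x =>
      have e1 : (n + 2).choose (x + 1 + 1) = n.choose x + n.choose (x + 1)
          + (n.choose (x + 1) + n.choose (x + 1 + 1)) := by
        rw [Nat.choose_succ_succ, Nat.choose_succ_succ n x, Nat.choose_succ_succ n (x + 1)]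
      rw [show n - (x + 1) + 1 = n - x by omega, Nat.choose_symm (by omega), e1]
      push_cast
      ring
  have hreflect : ∑ x ∈ A, (n.choose x : ℝ) * (n.choose (n - x + 1) : ℝ)
      = ∑ x ∈ A, (n.choose x : ℝ) * (n.choose (x + 1) : ℝ) := by
    refine Finset.sum_nbij' (fun x => n - x) (fun x => n - x) hsymm hsymm
      (fun x hx => Nat.sub_sub_self (hAn x hx)) (fun x hx => Nat.sub_sub_self (hAn x hx))
      fun x hx => ?_
    rw [Nat.choose_symm (hAn x hx)]
  calc ∑ x ∈ A, (n.choose x : ℝ) * ((n + 2).choose (x + 1) : ℝ)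
      = 2 * ∑ x ∈ A, (n.choose x : ℝ) ^ 2
        + ∑ x ∈ A, (n.choose x : ℝ) * (n.choose (x + 1) : ℝ)
        + ∑ x ∈ A, (n.choose x : ℝ) * (n.choose (n - x + 1) : ℝ) := by
        rw [Finset.mul_sum, ← Finset.sum_add_distrib, ← Finset.sum_add_distrib]
        refine Finset.sum_congr rfl fun x hx => ?_
        rw [hpascal x hx]
        ring
    _ ≤ _ := by rw [hreflect]; linarith

/-- The step sets of paths of `2 n` steps whose number of right steps among the first `n` steps
lies in `A`. -/
theorem sum_comp_rightSteps_half {n : ℕ} {A : Finset ℕ} (hA : ∀ x ∈ A, x ≤ n)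
    {𝓔 : Finset (Finset ℕ)}
    (h𝓔 : ∀ E, E ∈ 𝓔 ↔ E ⊆ Finset.range (2 * n) ∧ rightSteps E (2 * n) = n ∧ rightSteps E n ∈ A)
    (f : ℕ → ℝ) :
    ∑ E ∈ 𝓔, f (rightSteps E n) = ∑ x ∈ A, (n.choose x : ℝ) ^ 2 * f x := by
  rw [← Finset.sum_fiberwise_of_maps_to (g := fun E => rightSteps E n) (t := A)
    fun E hE => ((h𝓔 E).1 hE).2.2]
  refine Finset.sum_congr rfl fun x hx => ?_
  -- Choose x right steps in the first half and n - x in the second.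
  have hcard : (𝓔.filter fun E => rightSteps E n = x).card = n.choose x ^ 2 := by
    have h1 := card_filter_powersetCard_Ico (Nat.zero_le n) (by omega : n ≤ 2 * n) (hA x hx)
    rw [show 2 * n - n = n by omega, Nat.sub_zero, Nat.choose_symm (hA x hx), ← sq] at h1
    rw [← h1]
    congr 1
    ext E
    simp only [Finset.mem_filter, h𝓔, Finset.mem_powersetCard, ← Finset.range_eq_Ico]
    constructor
    · rintro ⟨⟨h2, h3, -⟩, h4⟩
      exact ⟨⟨h2, (rightSteps_eq_card h2).symm.trans h3⟩, h4⟩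
    · rintro ⟨⟨h2, h3⟩, h4⟩
      exact ⟨⟨h2, (rightSteps_eq_card h2).trans h3, (show rightSteps E n = x from h4) ▸ hx⟩, h4⟩
  rw [Finset.sum_congr rfl fun E hE => by rw [(Finset.mem_filter.1 hE).2], Finset.sum_const, hcard,
    nsmul_eq_mul]
  push_cast
  rfl

theorem PathScheme.avoidSquare_hasSmallOverlap (β : ℝ) (hβ : 0 < β ∧ β < 1) :
    ∃ C, ∀ᶠ N in atTop, (PathScheme.avoidSquare β hβ).HasSmallOverlap C N := by
  set S := PathScheme.avoidSquare β hβ with hS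
  have hβ1 : 0 < 1 - β := by linarith [hβ.2]
  -- If x is to the left of the excluded middle range but x + 1 is not in `A`, then x is close to (1
  -- - β)n/2. The value 4 in place of 2 leaves room for rounding.
  set κ : ℝ := 4 / (1 - β) with hκ
  have hκ0 : 0 < κ := by positivity
  refine ⟨4 * (2 : ℕ) * (2 * κ + 4) * √2, ?_⟩
  have hlarge : ∀ᶠ N : ℕ in atTop, 4 ≤ (1 - β) * (N : ℝ) :=
    (tendsto_natCast_atTop_atTop.const_mul_atTop hβ1).eventually_ge_atTop 4
  filter_upwards [hlarge, eventually_ge_atTop 1] with N hlarge hN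
  obtain ⟨n, rfl⟩ := Nat.exists_eq_add_of_le' hN
  set b : ℕ := ⌊β * ((n + 1 : ℕ) : ℝ)⌋₊ with hb
  have hbn : (b : ℝ) ≤ β * (n + 1) := by
    have := Nat.floor_le (mul_nonneg hβ.1.le (Nat.cast_nonneg (n + 1)))
    push_cast at this ⊢
    simpa [hb] using this
  have hheight : S.height (n + 1) = n + 1 := rfl
  have hsteps : n + 1 + S.height (n + 1) - 2 = 2 * n := by rw [hheight]; omega
  push_cast at hlarge
  have hbn' : (b : ℝ) < n := by nlinarith
  have hbn'' : b < n := by exact_mod_cast hbn'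
  set A : Finset ℕ := (Finset.range (n + 1)).filter fun x => (b : ℤ) < |2 * (x : ℤ) - n| with hA
  have hAn : ∀ x ∈ A, x ≤ n := fun x hx =>
    Nat.lt_succ_iff.1 (Finset.mem_range.1 (Finset.mem_filter.1 hx).1)
  have hAmem : ∀ x, x ∈ A ↔ x ≤ n ∧ (b : ℤ) < |2 * (x : ℤ) - n| := fun x => by
    simp only [hA, Finset.mem_filter, Finset.mem_range, Nat.lt_succ_iff]
  have hmem : ∀ E, E ∈ S.stepSets (n + 1) ↔ E ⊆ Finset.range (2 * n) ∧
      rightSteps E (2 * n) = n ∧ rightSteps E n ∈ A := by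
    intro E
    rw [PathScheme.mem_stepSets, hsteps, Nat.add_sub_cancel, hAmem]
    refine and_congr_right fun _ => and_congr_right fun hE => ?_
    rw [and_iff_right (rightSteps_le E n)]
    exact pathOf_avoids_centralSquare_iff hE
  have h0A : 0 ∈ A := by
    rw [hAmem, lt_abs]; push_cast; omega
  have hsymm : ∀ x ∈ A, n - x ∈ A := fun x hx => by
    rw [hAmem, lt_abs] at hx ⊢
    push_cast [Nat.cast_sub hx.1]
    omega
  have hsucc : ∀ x ∈ A, x + 1 ∈ A ∨ (n : ℝ) ≤ κ * (x + 1) := fun x hx => by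
    refine or_iff_not_imp_right.2 fun h => ?_
    rw [not_le, hκ, div_mul_eq_mul_div, div_lt_iff₀ hβ1] at h
    have h1 : 2 * ((x : ℝ) + 1) + b < n := by nlinarith
    have h2 : 2 * (x + 1) + b < n := by exact_mod_cast h1
    rw [hAmem, lt_abs]
    push_cast
    omega
  have hsum := sum_comp_rightSteps_half hAn hmem
  have hcard : ((S.stepSets (n + 1)).card : ℝ) = ∑ x ∈ A, (n.choose x : ℝ) ^ 2 := by
    have := hsum fun _ => 1
    simpa using this
  have hratio : ∑ E ∈ S.stepSets (n + 1), chooseRatio n (rightSteps E n)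
      ≤ (2 * κ + 4) * (S.stepSets (n + 1)).card := by
    rw [hsum, hcard]
    refine le_trans (Finset.sum_le_sum fun x hx => ?_)
      (sum_choose_mul_choose_add_two_le hκ0.le hsucc hAn hsymm)
    have : 0 < (n.choose x : ℝ) := by exact_mod_cast Nat.choose_pos (hAn x hx)
    rw [chooseRatio, sq, mul_assoc, mul_div_cancel₀ _ this.ne']
  have hne : (S.stepSets (n + 1)).Nonempty := by
    rw [← Finset.card_pos, ← Nat.cast_pos (α := ℝ), hcard]
    refine Finset.sum_pos' (fun x _ => sq_nonneg _) ⟨0, h0A, by simp⟩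
  -- The restriction depends only on the position at time n, the common endpoint of the two blocks.
  have hcl : ∀ j < 2, ClosedUnderResampling (S.stepSets (n + 1)) (j * n) ((j + 1) * n) := by
    intro j hj E hE G hG hGc
    rw [hmem] at hE ⊢
    have hj' : (j + 1) * n ≤ 2 * n := Nat.mul_le_mul_right n hj
    refine ⟨Finset.union_subset (Finset.sdiff_subset.trans hE.1) fun i hi => ?_, ?_, ?_⟩
    · have h1 := (Finset.mem_Ico.1 (hG hi)).2
      exact Finset.mem_range.2 (by omega)
    · rw [rightSteps_resample hG hGc (Or.inr hj')]; exact hE.2.1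
    · rw [rightSteps_resample hG hGc]
      · exact hE.2.2
      · interval_cases j
        · right; omega
        · left; omega
  refine PathScheme.hasSmallOverlap_of_stepSets hN (hheight ▸ hN) hne (τ := fun j => j * n)
    (by simp) hsteps.symm two_pos (fun i j hij _ => Nat.mul_le_mul_right n hij) hcl
    (by positivity) (fun j hj => ?_) (by rw [hheight]; push_cast; linarith)
  refine le_trans (Finset.sum_le_sum fun E hE => le_of_eq ?_) hratio
  rw [hmem] at hE
  rw [card_inter_Ico_eq_sub E (Nat.mul_le_mul_right n (Nat.le_succ j)),
    show (j + 1) * n - j * n = n by rw [Nat.succ_mul]; omega]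
  interval_cases j
  · simp
  · simp only [one_mul]
    -- The second half has n - x right steps when the first has x.
    rw [hE.2.1, chooseRatio_symm (rightSteps_le E n)]

theorem PathScheme.exists_hasSmallOverlap (S : PathScheme) :
    ∃ C, ∀ᶠ N in atTop, S.HasSmallOverlap C N := by
  cases S with
  | unrestricted ξ hξ => exact PathScheme.unrestricted_hasSmallOverlap ξ hξ
  | throughPoints ξ hξ n x y hx hy hx_mem hy_mem =>
    exact PathScheme.throughPoints_hasSmallOverlap ξ hξ n x y hx hy hx_mem hy_mem
  | avoidSquare β hβ => exact PathScheme.avoidSquare_hasSmallOverlap β hβ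

/-! ### The central limit theorem along a fixed path -/

theorem Complex.norm_exp_ofReal_mul_I_sub_taylor_le (x : ℝ) :
    ‖Complex.exp (x * Complex.I) - (1 + x * Complex.I - (x : ℂ) ^ 2 / 2)‖ ≤ 4 * |x| ^ 3 := by
  rcases le_total |x| 1 with h | h
  · have hx : ‖(x : ℂ) * Complex.I‖ = |x| := by simp
    have h1 := Complex.exp_bound (x := x * Complex.I) (by rwa [hx]) (n := 3) (by norm_num)
    rw [hx] at h1
    simp only [Finset.sum_range_succ, Finset.sum_range_zero] at h1
    have h2 : (x : ℂ) * Complex.I * (x * Complex.I) = -(x : ℂ) ^ 2 := by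
      linear_combination (x : ℂ) ^ 2 * Complex.I_sq
    norm_num [Nat.factorial, mul_pow] at h1
    have h3 : (1 : ℂ) + x * Complex.I - (x : ℂ) ^ 2 / 2
      = 1 + x * Complex.I + -(x : ℂ) ^ 2 / 2 := by ring
    rw [h3]
    refine h1.trans ?_
    have := pow_nonneg (abs_nonneg x) 3
    linarith
  · have h1 : ‖(1 : ℂ) + x * Complex.I - (x : ℂ) ^ 2 / 2‖ ≤ 1 + |x| + |x| ^ 2 / 2 := by
      refine (norm_sub_le _ _).trans (add_le_add ((norm_add_le _ _).trans ?_) ?_)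
      · simp
      · simp
    have h2 := norm_sub_le (Complex.exp (x * Complex.I)) (1 + x * Complex.I - (x : ℂ) ^ 2 / 2)
    rw [Complex.norm_exp_ofReal_mul_I] at h2
    have h3 : |x| ≤ |x| ^ 3 := le_self_pow₀ h (by norm_num)
    have h4 : |x| ^ 2 ≤ |x| ^ 3 := pow_le_pow_right₀ h (by norm_num)
    linarith

/-- Exchange the factors one at a time; all the others have norm at most 1. -/
theorem norm_prod_sub_prod_le {ι : Type*} (s : Finset ι) {f g : ι → ℂ} (hf : ∀ i ∈ s, ‖f i‖ ≤ 1)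
    (hg : ∀ i ∈ s, ‖g i‖ ≤ 1) : ‖∏ i ∈ s, f i - ∏ i ∈ s, g i‖ ≤ ∑ i ∈ s, ‖f i - g i‖ := by
  classical
  induction s using Finset.induction_on with
  | empty => simp
  | insert a s ha ih =>
    rw [Finset.prod_insert ha, Finset.prod_insert ha, Finset.sum_insert ha]
    have ih := ih (fun i hi => hf i (Finset.mem_insert_of_mem hi))
      fun i hi => hg i (Finset.mem_insert_of_mem hi)
    have hfa := hf a (Finset.mem_insert_self a s)
    have hgs : ‖∏ i ∈ s, g i‖ ≤ 1 := by
      rw [norm_prod]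
      exact Finset.prod_le_one (fun _ _ => norm_nonneg _)
        fun i hi => hg i (Finset.mem_insert_of_mem hi)
    have e : f a * ∏ i ∈ s, f i - g a * ∏ i ∈ s, g i
        = f a * (∏ i ∈ s, f i - ∏ i ∈ s, g i) + (f a - g a) * ∏ i ∈ s, g i := by ring
    rw [e]
    refine (norm_add_le _ _).trans ?_
    rw [norm_mul, norm_mul]
    have h1 := mul_le_mul hfa ih (norm_nonneg _) zero_le_one
    have h2 := mul_le_mul_of_nonneg_left hgs (norm_nonneg (f a - g a))
    linarith

theorem Integrable.pow_of_pow_six {α : Type*} [MeasurableSpace α] {P : Measure α}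
    [IsFiniteMeasure P] {X : α → ℝ} (hX : Measurable X)
    (h6 : Integrable (fun ω => X ω ^ 6) P) {j : ℕ} (hj : j ≤ 6) :
    Integrable (fun ω => |X ω| ^ j) P := by
  refine Integrable.mono' ((integrable_const 1).add h6) (by fun_prop) (.of_forall fun ω => ?_)
  simp only [Real.norm_eq_abs, abs_pow, abs_abs, Pi.add_apply]
  rw [← Even.pow_abs (by decide : Even 6) (X ω)]
  rcases le_total |X ω| 1 with h | h
  · have h1 := pow_le_one₀ (abs_nonneg (X ω)) h (n := j)
    have h2 := pow_nonneg (abs_nonneg (X ω)) 6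
    linarith
  · have := pow_le_pow_right₀ h hj
    linarith

/-- Both functions are compared with 1 - u²/2. The Taylor remainder costs 4(1 + K)|u|³, since |X|³ ≤
1 + X⁶, and the Gaussian side costs at most |u|³. -/
theorem norm_charFun_sub_exp_le {Ω : Type*} [MeasurableSpace Ω] {P : Measure Ω}
    [IsProbabilityMeasure P] {X : Ω → ℝ} (hX : Measurable X)
    (h6 : Integrable (fun ω => X ω ^ 6) P) {K : ℝ} (hK : ∫ ω, X ω ^ 6 ∂P ≤ K)
    (h1 : ∫ ω, X ω ∂P = 0) (h2 : ∫ ω, X ω ^ 2 ∂P = 1) {u : ℝ} (hu : |u| ≤ 1) :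
    ‖charFun (P.map X) u - Complex.exp (-(u : ℂ) ^ 2 / 2)‖ ≤ (4 * K + 5) * |u| ^ 3 := by
  have i3 := Integrable.pow_of_pow_six hX h6 (j := 3) (by norm_num)
  have i2 : Integrable (fun ω => X ω ^ 2) P := by
    simpa using Integrable.pow_of_pow_six hX h6 (j := 2) (by norm_num)
  have i1 : Integrable X P := by
    have := Integrable.pow_of_pow_six hX h6 (j := 1) (by norm_num)
    simp only [pow_one] at this
    exact (integrable_norm_iff hX.aestronglyMeasurable).1 this
  have hm3 : ∫ ω, |X ω| ^ 3 ∂P ≤ 1 + K := by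
    calc ∫ ω, |X ω| ^ 3 ∂P ≤ ∫ ω, (1 + X ω ^ 6) ∂P := by
          refine integral_mono i3 ((integrable_const 1).add h6) fun ω => ?_
          have e : X ω ^ 6 = (|X ω| ^ 3) ^ 2 := by
            rw [← Even.pow_abs (by decide : Even 6) (X ω)]; ring
          simp only [e]
          nlinarith [sq_nonneg (|X ω| ^ 3 - 1), pow_nonneg (abs_nonneg (X ω)) 3]
      _ = 1 + ∫ ω, X ω ^ 6 ∂P := by rw [integral_add (integrable_const 1) h6]; simp
      _ ≤ _ := by linarith
  have ie : Integrable (fun ω => Complex.exp ((u * X ω : ℝ) * Complex.I)) P := by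
    refine Integrable.of_bound (by fun_prop) 1 (.of_forall fun ω => ?_)
    rw [Complex.norm_exp_ofReal_mul_I]
  have hchar : charFun (P.map X) u = ∫ ω, Complex.exp ((u * X ω : ℝ) * Complex.I) ∂P := by
    rw [charFun_apply_real, integral_map hX.aemeasurable (by fun_prop)]
    push_cast
    rfl
  have iX : Integrable (fun ω => ((X ω : ℝ) : ℂ)) P := i1.ofReal
  have iX2 : Integrable (fun ω => ((X ω ^ 2 : ℝ) : ℂ)) P := i2.ofReal
  have htaylor : ∫ ω, ((1 : ℂ) + (u * Complex.I) * ((X ω : ℝ) : ℂ)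
      + (-(u : ℂ) ^ 2 / 2) * ((X ω ^ 2 : ℝ) : ℂ)) ∂P = 1 - (u : ℂ) ^ 2 / 2 := by
    have e1 := integral_add ((integrable_const (1 : ℂ)).add (iX.const_mul (u * Complex.I)))
      (iX2.const_mul (-(u : ℂ) ^ 2 / 2))
    simp only [Pi.add_apply] at e1
    rw [e1, integral_add (integrable_const _) (iX.const_mul _), integral_const_mul, integral_const_mul,
      integral_complex_ofReal, integral_complex_ofReal, h1, h2]
    simp
    ring
  have it : Integrable (fun ω => (1 : ℂ) + (u * Complex.I) * ((X ω : ℝ) : ℂ)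
      + (-(u : ℂ) ^ 2 / 2) * ((X ω ^ 2 : ℝ) : ℂ)) P :=
    ((integrable_const _).add (iX.const_mul _)).add (iX2.const_mul _)
  have hA : ‖charFun (P.map X) u - (1 - (u : ℂ) ^ 2 / 2)‖ ≤ 4 * (1 + K) * |u| ^ 3 := by
    rw [hchar, ← htaylor, ← integral_sub ie it]
    refine (norm_integral_le_integral_norm _).trans ?_
    calc _ ≤ ∫ ω, 4 * |u| ^ 3 * |X ω| ^ 3 ∂P := by
          refine integral_mono (ie.sub it).norm (i3.const_mul _) fun ω => ?_
          have := Complex.norm_exp_ofReal_mul_I_sub_taylor_le (u * X ω)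
          rw [abs_mul, mul_pow, ← mul_assoc] at this
          convert! this using 3
          push_cast
          ring
      _ = 4 * |u| ^ 3 * ∫ ω, |X ω| ^ 3 ∂P := integral_const_mul _ _
      _ ≤ 4 * |u| ^ 3 * (1 + K) := by gcongr
      _ = _ := by ring
  have hu2 : u ^ 2 ≤ 1 := by rw [← sq_abs]; exact pow_le_one₀ (abs_nonneg u) hu
  have hB : ‖(1 - (u : ℂ) ^ 2 / 2) - Complex.exp (-(u : ℂ) ^ 2 / 2)‖ ≤ |u| ^ 3 := by
    have h := Real.abs_exp_sub_one_sub_id_le (x := -u ^ 2 / 2)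
      (by rw [abs_le]; constructor <;> nlinarith [sq_nonneg u])
    rw [norm_sub_rev]
    have e : Complex.exp (-(u : ℂ) ^ 2 / 2) - (1 - (u : ℂ) ^ 2 / 2)
        = ((Real.exp (-u ^ 2 / 2) - 1 - -u ^ 2 / 2 : ℝ) : ℂ) := by push_cast; ring
    rw [e, Complex.norm_real, Real.norm_eq_abs]
    refine h.trans ?_
    have e2 : (-u ^ 2 / 2) ^ 2 = |u| ^ 4 / 4 := by
      rw [Even.pow_abs (by decide : Even 4)]; ring
    rw [e2]
    have h3 : |u| ^ 4 ≤ |u| ^ 3 := pow_le_pow_of_le_one (abs_nonneg u) hu (by norm_num)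
    have := pow_nonneg (abs_nonneg u) 3
    linarith
  calc _ ≤ _ := norm_sub_le_norm_sub_add_norm_sub _ (1 - (u : ℂ) ^ 2 / 2) _
    _ ≤ _ := by linarith

theorem norm_charFun_sum_sub_exp_le {Ω ι : Type*} [MeasurableSpace Ω] {P : Measure Ω}
    [IsProbabilityMeasure P] {X : ι → Ω → ℝ} {s : Finset ι} (hX : ∀ i ∈ s, Measurable (X i))
    (hind : iIndepFun (s.restrict X) P) (h6 : ∀ i ∈ s, Integrable (fun ω => X i ω ^ 6) P) {K : ℝ}
    (hK : ∀ i ∈ s, ∫ ω, X i ω ^ 6 ∂P ≤ K) (h1 : ∀ i ∈ s, ∫ ω, X i ω ∂P = 0)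
    (h2 : ∀ i ∈ s, ∫ ω, X i ω ^ 2 ∂P = 1) {u : ℝ} (hu : |u| ≤ 1) :
    ‖charFun (P.map fun ω => ∑ i ∈ s, X i ω) u - Complex.exp (-(s.card * u ^ 2) / 2)‖
      ≤ s.card * ((4 * K + 5) * |u| ^ 3) := by
  have hexp : Complex.exp (-(s.card * u ^ 2) / 2)
      = ∏ i ∈ s, Complex.exp (-(u : ℂ) ^ 2 / 2) := by
    rw [Finset.prod_const, ← Complex.exp_nat_mul]
    congr 1
    ring
  rw [hind.charFun_map_fun_finsetSum_eq_prod fun i hi => (hX i hi).aemeasurable, hexp,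
    Finset.prod_apply, ← nsmul_eq_mul, ← Finset.sum_const]
  refine (norm_prod_sub_prod_le s (fun i hi => ?_) fun i hi => ?_).trans
    (Finset.sum_le_sum fun i hi =>
      norm_charFun_sub_exp_le (hX i hi) (h6 i hi) (hK i hi) (h1 i hi) (h2 i hi) hu)
  · have := Measure.isProbabilityMeasure_map (μ := P) (hX i hi).aemeasurable
    exact norm_charFun_le_one _
  · have e : (-(u : ℂ) ^ 2 / 2) = ((-u ^ 2 / 2 : ℝ) : ℂ) := by push_cast; ring
    rw [e, ← Complex.ofReal_exp, Complex.norm_real, Real.norm_eq_abs, Real.abs_exp,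
      Real.exp_le_one_iff]
    nlinarith [sq_nonneg u]

/-! ### Criteria for almost sure and for weak convergence -/

theorem integrable_pow_six_of_lintegral_le {Ω : Type*} [MeasurableSpace Ω] {P : Measure Ω}
    [IsProbabilityMeasure P] {X : Ω → ℝ} (hX : Measurable X) {p : ℝ} (hp : 6 ≤ p) {K : ℝ≥0}
    (h : ∫⁻ ω, ‖X ω‖ₑ ^ p ∂P ≤ K) :
    Integrable (fun ω => X ω ^ 6) P ∧ ∫ ω, X ω ^ 6 ∂P ≤ 1 + K := by
  have hle : ∫⁻ ω, ‖X ω ^ 6‖ₑ ∂P ≤ ((1 + K : ℝ≥0) : ℝ≥0∞) := by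
    calc ∫⁻ ω, ‖X ω ^ 6‖ₑ ∂P ≤ ∫⁻ ω, (1 + ‖X ω‖ₑ ^ p) ∂P := by
          refine lintegral_mono fun ω => ?_
          rw [enorm_pow, ← ENNReal.rpow_natCast]
          rcases le_total ‖X ω‖ₑ 1 with h1 | h1
          · exact (ENNReal.rpow_le_one h1 (by norm_num)).trans le_self_add
          · exact (ENNReal.rpow_le_rpow_of_exponent_le h1 (by exact_mod_cast hp)).trans
              le_add_self
      _ = 1 + ∫⁻ ω, ‖X ω‖ₑ ^ p ∂P := by
          rw [lintegral_add_left measurable_const]; simp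
      _ ≤ _ := by push_cast; gcongr
  have hint : Integrable (fun ω => X ω ^ 6) P :=
    ⟨by fun_prop, lt_of_le_of_lt hle ENNReal.coe_lt_top⟩
  refine ⟨hint, ?_⟩
  rw [integral_eq_lintegral_of_nonneg_ae (.of_forall fun ω => Even.pow_nonneg (by decide) _)
    (by fun_prop)]
  refine ENNReal.toReal_le_of_le_ofReal (by positivity) ?_
  refine (lintegral_mono fun ω => Real.ofReal_le_enorm _).trans (hle.trans_eq ?_)
  rw [ENNReal.ofReal, Real.toNNReal_add zero_le_one K.coe_nonneg, Real.toNNReal_one,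
    Real.toNNReal_coe]

/-- The sum of the sixth powers, from some index on, has finite expectation and is thus almost
surely finite. Nothing about the joint law of the `Y N` is needed. -/
theorem ae_tendsto_zero_of_integral_pow_six_le {Ω : Type*} [MeasurableSpace Ω] {P : Measure Ω}
    {Y : ℕ → Ω → ℝ} (hY : ∀ N, Measurable (Y N)) (hi : ∀ N, Integrable (fun ω => Y N ω ^ 6) P)
    {g : ℕ → ℝ} (hg : Summable g) (h : ∀ᶠ N in atTop, ∫ ω, Y N ω ^ 6 ∂P ≤ g N) :
    ∀ᵐ ω ∂P, Tendsto (fun N => Y N ω) atTop (𝓝 0) := by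
  obtain ⟨N₀, hN₀⟩ := eventually_atTop.1 h
  have hsum : ∫⁻ ω, ∑' N, ENNReal.ofReal (Y (N + N₀) ω ^ 6) ∂P ≠ ∞ := by
    rw [lintegral_tsum fun N => ((hY _).pow_const 6).ennreal_ofReal.aemeasurable]
    refine ne_top_of_le_ne_top ((summable_nat_add_iff N₀).2 hg).tsum_ofReal_ne_top
      (ENNReal.tsum_le_tsum fun N => ?_)
    rw [← ofReal_integral_eq_lintegral_ofReal (hi _)
      (.of_forall fun ω => Even.pow_nonneg (by decide) _)]
    exact ENNReal.ofReal_le_ofReal (hN₀ _ (Nat.le_add_left _ _))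
  have hae := ae_lt_top (Measurable.tsum fun N =>
    ((hY (N + N₀)).pow_const 6).ennreal_ofReal) hsum
  filter_upwards [hae] with ω hω
  have h1 := ENNReal.tendsto_atTop_zero_of_tsum_ne_top hω.ne
  have h2 : Tendsto (fun N => Y (N + N₀) ω ^ 6) atTop (𝓝 0) := by
    have := (ENNReal.continuousAt_toReal ENNReal.zero_ne_top).tendsto.comp h1
    refine Tendsto.congr (fun N => ?_) this
    simp only [Function.comp_apply]
    exact ENNReal.toReal_ofReal (Even.pow_nonneg (by decide) _)
  have h3 : Tendsto (fun N => Y (N + N₀) ω) atTop (𝓝 0) := by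
    rw [Metric.tendsto_atTop] at h2 ⊢
    intro ε hε
    obtain ⟨N, hN⟩ := h2 (ε ^ 6) (by positivity)
    refine ⟨N, fun k hk => ?_⟩
    have := hN k hk
    rw [Real.dist_eq, sub_zero, abs_pow] at this
    rw [Real.dist_eq, sub_zero]
    exact lt_of_pow_lt_pow_left₀ 6 hε.le this
  exact (tendsto_add_atTop_iff_nat N₀).1 h3

/-- If the characteristic functions converge at the rational points, and truncated first moments
are uniformly small at small scales, then the measures converge weakly. -/
theorem ProbabilityMeasure.tendsto_of_tendsto_charFun_ratCast {ν : ℕ → ProbabilityMeasure ℝ}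
    {ν₀ : ProbabilityMeasure ℝ}
    (hq : ∀ q : ℚ, Tendsto (fun N => charFun (ν N : Measure ℝ) (q : ℝ)) atTop
      (𝓝 (charFun (ν₀ : Measure ℝ) (q : ℝ))))
    (hm : ∀ m : ℕ, ∀ᶠ N in atTop,
      ∫ x, min (|x| / (m + 1 : ℝ)) 2 ∂(ν N : Measure ℝ) ≤ 2 / (m + 1 : ℝ)) :
    Tendsto ν atTop (𝓝 ν₀) := by
  refine ProbabilityMeasure.tendsto_of_tendsto_charFun fun t => ?_
  rw [Metric.tendsto_atTop]
  intro ε hε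
  obtain ⟨m, hmε⟩ := exists_nat_gt (2 / (ε / 3))
  have hm0 : (0 : ℝ) < (m : ℝ) + 1 := by positivity
  have hmε' : 2 / ((m : ℝ) + 1) < ε / 3 := by
    rw [div_lt_iff₀ hm0]
    rw [div_lt_iff₀ (by positivity)] at hmε
    nlinarith
  have hcont := (continuous_charFun (μ := (ν₀ : Measure ℝ))).tendsto t
  obtain ⟨d, hd, hdc⟩ := Metric.tendsto_nhds_nhds.1 hcont (ε / 3) (by positivity)
  -- The rational point is close enough to t for the continuity of the limit, and within 1/(m + 1),
  -- the scale of the truncated moment.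
  obtain ⟨q, hq1, hq2⟩ := exists_rat_btwn
    (show t < t + min d (1 / ((m : ℝ) + 1)) from lt_add_of_pos_right _ (by positivity))
  have hqt : |(q : ℝ) - t| < min d (1 / ((m : ℝ) + 1)) := by
    rw [abs_of_pos (by linarith)]; linarith
  have hc0 := hdc (x := (q : ℝ)) (by rw [Real.dist_eq]; exact hqt.trans_le (min_le_left _ _))
  obtain ⟨N₁, hN₁⟩ := Metric.tendsto_atTop.1 (hq q) (ε / 3) (by positivity)
  obtain ⟨N₂, hN₂⟩ := eventually_atTop.1 (hm m)
  refine ⟨max N₁ N₂, fun N hN => ?_⟩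
  have h1 := hN₁ N ((le_max_left _ _).trans hN)
  have h2 := hN₂ N ((le_max_right _ _).trans hN)
  have hie : ∀ u : ℝ, Integrable (fun x : ℝ => Complex.exp (u * x * Complex.I))
      (ν N : Measure ℝ) := fun u => by
    refine Integrable.of_bound (by fun_prop) 1 (.of_forall fun x => ?_)
    rw [← Complex.ofReal_mul, Complex.norm_exp_ofReal_mul_I]
  have h3 : dist (charFun (ν N : Measure ℝ) t) (charFun (ν N : Measure ℝ) q) ≤ 2 / (m + 1 : ℝ) := by
    rw [dist_eq_norm, charFun_apply_real, charFun_apply_real, ← integral_sub (hie _) (hie _)]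
    refine (norm_integral_le_integral_norm _).trans (le_trans ?_ h2)
    refine integral_mono_of_nonneg (.of_forall fun x => norm_nonneg _) ?_
      (.of_forall fun x => ?_)
    · refine Integrable.of_bound (by fun_prop) 2 (.of_forall fun x => ?_)
      rw [Real.norm_eq_abs, abs_of_nonneg (by positivity)]
      exact min_le_right _ _
    · simp only
      -- The difference of the exponentials is at most |t - q||x|, and trivially at most 2.
      refine le_min ?_ ?_
      · have e : Complex.exp (t * x * Complex.I) - Complex.exp ((q : ℝ) * x * Complex.I)
            = Complex.exp ((((q : ℝ) * x : ℝ)) * Complex.I) *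
              (Complex.exp (Complex.I * (((t - q) * x : ℝ))) - 1) := by
          rw [mul_sub, ← Complex.exp_add, mul_one]
          push_cast
          ring_nf
        rw [e, norm_mul, Complex.norm_exp_ofReal_mul_I, one_mul]
        refine Real.norm_exp_I_mul_ofReal_sub_one_le.trans ?_
        rw [Real.norm_eq_abs, abs_mul, div_eq_mul_one_div, mul_comm]
        refine mul_le_mul_of_nonneg_left ?_ (abs_nonneg x)
        rw [abs_sub_comm]
        exact hqt.le.trans (min_le_right _ _)
      · refine (norm_sub_le _ _).trans ?_
        rw [← Complex.ofReal_mul, ← Complex.ofReal_mul, Complex.norm_exp_ofReal_mul_I,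
          Complex.norm_exp_ofReal_mul_I]
        norm_num
  calc dist (charFun (ν N : Measure ℝ) t) (charFun (ν₀ : Measure ℝ) t)
      ≤ dist (charFun (ν N : Measure ℝ) t) (charFun (ν N : Measure ℝ) q)
        + dist (charFun (ν N : Measure ℝ) q) (charFun (ν₀ : Measure ℝ) q)
        + dist (charFun (ν₀ : Measure ℝ) q) (charFun (ν₀ : Measure ℝ) t) := dist_triangle4 _ _ _ _
    _ < ε := by linarith

theorem charFun_eq_integral_cos_add_integral_sin (ν : Measure ℝ) [IsFiniteMeasure ν] (t : ℝ) :
    charFun ν t = ((∫ x, Real.cos (t * x) ∂ν : ℝ) : ℂ)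
      + ((∫ x, Real.sin (t * x) ∂ν : ℝ) : ℂ) * Complex.I := by
  have hc' : Integrable (fun x => Real.cos (t * x)) ν :=
    Integrable.of_bound (by fun_prop) 1 (.of_forall fun x => Real.abs_cos_le_one _)
  have hs' : Integrable (fun x => Real.sin (t * x)) ν :=
    Integrable.of_bound (by fun_prop) 1 (.of_forall fun x => Real.abs_sin_le_one _)
  have hc : Integrable (fun x => ((Real.cos (t * x) : ℝ) : ℂ)) ν := hc'.ofReal
  have hs : Integrable (fun x => ((Real.sin (t * x) : ℝ) : ℂ)) ν := hs'.ofReal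
  rw [charFun_apply_real, ← integral_complex_ofReal, ← integral_complex_ofReal,
    ← integral_mul_const, ← integral_add hc (hs.mul_const _)]
  refine integral_congr_ae (.of_forall fun x => ?_)
  simp only
  rw [Complex.exp_mul_I]
  push_cast
  rfl

/-! ### Concentration and mean of quenched averages -/

/-- The weights on the finite set `T` are independent and centred, with unit variance and sixth
moment at most `K`. -/
structure IsCentredArray {Ω : Type*} [MeasurableSpace Ω] (P : Measure Ω) (T : Finset (ℕ × ℕ))
    (w : ℕ × ℕ → Ω → ℝ) (K : ℝ) : Prop where
  measurable : ∀ a ∈ T, Measurable (w a)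
  indep : iIndepFun (fun a : T => w a) P
  integrable : ∀ a ∈ T, Integrable (fun ω => w a ω ^ 6) P
  moment_le : ∀ a ∈ T, ∫ ω, w a ω ^ 6 ∂P ≤ K
  mean : ∀ a ∈ T, ∫ ω, w a ω ∂P = 0
  second_moment : ∀ a ∈ T, ∫ ω, w a ω ^ 2 ∂P = 1

namespace PathScheme

variable {S : PathScheme} {N : ℕ}

theorem integral_quenchedMeasure (S : PathScheme) (N : ℕ) (v : ℕ × ℕ → ℝ) (f : ℝ → ℝ) :
    ∫ x, f x ∂S.quenchedMeasure N v
      = ((S.paths N).card : ℝ)⁻¹ * ∑ σ ∈ S.paths N, f (S.pathSum N v σ) := by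
  rw [quenchedMeasure, integral_smul_measure, integral_finsetSum_measure]
  · simp
  · exact fun σ _ => integrable_dirac (by simp)

theorem pathSum_congr {v v' : ℕ × ℕ → ℝ} (h : ∀ a ∈ S.box N, v a = v' a)
    {σ : Finset (ℕ × ℕ)} (hσ : σ ∈ S.paths N) : S.pathSum N v σ = S.pathSum N v' σ := by
  rw [pathSum, pathSum, Finset.sum_congr rfl fun a ha => h a (subset_box_of_mem_paths hσ ha)]

theorem pathSum_update_sub (v : ℕ × ℕ → ℝ) (a : ℕ × ℕ) (y : ℝ) (σ : Finset (ℕ × ℕ)) :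
    S.pathSum N (Function.update v a y) σ - S.pathSum N v σ
      = if a ∈ σ then 1 / √((S.height N : ℝ) + N - 1) * (y - v a) else 0 := by
  rw [pathSum, pathSum, ← mul_sub, ← Finset.sum_sub_distrib]
  split_ifs with ha
  · rw [Finset.sum_eq_single_of_mem a ha fun b _ hb => by rw [Function.update_of_ne hb, sub_self],
      Function.update_self]
  · rw [Finset.sum_eq_zero fun b hb => by
      rw [Function.update_of_ne (fun h : b = a => ha (h ▸ hb)), sub_self], mul_zero]

/-- Only the paths through `a` notice the change, so the Lipschitz constant in this weight carries
the probability that the path visits `a`. -/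
theorem abs_integral_quenchedMeasure_update_sub_le {f : ℝ → ℝ} {Λ : ℝ}
    (hL : ∀ x y, |f x - f y| ≤ Λ * |x - y|) (v : ℕ × ℕ → ℝ) (a : ℕ × ℕ) (y : ℝ) :
    |∫ x, f x ∂S.quenchedMeasure N (Function.update v a y) - ∫ x, f x ∂S.quenchedMeasure N v|
      ≤ (((S.paths N).card : ℝ)⁻¹ * (((S.paths N).filter (a ∈ ·)).card *
          (Λ * (1 / √((S.height N : ℝ) + N - 1))))) * |y - v a| := by
  rw [integral_quenchedMeasure, integral_quenchedMeasure, ← mul_sub, ← Finset.sum_sub_distrib,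
    abs_mul, abs_of_nonneg (inv_nonneg.2 (Nat.cast_nonneg _)), mul_assoc]
  refine mul_le_mul_of_nonneg_left ?_ (inv_nonneg.2 (Nat.cast_nonneg _))
  refine (Finset.abs_sum_le_sum_abs _ _).trans ?_
  calc ∑ σ ∈ S.paths N, |f (S.pathSum N (Function.update v a y) σ) - f (S.pathSum N v σ)|
      ≤ ∑ σ ∈ S.paths N, if a ∈ σ then
          Λ * (1 / √((S.height N : ℝ) + N - 1)) * |y - v a| else 0 := by
        refine Finset.sum_le_sum fun σ _ => (hL _ _).trans_eq ?_
        rw [pathSum_update_sub]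
        split_ifs
        · rw [abs_mul, abs_of_nonneg (a := 1 / √((S.height N : ℝ) + N - 1)) (by positivity)]
          ring
        · simp
    _ = _ := by rw [← Finset.sum_filter, Finset.sum_const, nsmul_eq_mul]; ring

theorem HasSmallOverlap.le_length {C : ℝ} (h : S.HasSmallOverlap C N) :
    (N : ℝ) ≤ (S.height N : ℝ) + N - 1 := by
  have : (1 : ℝ) ≤ S.height N := by exact_mod_cast h.2.1
  linarith

theorem measurable_pathSum {Ω : Type*} [MeasurableSpace Ω] {w : ℕ × ℕ → Ω → ℝ}
    (hw : ∀ a ∈ S.box N, Measurable (w a)) {σ : Finset (ℕ × ℕ)} (hσ : σ ∈ S.paths N) :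
    Measurable fun ω => S.pathSum N (fun a => w a ω) σ :=
  (Finset.measurable_fun_sum _ fun a ha => hw a (subset_box_of_mem_paths hσ ha)).const_mul _

theorem measurable_integral_quenchedMeasure {Ω : Type*} [MeasurableSpace Ω] {w : ℕ × ℕ → Ω → ℝ}
    (hw : ∀ a ∈ S.box N, Measurable (w a)) {f : ℝ → ℝ} (hf : Measurable f) :
    Measurable fun ω => ∫ x, f x ∂S.quenchedMeasure N (fun a => w a ω) := by
  simp only [integral_quenchedMeasure]
  exact (Finset.measurable_fun_sum _ fun σ hσ =>
    hf.comp (measurable_pathSum hw hσ)).const_mul _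

theorem abs_integral_quenchedMeasure_le {f : ℝ → ℝ} {B : ℝ} (hB : ∀ x, |f x| ≤ B)
    (v : ℕ × ℕ → ℝ) : |∫ x, f x ∂S.quenchedMeasure N v| ≤ B := by
  have hB0 : 0 ≤ B := (abs_nonneg _).trans (hB 0)
  rw [integral_quenchedMeasure, abs_mul, abs_of_nonneg (inv_nonneg.2 (Nat.cast_nonneg _))]
  rcases (S.paths N).eq_empty_or_nonempty with h | h
  · simpa [h] using hB0
  have hcard : (0 : ℝ) < (S.paths N).card := by exact_mod_cast h.card_pos
  rw [inv_mul_le_iff₀ hcard, ← nsmul_eq_mul, ← Finset.sum_const]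
  exact (Finset.abs_sum_le_sum_abs _ _).trans (Finset.sum_le_sum fun σ _ => hB _)

/-- The overlap contributes √N and the normalization 1/L ≤ 1/N, which leaves N^(-1/2). -/
theorem HasSmallOverlap.sum_sq_le {C : ℝ} (h : S.HasSmallOverlap C N) (Λ : ℝ) :
    ∑ a : S.box N, (((S.paths N).card : ℝ)⁻¹ * (((S.paths N).filter ((a : ℕ × ℕ) ∈ ·)).card *
        (Λ * (1 / √((S.height N : ℝ) + N - 1))))) ^ 2 ≤ Λ ^ 2 * C * (1 / √(N : ℝ)) := by
  have hN0 : (0 : ℝ) < N := by exact_mod_cast h.1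
  have hl := h.le_length
  have hl0 : 0 < (S.height N : ℝ) + N - 1 := hN0.trans_le hl
  have hcard : (0 : ℝ) < (S.paths N).card := by exact_mod_cast h.2.2.1.card_pos
  set m : ℕ × ℕ → ℝ := fun a => (((S.paths N).filter (a ∈ ·)).card : ℝ) with hm
  have hCN : ∑ a ∈ S.box N, m a ^ 2 ≤ C * √(N : ℝ) * ((S.paths N).card : ℝ) ^ 2 := h.2.2.2
  have h1 : ∑ a : S.box N, (((S.paths N).card : ℝ)⁻¹ * (m a *
      (Λ * (1 / √((S.height N : ℝ) + N - 1))))) ^ 2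
      = Λ ^ 2 * ((((S.paths N).card : ℝ) ^ 2)⁻¹ * ∑ a ∈ S.box N, m a ^ 2) *
        (1 / ((S.height N : ℝ) + N - 1)) := by
    rw [← Finset.sum_coe_sort (S.box N) fun a => m a ^ 2, Finset.mul_sum, Finset.mul_sum,
      Finset.sum_mul]
    refine Finset.sum_congr rfl fun a _ => ?_
    simp only [mul_pow, one_div, inv_pow, Real.sq_sqrt hl0.le]
    ring
  have h2 : (((S.paths N).card : ℝ) ^ 2)⁻¹ * ∑ a ∈ S.box N, m a ^ 2 ≤ C * √(N : ℝ) := by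
    rw [inv_mul_le_iff₀ (by positivity)]
    linarith
  have h3 : 0 ≤ C * √(N : ℝ) := le_trans (mul_nonneg (by positivity)
    (Finset.sum_nonneg fun _ _ => sq_nonneg _)) h2
  have h4 : 0 < √(N : ℝ) := Real.sqrt_pos.2 hN0
  have h5 : C * √(N : ℝ) * (1 / N) = C * (1 / √(N : ℝ)) := by
    rw [mul_assoc]
    congr 1
    field_simp
    exact Real.sq_sqrt hN0.le
  rw [h1, mul_assoc (Λ ^ 2), mul_assoc (Λ ^ 2), ← h5]
  refine mul_le_mul_of_nonneg_left ?_ (sq_nonneg Λ)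
  exact mul_le_mul h2 (one_div_le_one_div_of_le hN0 hl) (by positivity) h3

/-- The quenched average of a bounded Lipschitz function is concentrated around its mean. -/
theorem HasSmallOverlap.integral_sub_integral_pow_six_le {Ω : Type*} [MeasurableSpace Ω]
    {P : Measure Ω} [IsProbabilityMeasure P] {w : ℕ × ℕ → Ω → ℝ} {K : ℝ} (hK0 : 0 ≤ K)
    (hw : IsCentredArray P (S.box N) w K) {C : ℝ} (h : S.HasSmallOverlap C N)
    {f : ℝ → ℝ} (hf : Measurable f) {B : ℝ} (hB : ∀ x, |f x| ≤ B) {Λ : ℝ} (hΛ : 0 ≤ Λ)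
    (hL : ∀ x y, |f x - f y| ≤ Λ * |x - y|) :
    ∫ ω, (∫ x, f x ∂S.quenchedMeasure N (fun a => w a ω)
        - ∫ ω', ∫ x, f x ∂S.quenchedMeasure N (fun a => w a ω') ∂P) ^ 6 ∂P
      ≤ 34 * centredMomentBound K ^ 3 * (Λ ^ 2 * C) ^ 3 * (1 / √(N : ℝ)) ^ 3 := by
  -- The moment inequality needs finitely many coordinates. Extending by 0 off the grid is
  -- immaterial, because paths stay inside it.
  set e : (S.box N → ℝ) → ℕ × ℕ → ℝ := fun x a => if h : a ∈ S.box N then x ⟨a, h⟩ else 0 with he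
  set F : (S.box N → ℝ) → ℝ := fun x => ∫ t, f t ∂S.quenchedMeasure N (e x) with hF
  set m : ℕ × ℕ → ℝ := fun a => (((S.paths N).filter (a ∈ ·)).card : ℝ) with hm
  set c : S.box N → ℝ := fun a => ((S.paths N).card : ℝ)⁻¹ * (m a *
    (Λ * (1 / √((S.height N : ℝ) + N - 1)))) with hc
  have hFm : Measurable F := by
    refine measurable_integral_quenchedMeasure (w := fun a x => e x a) (fun a ha => ?_) hf
    simp only [he, dif_pos ha]
    exact measurable_pi_apply _
  have hupd : ∀ (i : S.box N) (x : S.box N → ℝ) (y : ℝ),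
      e (Function.update x i y) = Function.update (e x) i y := fun i x y => by
    ext a
    by_cases ha : a = i
    · subst ha
      simp [he]
    · rw [Function.update_of_ne ha]
      simp only [he]
      split_ifs with h1
      · rw [Function.update_of_ne]
        exact fun h2 => ha (congrArg Subtype.val h2)
      · rfl
  have hval : ∀ ω, F (fun a => w a ω) = ∫ x, f x ∂S.quenchedMeasure N (fun a => w a ω) :=
    fun ω => by
      simp only [hF, integral_quenchedMeasure]
      congr 1
      refine Finset.sum_congr rfl fun σ hσ => ?_
      rw [pathSum_congr (v' := fun a => w a ω) (fun a ha => by simp [he, ha]) hσ]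
  have hbd : ∀ x, |F x| ≤ B := fun x => abs_integral_quenchedMeasure_le hB _
  have hc0 : ∀ a, 0 ≤ c a := fun a => by positivity
  have hlip : ∀ i x y, |F (Function.update x i y) - F x| ≤ c i * |y - x i| := fun i x y => by
    have h1 := abs_integral_quenchedMeasure_update_sub_le (S := S) (N := N) hL (e x) i y
    rw [← hupd] at h1
    have h2 : e x i = x i := by simp [he]
    rwa [h2] at h1
  have hV : ∑ a, c a ^ 2 ≤ Λ ^ 2 * C * (1 / √(N : ℝ)) := h.sum_sq_le Λ
  clear_value c F
  have hmain := integral_comp_sub_integral_pow_six_le hK0 (fun a : S.box N => hw.measurable a a.2)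
    hw.indep (fun a => hw.integrable a a.2) (fun a => hw.moment_le a a.2) hFm hbd hc0 hlip
  simp only [hval] at hmain
  refine hmain.trans ?_
  have hA : 0 ≤ centredMomentBound K := by unfold centredMomentBound; positivity
  have hV0 : 0 ≤ ∑ a, c a ^ 2 := Finset.sum_nonneg fun _ _ => sq_nonneg _
  calc _ ≤ 34 * centredMomentBound K ^ 3 * (Λ ^ 2 * C * (1 / √(N : ℝ))) ^ 3 :=
        mul_le_mul_of_nonneg_left (pow_le_pow_left₀ hV0 hV 3) (by positivity)
    _ = _ := by ring

/-- The expected quenched average is the average over paths of expectations, so an estimate uniform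
over single paths passes to it. -/
theorem HasSmallOverlap.abs_integral_integral_sub_le {Ω : Type*} [MeasurableSpace Ω]
    {P : Measure Ω} [IsProbabilityMeasure P] {w : ℕ × ℕ → Ω → ℝ}
    (hw : ∀ a ∈ S.box N, Measurable (w a)) {C : ℝ} (h : S.HasSmallOverlap C N)
    {f : ℝ → ℝ} (hf : Measurable f) {B : ℝ} (hB : ∀ x, |f x| ≤ B) {l b : ℝ}
    (hl : ∀ σ ∈ S.paths N, |∫ ω, f (S.pathSum N (fun a => w a ω) σ) ∂P - l| ≤ b) :
    |∫ ω, ∫ x, f x ∂S.quenchedMeasure N (fun a => w a ω) ∂P - l| ≤ b := by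
  have hcard : (0 : ℝ) < (S.paths N).card := by exact_mod_cast h.2.2.1.card_pos
  simp only [integral_quenchedMeasure]
  have hint : ∀ σ ∈ S.paths N, Integrable (fun ω => f (S.pathSum N (fun a => w a ω) σ)) P :=
    fun σ hσ =>
      integrable_of_measurable_of_abs_le (hf.comp (measurable_pathSum hw hσ)) fun ω => hB _
  rw [integral_const_mul, integral_finsetSum _ hint]
  have e : ((S.paths N).card : ℝ)⁻¹ * ∑ σ ∈ S.paths N, ∫ ω, f (S.pathSum N (fun a => w a ω) σ) ∂P - l
      = ((S.paths N).card : ℝ)⁻¹ *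
        ∑ σ ∈ S.paths N, (∫ ω, f (S.pathSum N (fun a => w a ω) σ) ∂P - l) := by
    rw [Finset.sum_sub_distrib, Finset.sum_const, nsmul_eq_mul, mul_sub,
      inv_mul_cancel_left₀ hcard.ne']
  rw [e, abs_mul, abs_of_nonneg (inv_nonneg.2 hcard.le), inv_mul_le_iff₀ hcard, ← nsmul_eq_mul,
    ← Finset.sum_const]
  exact (Finset.abs_sum_le_sum_abs _ _).trans (Finset.sum_le_sum hl)

/-- L factors at u = s/√L, each with an error of order |u|³, give |s|³/√L. The condition on s
ensures |u| ≤ 1. -/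
theorem HasSmallOverlap.norm_charFun_pathSum_sub_le {Ω : Type*} [MeasurableSpace Ω]
    {P : Measure Ω} [IsProbabilityMeasure P] {w : ℕ × ℕ → Ω → ℝ} {K : ℝ} (hK0 : 0 ≤ K)
    (hw : IsCentredArray P (S.box N) w K) {C : ℝ} (h : S.HasSmallOverlap C N)
    {σ : Finset (ℕ × ℕ)} (hσ : σ ∈ S.paths N) {s : ℝ} (hs : |s| ≤ √(N : ℝ)) :
    ‖charFun (P.map fun ω => S.pathSum N (fun a => w a ω) σ) s - Complex.exp (-(s : ℂ) ^ 2 / 2)‖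
      ≤ (4 * K + 5) * |s| ^ 3 * (1 / √(N : ℝ)) := by
  have hbox := subset_box_of_mem_paths hσ
  have hN0 : (0 : ℝ) < N := by exact_mod_cast h.1
  have hl := h.le_length
  have hl0 : 0 < (S.height N : ℝ) + N - 1 := hN0.trans_le hl
  have hcard : (σ.card : ℝ) = (S.height N : ℝ) + N - 1 := by
    rw [card_of_mem_paths h.1 h.2.1 hσ, Nat.cast_sub (by have := h.1; omega)]
    push_cast
    ring
  set L := (S.height N : ℝ) + N - 1 with hL
  have hL0 : 0 < √L := Real.sqrt_pos.2 hl0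
  have hLL : √L ^ 2 = L := Real.sq_sqrt hl0.le
  have hNL : √(N : ℝ) ≤ √L := Real.sqrt_le_sqrt hl
  have hu : |1 / √L * s| ≤ 1 := by
    rw [abs_mul, abs_of_pos (by positivity), one_div, inv_mul_le_iff₀ hL0, mul_one]
    exact hs.trans hNL
  have hind : iIndepFun (σ.restrict w) P :=
    hw.indep.precomp (g := fun a : σ => (⟨a, hbox a.2⟩ : S.box N))
      fun a b hab => Subtype.ext (congrArg (fun z : S.box N => (z : ℕ × ℕ)) hab)
  have hmain := norm_charFun_sum_sub_exp_le (fun a ha => hw.measurable a (hbox ha)) hind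
    (fun a ha => hw.integrable a (hbox ha)) (fun a ha => hw.moment_le a (hbox ha))
    (fun a ha => hw.mean a (hbox ha)) (fun a ha => hw.second_moment a (hbox ha)) hu
  have hmap : charFun (P.map fun ω => S.pathSum N (fun a => w a ω) σ) s
      = charFun (P.map fun ω => ∑ a ∈ σ, w a ω) (1 / √L * s) := by
    have hm : AEMeasurable (fun ω => ∑ a ∈ σ, w a ω) P :=
      Finset.aemeasurable_fun_sum _ fun a ha => (hw.measurable a (hbox ha)).aemeasurable
    exact charFun_map_mul_comp hm (1 / √L) s
  have hsq : (σ.card : ℝ) * (1 / √L * s) ^ 2 = s ^ 2 := by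
    rw [hcard, mul_pow, div_pow, hLL]
    field_simp
  have hsq' : -((σ.card : ℂ) * (((1 / √L * s : ℝ) : ℂ)) ^ 2) / 2 = -(s : ℂ) ^ 2 / 2 := by
    have : (σ.card : ℂ) * (((1 / √L * s : ℝ) : ℂ)) ^ 2 = (s : ℂ) ^ 2 := by exact_mod_cast hsq
    rw [this]
  rw [hmap]
  rw [hsq'] at hmain
  refine hmain.trans ?_
  rw [hcard, abs_mul, abs_of_pos (by positivity : 0 < 1 / √L), mul_pow]
  calc L * ((4 * K + 5) * ((1 / √L) ^ 3 * |s| ^ 3))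
      = (4 * K + 5) * |s| ^ 3 * (1 / √L) := by
        nth_rewrite 1 [← hLL]
        field_simp
    _ ≤ _ := by gcongr

/-- The normalized sum has second moment 1, and |x| ≤ (1 + x²)/2. -/
theorem HasSmallOverlap.integral_abs_pathSum_le {Ω : Type*} [MeasurableSpace Ω]
    {P : Measure Ω} [IsProbabilityMeasure P] {w : ℕ × ℕ → Ω → ℝ} {K : ℝ}
    (hw : IsCentredArray P (S.box N) w K) {C : ℝ} (h : S.HasSmallOverlap C N)
    {σ : Finset (ℕ × ℕ)} (hσ : σ ∈ S.paths N) :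
    Integrable (fun ω => |S.pathSum N (fun a => w a ω) σ|) P ∧
      ∫ ω, |S.pathSum N (fun a => w a ω) σ| ∂P ≤ 1 := by
  have hbox := subset_box_of_mem_paths hσ
  have hN0 : (0 : ℝ) < N := by exact_mod_cast h.1
  have hl0 : 0 < (S.height N : ℝ) + N - 1 := hN0.trans_le h.le_length
  have hcard : (σ.card : ℝ) = (S.height N : ℝ) + N - 1 := by
    rw [card_of_mem_paths h.1 h.2.1 hσ, Nat.cast_sub (by have := h.1; omega)]
    push_cast
    ring
  have hmem : ∀ a ∈ σ, MemLp (w a) 2 P := fun a ha => by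
    rw [memLp_two_iff_integrable_sq (hw.measurable a (hbox ha)).aestronglyMeasurable]
    simpa using Integrable.pow_of_pow_six (hw.measurable a (hbox ha))
      (hw.integrable a (hbox ha)) (j := 2) (by norm_num)
  have hsum : MemLp (∑ a ∈ σ, w a) 2 P := memLp_finsetSum' _ hmem
  have hmean : ∫ ω, (∑ a ∈ σ, w a) ω ∂P = 0 := by
    simp only [Finset.sum_apply]
    rw [integral_finsetSum _ fun a ha => (hmem a ha).integrable one_le_two]
    exact Finset.sum_eq_zero fun a ha => hw.mean a (hbox ha)
  have hvar : ∫ ω, (∑ a ∈ σ, w a) ω ^ 2 ∂P = σ.card := by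
    rw [← variance_of_integral_eq_zero hsum.aestronglyMeasurable.aemeasurable hmean,
      IndepFun.variance_sum hmem]
    · rw [Finset.sum_congr rfl fun a ha => by
        rw [variance_of_integral_eq_zero (hw.measurable a (hbox ha)).aemeasurable
          (hw.mean a (hbox ha)), hw.second_moment a (hbox ha)]]
      simp
    · intro a ha b hb hab
      exact hw.indep.indepFun (i := ⟨a, hbox ha⟩) (j := ⟨b, hbox hb⟩)
        fun h => hab (congrArg Subtype.val h)
  have hX : ∀ ω, S.pathSum N (fun a => w a ω) σ
      = 1 / √((S.height N : ℝ) + N - 1) * (∑ a ∈ σ, w a) ω := fun ω => by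
    rw [pathSum, Finset.sum_apply]
  have hX1 : Integrable (fun ω => S.pathSum N (fun a => w a ω) σ) P := by
    simp only [hX]
    exact (hsum.integrable one_le_two).const_mul _
  have hX2 : Integrable (fun ω => S.pathSum N (fun a => w a ω) σ ^ 2) P := by
    simp only [hX, mul_pow]
    exact hsum.integrable_sq.const_mul _
  have hX3 : ∫ ω, S.pathSum N (fun a => w a ω) σ ^ 2 ∂P = 1 := by
    simp only [hX, mul_pow]
    rw [integral_const_mul, hvar, hcard, div_pow, Real.sq_sqrt hl0.le]
    field_simp
  refine ⟨hX1.abs, ?_⟩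
  calc ∫ ω, |S.pathSum N (fun a => w a ω) σ| ∂P
      ≤ ∫ ω, (1 / 2 + 1 / 2 * S.pathSum N (fun a => w a ω) σ ^ 2) ∂P := by
        refine integral_mono hX1.abs ((integrable_const _).add (hX2.const_mul _)) fun ω => ?_
        simp only
        nlinarith [sq_nonneg (|S.pathSum N (fun a => w a ω) σ| - 1),
          sq_abs (S.pathSum N (fun a => w a ω) σ)]
    _ = 1 := by
        rw [integral_add (integrable_const _) (hX2.const_mul _), integral_const_mul, hX3]
        norm_num

end PathScheme

/-! ### Almost sure weak convergence -/

theorem summable_one_div_sqrt_pow_three (D : ℝ) :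
    Summable fun N : ℕ => D * (1 / √(N : ℝ)) ^ 3 := by
  refine Summable.mul_left D ?_
  have h := Real.summable_one_div_nat_rpow.2 (by norm_num : (1 : ℝ) < 3 / 2)
  refine h.congr fun N => ?_
  rw [div_pow, one_pow, Real.sqrt_eq_rpow, ← Real.rpow_natCast, ← Real.rpow_mul (Nat.cast_nonneg N)]
  norm_num

theorem tendsto_const_mul_one_div_sqrt (D : ℝ) :
    Tendsto (fun N : ℕ => D * (1 / √(N : ℝ))) atTop (𝓝 0) := by
  have h : Tendsto (fun N : ℕ => 1 / √(N : ℝ)) atTop (𝓝 0) := by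
    simp only [one_div]
    exact (Real.tendsto_sqrt_atTop.comp tendsto_natCast_atTop_atTop).inv_tendsto_atTop
  simpa using h.const_mul D

namespace PathScheme

variable {Ω : Type*} [MeasurableSpace Ω] {P : Measure Ω} [IsProbabilityMeasure P]
  {S : PathScheme} {w : ℕ → ℕ × ℕ → Ω → ℝ} {K : ℝ} {C : ℝ}

theorem ae_tendsto_integral_quenchedMeasure_sub (hK0 : 0 ≤ K)
    (hw : ∀ N, IsCentredArray P (S.box N) (w N) K) (hC : ∀ᶠ N in atTop, S.HasSmallOverlap C N)
    {f : ℝ → ℝ} (hf : Measurable f) {B : ℝ} (hB : ∀ x, |f x| ≤ B) {Λ : ℝ} (hΛ : 0 ≤ Λ)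
    (hL : ∀ x y, |f x - f y| ≤ Λ * |x - y|) :
    ∀ᵐ ω ∂P, Tendsto (fun N => ∫ x, f x ∂S.quenchedMeasure N (fun a => w N a ω)
      - ∫ ω', ∫ x, f x ∂S.quenchedMeasure N (fun a => w N a ω') ∂P) atTop (𝓝 0) := by
  have hm : ∀ N, Measurable fun ω => ∫ x, f x ∂S.quenchedMeasure N (fun a => w N a ω) := fun N =>
    measurable_integral_quenchedMeasure (hw N).measurable hf
  refine ae_tendsto_zero_of_integral_pow_six_le (fun N => (hm N).sub_const _) (fun N => ?_)
    (summable_one_div_sqrt_pow_three (34 * centredMomentBound K ^ 3 * (Λ ^ 2 * C) ^ 3))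
    (hC.mono fun N h => h.integral_sub_integral_pow_six_le hK0 (hw N) hf hB hΛ hL)
  set E := ∫ ω', ∫ x, f x ∂S.quenchedMeasure N (fun a => w N a ω') ∂P
  refine integrable_of_measurable_of_abs_le (((hm N).sub_const _).pow_const 6)
    (B := (B + |E|) ^ 6) fun ω => ?_
  rw [abs_pow]
  exact pow_le_pow_left₀ (abs_nonneg _) ((abs_sub _ _).trans
    (add_le_add_left (abs_integral_quenchedMeasure_le hB _) _)) 6

theorem ae_tendsto_of_tendsto_integral (hK0 : 0 ≤ K)
    (hw : ∀ N, IsCentredArray P (S.box N) (w N) K) (hC : ∀ᶠ N in atTop, S.HasSmallOverlap C N)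
    {f : ℝ → ℝ} (hf : Measurable f) {B : ℝ} (hB : ∀ x, |f x| ≤ B) {Λ : ℝ} (hΛ : 0 ≤ Λ)
    (hL : ∀ x y, |f x - f y| ≤ Λ * |x - y|) {l : ℝ} {b : ℕ → ℝ} (hb : Tendsto b atTop (𝓝 0))
    (hl : ∀ᶠ N in atTop, ∀ σ ∈ S.paths N,
      |∫ ω, f (S.pathSum N (fun a => w N a ω) σ) ∂P - l| ≤ b N) :
    ∀ᵐ ω ∂P, Tendsto (fun N => ∫ x, f x ∂S.quenchedMeasure N (fun a => w N a ω)) atTop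
      (𝓝 l) := by
  have hE : Tendsto (fun N => ∫ ω, ∫ x, f x ∂S.quenchedMeasure N (fun a => w N a ω) ∂P - l)
      atTop (𝓝 0) := by
    refine squeeze_zero_norm' ?_ hb
    filter_upwards [hC, hl] with N h1 h2
    exact h1.abs_integral_integral_sub_le (hw N).measurable hf hB h2
  filter_upwards [ae_tendsto_integral_quenchedMeasure_sub hK0 hw hC hf hB hΛ hL] with ω hω
  have := (hω.add hE).add_const l
  simpa using this

/-- Concentration is available for real test functions, so cosine and sine are treated separately.
The exceptional null set depends on s, which is why only countably many s are used later. -/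
theorem ae_tendsto_charFun_quenchedMeasure (hK0 : 0 ≤ K)
    (hw : ∀ N, IsCentredArray P (S.box N) (w N) K) (hC : ∀ᶠ N in atTop, S.HasSmallOverlap C N)
    (s : ℝ) :
    ∀ᵐ ω ∂P, Tendsto (fun N => charFun (S.quenchedMeasure N (fun a => w N a ω)) s) atTop
      (𝓝 (charFun (gaussianReal 0 1) s)) := by
  have hb := tendsto_const_mul_one_div_sqrt ((4 * K + 5) * |s| ^ 3)
  have hs : ∀ᶠ N : ℕ in atTop, |s| ≤ √(N : ℝ) :=
    (Real.tendsto_sqrt_atTop.comp tendsto_natCast_atTop_atTop).eventually_ge_atTop _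
  have hexp : Complex.exp (-(s : ℂ) ^ 2 / 2) = ((Real.exp (-s ^ 2 / 2) : ℝ) : ℂ) := by
    push_cast; rfl
  have hchar : ∀ᶠ N in atTop, ∀ σ ∈ S.paths N,
      ‖(((∫ ω, Real.cos (s * S.pathSum N (fun a => w N a ω) σ) ∂P : ℝ) : ℂ)
        + ((∫ ω, Real.sin (s * S.pathSum N (fun a => w N a ω) σ) ∂P : ℝ) : ℂ) * Complex.I)
        - ((Real.exp (-s ^ 2 / 2) : ℝ) : ℂ)‖ ≤ (4 * K + 5) * |s| ^ 3 * (1 / √(N : ℝ)) := by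
    filter_upwards [hC, hs] with N h hs σ hσ
    have hm := measurable_pathSum (hw N).measurable hσ
    have := Measure.isProbabilityMeasure_map (μ := P) hm.aemeasurable
    have h1 := h.norm_charFun_pathSum_sub_le hK0 (hw N) hσ hs
    rwa [charFun_eq_integral_cos_add_integral_sin,
      integral_map hm.aemeasurable (by fun_prop), integral_map hm.aemeasurable (by fun_prop),
      hexp] at h1
  have hcos : ∀ᶠ N in atTop, ∀ σ ∈ S.paths N,
      |∫ ω, Real.cos (s * S.pathSum N (fun a => w N a ω) σ) ∂P - Real.exp (-s ^ 2 / 2)|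
        ≤ (4 * K + 5) * |s| ^ 3 * (1 / √(N : ℝ)) := by
    filter_upwards [hchar] with N h σ hσ
    refine le_trans (le_of_eq ?_) ((Complex.abs_re_le_norm _).trans (h σ hσ))
    simp [-Complex.ofReal_exp, Complex.ofReal_re]
  have hsin : ∀ᶠ N in atTop, ∀ σ ∈ S.paths N,
      |∫ ω, Real.sin (s * S.pathSum N (fun a => w N a ω) σ) ∂P - 0|
        ≤ (4 * K + 5) * |s| ^ 3 * (1 / √(N : ℝ)) := by
    filter_upwards [hchar] with N h σ hσ
    refine le_trans (le_of_eq ?_) ((Complex.abs_im_le_norm _).trans (h σ hσ))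
    simp [-Complex.ofReal_exp, Complex.ofReal_im]
  have hLc : ∀ x y, |Real.cos (s * x) - Real.cos (s * y)| ≤ |s| * |x - y| := fun x y => by
    rw [← abs_mul, mul_sub]
    simpa [Real.dist_eq] using Real.lipschitzWith_cos.dist_le_mul (s * x) (s * y)
  have hLs : ∀ x y, |Real.sin (s * x) - Real.sin (s * y)| ≤ |s| * |x - y| := fun x y => by
    rw [← abs_mul, mul_sub]
    simpa [Real.dist_eq] using Real.lipschitzWith_sin.dist_le_mul (s * x) (s * y)
  filter_upwards [ae_tendsto_of_tendsto_integral hK0 hw hC (f := fun x => Real.cos (s * x))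
      (by fun_prop) (fun x => Real.abs_cos_le_one _) (abs_nonneg s) hLc hb hcos,
    ae_tendsto_of_tendsto_integral hK0 hw hC (f := fun x => Real.sin (s * x))
      (by fun_prop) (fun x => Real.abs_sin_le_one _) (abs_nonneg s) hLs hb hsin] with ω h1 h2
  simp only [charFun_eq_integral_cos_add_integral_sin (S.quenchedMeasure _ _)]
  have h3 : charFun (gaussianReal 0 1) s
      = ((Real.exp (-s ^ 2 / 2) : ℝ) : ℂ) + ((0 : ℝ) : ℂ) * Complex.I := by
    rw [charFun_gaussianReal, ← hexp]
    simp
    ring_nf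
  rw [h3]
  exact ((Complex.continuous_ofReal.tendsto _).comp h1).add
    (((Complex.continuous_ofReal.tendsto _).comp h2).mul_const _)

theorem ae_eventually_integral_min_abs_le (hK0 : 0 ≤ K)
    (hw : ∀ N, IsCentredArray P (S.box N) (w N) K) (hC : ∀ᶠ N in atTop, S.HasSmallOverlap C N)
    (m : ℕ) :
    ∀ᵐ ω ∂P, ∀ᶠ N in atTop, ∫ x, min (|x| / (m + 1 : ℝ)) 2
      ∂S.quenchedMeasure N (fun a => w N a ω) ≤ 2 / (m + 1 : ℝ) := by
  have hm0 : (0 : ℝ) < (m : ℝ) + 1 := by positivity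
  -- The truncation at 2 makes the function bounded, as concentration requires, and still dominates
  -- the difference of two exponentials. Of the final bound 2/(m + 1), one half is for the mean and
  -- one for the fluctuation.
  set f : ℝ → ℝ := fun x => min (|x| / (m + 1 : ℝ)) 2 with hf
  have hf0 : ∀ x, 0 ≤ f x := fun x => by positivity
  have hfm : Measurable f := by fun_prop
  have hB : ∀ x, |f x| ≤ 2 := fun x => by rw [abs_of_nonneg (hf0 x)]; exact min_le_right _ _
  have hL : ∀ x y, |f x - f y| ≤ 1 / (m + 1 : ℝ) * |x - y| := fun x y => by
    refine (abs_min_sub_min_le_max _ _ _ _).trans (max_le ?_ (by simp; positivity))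
    rw [← sub_div, abs_div, abs_of_pos hm0, div_eq_mul_one_div, mul_comm]
    exact mul_le_mul_of_nonneg_left (abs_abs_sub_abs_le_abs_sub x y) (by positivity)
  have hE : ∀ᶠ N in atTop,
      |∫ ω, ∫ x, f x ∂S.quenchedMeasure N (fun a => w N a ω) ∂P - 0| ≤ 1 / (m + 1 : ℝ) := by
    filter_upwards [hC] with N h
    refine h.abs_integral_integral_sub_le (hw N).measurable hfm hB fun σ hσ => ?_
    obtain ⟨hi, hle⟩ := h.integral_abs_pathSum_le (hw N) hσ
    rw [sub_zero, abs_of_nonneg (integral_nonneg fun ω => hf0 _)]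
    calc ∫ ω, f (S.pathSum N (fun a => w N a ω) σ) ∂P
        ≤ ∫ ω, |S.pathSum N (fun a => w N a ω) σ| / (m + 1 : ℝ) ∂P :=
          integral_mono_of_nonneg (.of_forall fun ω => hf0 _) (hi.div_const _)
            (.of_forall fun ω => min_le_left _ _)
      _ ≤ _ := by rw [integral_div]; gcongr
  filter_upwards [ae_tendsto_integral_quenchedMeasure_sub hK0 hw hC hfm hB (by positivity) hL]
    with ω hω
  filter_upwards [hE, hω.eventually (gt_mem_nhds (show 0 < 1 / (m + 1 : ℝ) by positivity))]
    with N h1 h2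
  rw [sub_zero] at h1
  have h3 := (le_abs_self _).trans h1
  have : 2 / (m + 1 : ℝ) = 1 / (m + 1 : ℝ) + 1 / (m + 1 : ℝ) := by ring
  linarith

/-- The quenched measure is the zero measure when there is no path. Putting ν in its place for those
N makes the characteristic function criterion for probability measures applicable. -/
theorem tendsto_quenchedLaw_of_forall_tendsto {v : ℕ → ℕ × ℕ → ℝ} {ν : ProbabilityMeasure ℝ}
    (hne : ∀ᶠ N in atTop, (S.paths N).Nonempty)
    (h : ∀ ρ : ℕ → ProbabilityMeasure ℝ,
      (∀ᶠ N in atTop, (ρ N : Measure ℝ) = S.quenchedMeasure N (v N)) → Tendsto ρ atTop (𝓝 ν)) :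
    Tendsto (fun N => S.quenchedLaw N (v N)) atTop (𝓝 ν.toFiniteMeasure) := by
  have hex : ∀ N, ∃ ρ : ProbabilityMeasure ℝ, (S.paths N).Nonempty →
      (ρ : Measure ℝ) = S.quenchedMeasure N (v N) := fun N => by
    by_cases hN : (S.paths N).Nonempty
    · exact ⟨⟨_, S.isProbabilityMeasure_quenchedMeasure N (v N) hN⟩, fun _ => rfl⟩
    · exact ⟨ν, fun h' => absurd h' hN⟩
  choose ρ hρ using hex
  have hρN := hne.mono hρ
  have hlim := h ρ hρN
  rw [ProbabilityMeasure.tendsto_nhds_iff_toFiniteMeasure_tendsto_nhds] at hlim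
  exact hlim.congr' (hρN.mono fun N h => Subtype.ext h)

theorem ae_tendsto_quenchedLaw (hK0 : 0 ≤ K)
    (hw : ∀ N, IsCentredArray P (S.box N) (w N) K) :
    ∀ᵐ ω ∂P, Tendsto (fun N => S.quenchedLaw N (fun a => w N a ω)) atTop (𝓝 stdNormal) := by
  obtain ⟨C, hC⟩ := S.exists_hasSmallOverlap
  have h1 := ae_all_iff.2 fun q : ℚ => ae_tendsto_charFun_quenchedMeasure hK0 hw hC (q : ℝ)
  have h2 := ae_all_iff.2 fun m : ℕ => ae_eventually_integral_min_abs_le hK0 hw hC m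
  filter_upwards [h1, h2] with ω h1 h2
  refine tendsto_quenchedLaw_of_forall_tendsto (v := fun N a => w N a ω)
    (ν := ⟨gaussianReal 0 1, inferInstance⟩) (hC.mono fun N h => h.2.2.1) fun ρ hρ => ?_
  refine ProbabilityMeasure.tendsto_of_tendsto_charFun_ratCast (fun q => ?_) fun m => ?_
  · exact (h1 q).congr' (hρ.mono fun N h => by simp only [h])
  · filter_upwards [hρ, h2 m] with N h h'
    rwa [h]

theorem convergesWeaklyInProbability_of_ae_tendsto (hw : ∀ N, ∀ a ∈ S.box N, Measurable (w N a))
    {ν : FiniteMeasure ℝ} (h : ∀ᵐ ω ∂P, Tendsto (fun N => S.quenchedLaw N (fun a => w N a ω)) atTop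
      (𝓝 ν)) :
    ConvergesWeaklyInProbability P (fun N ω => S.quenchedLaw N (fun a => w N a ω)) ν := by
  intro f ε hε
  have hm : ∀ N, AEStronglyMeasurable
      (fun ω => ∫ t, f t ∂(S.quenchedLaw N (fun a => w N a ω) : Measure ℝ)) P := fun N =>
    (measurable_integral_quenchedMeasure (hw N) f.continuous.measurable).aestronglyMeasurable
  have hae : ∀ᵐ ω ∂P, Tendsto
      (fun N => ∫ t, f t ∂(S.quenchedLaw N (fun a => w N a ω) : Measure ℝ)) atTop
      (𝓝 (∫ t, f t ∂(ν : Measure ℝ))) := by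
    filter_upwards [h] with ω hω
    exact FiniteMeasure.tendsto_iff_forall_integral_tendsto.1 hω f
  have h1 := tendstoInMeasure_of_tendsto_ae hm hae (ENNReal.ofReal ε) (by simpa using hε)
  refine tendsto_of_tendsto_of_tendsto_of_le_of_le tendsto_const_nhds h1 (fun N => zero_le)
    fun N => measure_mono fun ω hω => ?_
  simp only [Set.mem_ofPred_eq] at hω ⊢
  rw [edist_dist, Real.dist_eq]
  exact ENNReal.ofReal_le_ofReal hω.le

end PathScheme

theorem theorem1p2 {Ω : Type*} [MeasurableSpace Ω] (P : Measure Ω) [IsProbabilityMeasure P]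
    (S : PathScheme) (w : ℕ → ℕ × ℕ → Ω → ℝ) (p : ℝ) (K : ℝ≥0)
    (hmeas : ∀ N, ∀ a ∈ S.box N, Measurable (w N a))
    (hindep : ∀ N, iIndepFun (fun a : S.box N => w N a) P)
    (hmean : ∀ N, ∀ a ∈ S.box N, ∫ ω, w N a ω ∂P = 0)
    (hvar : ∀ N, ∀ a ∈ S.box N, variance (w N a) P = 1)
    (hmoment : ∀ N, ∀ a ∈ S.box N, ∫⁻ ω, ‖w N a ω‖ₑ ^ p ∂P ≤ (K : ℝ≥0∞)) :
    (8 < p →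
      ConvergesWeaklyInProbability P
        (fun N ω => S.quenchedLaw N (fun a => w N a ω)) stdNormal) ∧
    (12 < p →
      ∀ᵐ ω ∂P, Tendsto (fun N => S.quenchedLaw N (fun a => w N a ω)) atTop (𝓝 stdNormal)) := by
  -- The sixth moment is at most 1 + K, since x⁶ ≤ 1 + |x|^p for p ≥ 6. This almost sure statement
  -- yields both claims.
  have hae : 6 ≤ p →
      ∀ᵐ ω ∂P, Tendsto (fun N => S.quenchedLaw N (fun a => w N a ω)) atTop (𝓝 stdNormal) :=
    fun hp => PathScheme.ae_tendsto_quenchedLaw (K := 1 + K) (by positivity) fun N =>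
      { measurable := hmeas N
        indep := hindep N
        integrable := fun a ha =>
          (integrable_pow_six_of_lintegral_le (hmeas N a ha) hp (hmoment N a ha)).1
        moment_le := fun a ha =>
          (integrable_pow_six_of_lintegral_le (hmeas N a ha) hp (hmoment N a ha)).2
        mean := hmean N
        second_moment := fun a ha => by
          rw [← hvar N a ha, variance_of_integral_eq_zero (hmeas N a ha).aemeasurable
            (hmean N a ha)] }
  exact ⟨fun hp => PathScheme.convergesWeaklyInProbability_of_ae_tendsto hmeas
    (hae (by linarith)), fun hp => hae (by linarith)⟩
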